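/- Let $M$ be a connected smooth $n$-dimensional manifold without boundary and let $F:M\to\mathbb R^{n+1}$ be a smooth immersion with smooth unit normal field (Gauss map) $N:M\to S^n\subset\mathbb R^{n+1}$. Let $A(X,Y)=\langle\bar\nabla_XY,N\rangle$ be the second fundamental form, where $\bar\nabla$ is the flat connection of $\mathbb R^{n+1}$, and let $H$ be its trace with respect to the metric induced by $F$. For a real constant $\lambda$, we say that $M$ has constant weighted mean curvature $\lambda$ in the Gaussian space $\mathbb R^{n+1}$ (or is a $\lambda$-hypersurface, with unit normal $N$) if $$H+\tfrac12\langle F,N\rangle=\lambda\qquad\text{on } M .$$ Suppose that $M$ has constant weighted mean curvature $\lambda$, that the induced metric is complete, and that $F$ is proper. Let $1\le p\le n+1$ and suppose that the image of $N$ lies in the intersection of the closed hemispheres $x_{n+2-p}\ge0,\dots,x_{n+1}\ge0$. Then at least one of the following holds: (i) $M$ is a hyperplane, that is, $F$ maps $M$ injectively onto an affine hyperplane of $\mathbb R^{n+1}$; or (ii) $p\le n$, and $M$ splits isometrically as $M^n=\tilde M^{n-p}\times\mathbb R^p$, where $\tilde M^{n-p}$ is a connected smooth immersed hypersurface with constant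 weighted mean curvature $\lambda$ in the Gaussian space $\mathbb R^{n+1-p}\times\{0\}^p$. More precisely, there are such an $\tilde M$, with immersion $\tilde F:\tilde M\to\mathbb R^{n+1-p}$ and unit normal $\tilde N$, and a diffeomorphism $\Phi:\tilde M\times\mathbb R^p\to M$ which is an isometry from the Riemannian product of $\tilde M$ (with its induced metric) and $\mathbb R^p$ to $M$, such that $F(\Phi(m,t))=(\tilde F(m),t)$ and $N(\Phi(m,t))=(\tilde N(m),0)$ for all $m\in\tilde M$ and $t\in\mathbb R^p$. -/

import Mathlib

open Set Filter Topology MeasureTheory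
open scoped Manifold ContDiff ENNReal

universe u

noncomputable section

namespace GaussianHypersurface

/-- The Euclidean space of dimension `d`, with its canonical inner product. -/
abbrev E (d : ℕ) : Type := EuclideanSpace ℝ (Fin d)

section Immersion

variable {n : ℕ} {M : Type*} [TopologicalSpace M] [ChartedSpace (E n) M]

/-- The Riemannian metric induced on `M` by `F : M → ℝⁿ⁺¹` (the first fundamental form):
`g_x(v, w) = ⟨dF_x v, dF_x w⟩`. -/
def inducedMetric (F : M → E (n + 1)) (x : M) (v w : TangentSpace (𝓡 n) x) : ℝ :=
  @inner ℝ (E (n + 1)) _ (mfderiv (𝓡 n) (𝓡 (n + 1)) F x v) (mfderiv (𝓡 n) (𝓡 (n + 1)) F x w)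

/-- The length, for the induced metric, of a curve `γ : [0, 1] → M`. -/
def curveLength (F : M → E (n + 1)) (γ : ℝ → M) : ℝ≥0∞ :=
  ∫⁻ t in Icc (0 : ℝ) 1, ENNReal.ofReal (Real.sqrt (inducedMetric F (γ t)
    (mfderivWithin 𝓘(ℝ, ℝ) (𝓡 n) γ (Icc 0 1) t (1 : ℝ))
    (mfderivWithin 𝓘(ℝ, ℝ) (𝓡 n) γ (Icc 0 1) t (1 : ℝ))))

/-- The Riemannian distance of the induced metric: the infimum of the lengths of the `C¹` curves
from `x` to `y`. -/
def inducedEDist (F : M → E (n + 1)) (x y : M) : ℝ≥0∞ :=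
  ⨅ (γ : ℝ → M) (_ : ContMDiffOn 𝓘(ℝ, ℝ) (𝓡 n) 1 γ (Icc 0 1)) (_ : γ 0 = x) (_ : γ 1 = y),
    curveLength F γ

/-- The induced Riemannian metric is complete: every sequence that is Cauchy for the Riemannian
distance converges in `M`. -/
def IsCompleteHypersurface (F : M → E (n + 1)) : Prop :=
  ∀ u : ℕ → M,
    (∀ ε : ℝ≥0∞, 0 < ε → ∃ K : ℕ, ∀ i ≥ K, ∀ j ≥ K, inducedEDist F (u i) (u j) < ε) →
      ∃ x : M, Tendsto u atTop (𝓝 x)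

/-- `F : M → ℝⁿ⁺¹` is a (connected) smooth immersed hypersurface, where `M` is a smooth manifold
of dimension `n` without boundary. -/
structure IsImmersedHypersurface (F : M → E (n + 1)) : Prop where
  smoothManifold : IsManifold (𝓡 n) ∞ M
  t2 : T2Space M
  secondCountable : SecondCountableTopology M
  connected : ConnectedSpace M
  smooth : ContMDiff (𝓡 n) (𝓡 (n + 1)) ∞ F
  immersion : ∀ x : M, Function.Injective (mfderiv (𝓡 n) (𝓡 (n + 1)) F x)

/-- `N : M → Sⁿ ⊆ ℝⁿ⁺¹` is a smooth unit normal field along `F`, that is, a Gauss map of the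
hypersurface. -/
structure IsGaussMap (F N : M → E (n + 1)) : Prop where
  smooth : ContMDiff (𝓡 n) (𝓡 (n + 1)) ∞ N
  norm_eq_one : ∀ x : M, ‖N x‖ = 1
  orthogonal : ∀ (x : M) (v : TangentSpace (𝓡 n) x),
    @inner ℝ (E (n + 1)) _ (N x) (mfderiv (𝓡 n) (𝓡 (n + 1)) F x v) = 0

/-- The (scalar) second fundamental form `A_x(v, w) = ⟨∇̄_v W, N⟩`, where `∇̄` is the flat
connection of `ℝⁿ⁺¹` and `W` is a tangent field that extends `w`. The tangent space at `x` is
`ℝⁿ` through the preferred chart `φ` at `x`; for `W` the field with constant coordinates in this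
chart, `∇̄_v W` is the second derivative of the local parametrization `F ∘ φ⁻¹` in the directions
`v`, `w`. -/
def secondFundamentalForm (F N : M → E (n + 1)) (x : M) (v w : TangentSpace (𝓡 n) x) : ℝ :=
  inner ℝ
    (fderiv ℝ (fderiv ℝ (F ∘ (extChartAt (𝓡 n) x).symm)) (extChartAt (𝓡 n) x x)
      (v : E n) (w : E n))
    (N x)

/-- The `i`-th coordinate vector of the tangent space at `x`. -/
def coordVector (x : M) (i : Fin n) : TangentSpace (𝓡 n) x :=
  (EuclideanSpace.single i (1 : ℝ) : E n)

/-- The mean curvature `H`, the trace of the second fundamental form with respect to the induced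
metric: `H = ∑ᵢⱼ gⁱʲ Aᵢⱼ`. -/
def meanCurvature (F N : M → E (n + 1)) (x : M) : ℝ :=
  Matrix.trace
    ((Matrix.of fun i j : Fin n => inducedMetric F x (coordVector x i) (coordVector x j))⁻¹ *
      Matrix.of fun i j : Fin n =>
        secondFundamentalForm F N x (coordVector x i) (coordVector x j))

/-- `F : M → ℝⁿ⁺¹` is a hypersurface with unit normal `N` which has constant weighted mean
curvature `lam` in the Gaussian space: `H + ⟨x, N⟩ / 2 = lam`. -/
structure IsLambdaHypersurface (F N : M → E (n + 1)) (lam : ℝ) : Prop where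
  hypersurface : IsImmersedHypersurface F
  gaussMap : IsGaussMap F N
  weightedMeanCurvature_eq : ∀ x : M, meanCurvature F N x + 1 / 2 * inner ℝ (F x) (N x) = lam

/-- The hypersurface is a hyperplane: `F` maps `M` injectively onto an affine hyperplane. -/
def IsHyperplane (F : M → E (n + 1)) : Prop :=
  Function.Injective F ∧
    ∃ (V : E (n + 1)) (c : ℝ), V ≠ 0 ∧ range F = {y : E (n + 1) | inner ℝ V y = c}

/-- The hypersurface `F : M → ℝⁿ⁺¹` with normal `N` splits isometrically as `M' × ℝᵖ`, where
`G : M' → ℝᵏ⁺¹ = ℝᵏ⁺¹ × {0}ᵖ`, `k = n - p`, has normal `N'`: there is an isometric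
diffeomorphism `Φ` from the Riemannian product `M' × ℝᵖ` to `M` in terms of which
`F (m, t) = (G m, t)` and `N (m, t) = (N' m, 0)`. -/
def SplitsAs (F N : M → E (n + 1)) {k p : ℕ} (hk : k + p = n)
    {M' : Type*} [TopologicalSpace M'] [ChartedSpace (E k) M'] (G N' : M' → E (k + 1)) : Prop :=
  ∃ Φ : (M' × E p) ≃ₘ^∞⟮(𝓡 k).prod (𝓡 p), 𝓡 n⟯ M,
    (∀ (q : M' × E p) (v w : TangentSpace ((𝓡 k).prod (𝓡 p)) q),
      inducedMetric F (Φ q) (mfderiv ((𝓡 k).prod (𝓡 p)) (𝓡 n) Φ q v)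
          (mfderiv ((𝓡 k).prod (𝓡 p)) (𝓡 n) Φ q w) =
        inducedMetric G q.1 v.1 w.1 + @inner ℝ (E p) _ v.2 w.2) ∧
    ∀ (m : M') (t : E p),
      (∀ i : Fin (k + 1), F (Φ (m, t)) ⟨i, by omega⟩ = G m i ∧
        N (Φ (m, t)) ⟨i, by omega⟩ = N' m i) ∧
      (∀ j : Fin p, F (Φ (m, t)) ⟨k + 1 + j, by omega⟩ = t j ∧
        N (Φ (m, t)) ⟨k + 1 + j, by omega⟩ = 0)

end Immersion

end GaussianHypersurface

end

/-! Fix a vector V with u = ⟨V, N⟩ ≥ 0. Differentiating the equation H + ⟨F, N⟩/2 = λ and using the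
Codazzi symmetry shows that the drift Laplacian L = Δ - ½⟨F, ∇ ·⟩ satisfies L u = -|A|² u ≤ 0
(`drift_laplacian_normal`), so u is a nonnegative supersolution.

Its infimum is attained. Since L‖F‖² = 2n + 2λ⟨F, N⟩ - ‖F‖² is negative far from the origin, u +
ε‖F‖² has its minimum in a ball whose radius does not depend on ε, and properness makes the preimage
of this ball compact (`exists_forall_inner_normal_le`). A Hopf barrier gives the strong minimum
principle (`eventually_eq_of_forall_le`), and connectedness makes u constant (`inner_normal_const`).
If the constant is positive, L u = -|A|² u forces A = 0, and N is constant.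

Apply this to V = e_i for the last p coordinates. If some N_i is not identically zero, N is
constant. Otherwise the last p directions are tangent to M at every point. Both cases rest on one
construction (`exists_translation`): the vectors orthogonal to all normals act on M by lifted
translations, because small translations lift locally through the immersion and properness gives a
uniform step size. When N is constant, this group is the whole hyperplane orthogonal to N and acts
with a single orbit, so F is injective with an affine hyperplane as image. When N_i = 0 for the last
p indices, the action of ℝᵖ turns M into the product of ℝᵖ with the slice on which the last p
coordinates of F vanish (`exists_splitsAs`). In an orthonormal frame adapted to the product the ℝᵖ
directions add nothing to H, so the slice satisfies the equation with the same λ. -/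

noncomputable section

namespace GaussianHypersurface

/-! ### Traces of bilinear forms with respect to an induced inner product -/

section Trace

variable {X X' Y : Type*} [NormedAddCommGroup X] [NormedSpace ℝ X]
  [NormedAddCommGroup X'] [NormedSpace ℝ X'] [NormedAddCommGroup Y] [InnerProductSpace ℝ Y]

/-- The trace of the bilinear form `⟨B v w, ν⟩` with respect to the inner product `⟨D v, D w⟩`,
computed in the family `b`. -/
def formTrace {ι : Type*} [Fintype ι] [DecidableEq ι] (D : X →L[ℝ] Y) (B : X →L[ℝ] X →L[ℝ] Y)
    (ν : Y) (b : ι → X) : ℝ :=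
  Matrix.trace ((Matrix.of fun i j : ι => inner ℝ (D (b i)) (D (b j)))⁻¹ *
    Matrix.of fun i j : ι => inner ℝ (B (b i) (b j)) ν)

lemma gram_isUnit_det {ι : Type*} [Fintype ι] [DecidableEq ι] {D : X →L[ℝ] Y}
    (hD : Function.Injective D) {b : ι → X} (hb : LinearIndependent ℝ b) :
    IsUnit (Matrix.of fun i j : ι => inner ℝ (D (b i)) (D (b j))).det := by
  have h1 : LinearIndependent ℝ (fun i => D (b i)) :=
    hb.map' (D : X →ₗ[ℝ] Y) (LinearMap.ker_eq_bot.2 hD)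
  exact (Matrix.posDef_gram_of_linearIndependent h1).det_pos.ne'.isUnit

/-- A change of basis Q turns G and A into QᵀGQ and QᵀAQ, so G⁻¹A is conjugated and keeps its trace.
The two index types may differ because a product parametrization is indexed by a sum type. -/
lemma formTrace_basis_eq {ι ι' : Type*} [Fintype ι] [DecidableEq ι] [Fintype ι'] [DecidableEq ι']
    {D : X →L[ℝ] Y} (hD : Function.Injective D) (B : X →L[ℝ] X →L[ℝ] Y) (ν : Y)
    (b : Module.Basis ι ℝ X) (b' : Module.Basis ι' ℝ X) :
    formTrace D B ν b' = formTrace D B ν b := by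
  unfold formTrace
  set G := Matrix.of fun i j : ι => inner ℝ (D (b i)) (D (b j)) with hG
  set A := Matrix.of fun i j : ι => inner ℝ (B (b i) (b j)) ν with hA
  set Q := b.toMatrix b'
  set R := b'.toMatrix b
  have hQR : Q * R = 1 := b.toMatrix_mul_toMatrix_flip b'
  have hRQ : R * Q = 1 := b'.toMatrix_mul_toMatrix_flip b
  have hb' : ∀ j, b' j = ∑ i, Q i j • b i := fun j => (b.sum_toMatrix_smul_self b' j).symm
  have hGu : IsUnit G.det := gram_isUnit_det hD b.linearIndependent
  have e1 : (Matrix.of fun i j : ι' => inner ℝ (D (b' i)) (D (b' j))) = Q.transpose * G * Q := by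
    ext i j
    simp only [Matrix.of_apply, Matrix.mul_apply, Matrix.transpose_apply, hG, hb', map_sum,
      map_smul, sum_inner, inner_sum, real_inner_smul_left, real_inner_smul_right, Finset.sum_mul]
    refine Finset.sum_congr rfl fun x _ => Finset.sum_congr rfl fun y _ => by ring
  have e2 : (Matrix.of fun i j : ι' => inner ℝ (B (b' i) (b' j)) ν) = Q.transpose * A * Q := by
    ext i j
    simp only [Matrix.of_apply, Matrix.mul_apply, Matrix.transpose_apply, hA, hb', map_sum,
      map_smul, sum_inner, real_inner_smul_left, Finset.sum_mul,
      Finset.mul_sum, sum_apply, smul_apply]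
    refine Finset.sum_congr rfl fun x _ => Finset.sum_congr rfl fun y _ => by ring
  have e3 : (Q.transpose * G * Q)⁻¹ = R * G⁻¹ * R.transpose := by
    apply Matrix.inv_eq_right_inv
    calc Q.transpose * G * Q * (R * G⁻¹ * R.transpose)
        = Q.transpose * G * (Q * R) * G⁻¹ * R.transpose := by simp only [Matrix.mul_assoc]
      _ = Q.transpose * (G * G⁻¹) * R.transpose := by
          rw [hQR]; simp only [Matrix.mul_assoc, Matrix.one_mul]
      _ = 1 := by
          rw [Matrix.mul_nonsing_inv _ hGu, Matrix.mul_one, ← Matrix.transpose_mul, hRQ,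
            Matrix.transpose_one]
  rw [e1, e2, e3]
  calc Matrix.trace (R * G⁻¹ * R.transpose * (Q.transpose * A * Q))
      = Matrix.trace (R * (G⁻¹ * (R.transpose * Q.transpose) * A * Q)) := by
        simp only [Matrix.mul_assoc]
    _ = Matrix.trace (G⁻¹ * (R.transpose * Q.transpose) * A * Q * R) := by
        rw [Matrix.trace_mul_comm]
    _ = Matrix.trace (G⁻¹ * A) := by
        rw [← Matrix.transpose_mul, hQR, Matrix.transpose_one, Matrix.mul_one, Matrix.mul_assoc,
          hQR, Matrix.mul_one]

lemma formTrace_orthonormal {ι : Type*} [Fintype ι] [DecidableEq ι] {D : X →L[ℝ] Y}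
    (B : X →L[ℝ] X →L[ℝ] Y) (ν : Y) (b : ι → X) (hb : Orthonormal ℝ fun i => D (b i)) :
    formTrace D B ν b = ∑ i, inner ℝ (B (b i) (b i)) ν := by
  have : (Matrix.of fun i j : ι => inner ℝ (D (b i)) (D (b j))) = 1 := by
    ext i j
    rw [Matrix.of_apply, orthonormal_iff_ite.1 hb i j, Matrix.one_apply]
  simp [formTrace, this, Matrix.trace]

end Trace

/-! ### Second derivatives: chain rule and the test at a minimum -/

section SecondDerivative

variable {X X' Y : Type*} [NormedAddCommGroup X] [NormedSpace ℝ X]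
  [NormedAddCommGroup X'] [NormedSpace ℝ X'] [NormedAddCommGroup Y] [NormedSpace ℝ Y]

lemma fderiv_differentiableAt {f : X → Y} {x : X} (hf : ContDiffAt ℝ 2 f x) :
    DifferentiableAt ℝ (fderiv ℝ f) x :=
  (hf.fderiv_right (m := 1) (by norm_num)).differentiableAt (by norm_num)

/-- The second summand lies in the image of Df, hence is tangent to a hypersurface parametrized by
f. Pairing with the normal kills it, and a suitable τ uses it to cancel the tangential part of D²f.
-/
lemma fderiv_fderiv_comp {f : X → Y} {τ : X' → X} {y : X'} (hf : ContDiffAt ℝ 2 f (τ y))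
    (hτ : ContDiffAt ℝ 2 τ y) (v w : X') :
    fderiv ℝ (fderiv ℝ (f ∘ τ)) y v w =
      fderiv ℝ (fderiv ℝ f) (τ y) (fderiv ℝ τ y v) (fderiv ℝ τ y w) +
        fderiv ℝ f (τ y) (fderiv ℝ (fderiv ℝ τ) y v w) := by
  have h1 : fderiv ℝ (f ∘ τ) =ᶠ[𝓝 y] fun z => (fderiv ℝ f (τ z)).comp (fderiv ℝ τ z) := by
    filter_upwards [hτ.eventually (by simp),
      hτ.continuousAt.eventually (hf.eventually (by simp))] with z hz1 hz2
    exact fderiv_comp z (hz2.differentiableAt (by norm_num)) (hz1.differentiableAt (by norm_num))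
  have h2 : HasFDerivAt (fun z => fderiv ℝ f (τ z))
      ((fderiv ℝ (fderiv ℝ f) (τ y)).comp (fderiv ℝ τ y)) y :=
    (fderiv_differentiableAt hf).hasFDerivAt.comp y
      (hτ.differentiableAt (by norm_num)).hasFDerivAt
  rw [h1.fderiv_eq, (h2.clm_comp (fderiv_differentiableAt hτ).hasFDerivAt).fderiv]
  simp [add_comm]

/-- A negative second derivative would make x a local maximum as well, so g would be locally
constant and its second derivative zero. -/
lemma deriv_deriv_nonneg_of_isLocalMin {g : ℝ → ℝ} {x : ℝ} (h : IsLocalMin g x)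
    (hc : ContinuousAt g x) : 0 ≤ deriv (deriv g) x := by
  by_contra! hneg
  have hmax := isLocalMax_of_deriv_deriv_neg hneg h.deriv_eq_zero hc
  have hconst : g =ᶠ[𝓝 x] fun _ => g x := by
    filter_upwards [h, hmax] with y h1 h2 using le_antisymm h2 h1
  have h1 : deriv g =ᶠ[𝓝 x] fun _ => 0 := by
    filter_upwards [hconst.deriv] with y hy
    simpa using hy
  have h2 := h1.deriv_eq
  simp at h2
  exact hneg.ne h2

lemma fderiv_fderiv_nonneg_of_isLocalMin {w : X → ℝ} {x : X} (h : IsLocalMin w x)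
    (hw : ContDiffAt ℝ 2 w x) (v : X) : 0 ≤ fderiv ℝ (fderiv ℝ w) x v v := by
  set τ : ℝ → X := fun t => x + t • v with hτ
  have hτ0 : τ 0 = x := by simp [hτ]
  have hτs : ContDiff ℝ 2 τ := by fun_prop
  have hw' : ContDiffAt ℝ 2 w (τ 0) := by rwa [hτ0]
  have hd : ∀ t, HasFDerivAt τ ((1 : ℝ →L[ℝ] ℝ).smulRight v) t := by
    intro t
    exact ((hasFDerivAt_id t).smul_const v).const_add x
  have hd1 : fderiv ℝ τ = fun _ => (1 : ℝ →L[ℝ] ℝ).smulRight v := funext fun t => (hd t).fderiv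
  have key := fderiv_fderiv_comp hw' hτs.contDiffAt (1 : ℝ) 1
  rw [hd1, hτ0] at key
  simp at key
  rw [← key]
  have hloc : IsLocalMin (w ∘ τ) 0 := by
    have : Tendsto τ (𝓝 0) (𝓝 x) := by
      have := hτs.continuous.tendsto 0
      rwa [hτ0] at this
    have h2 := this.eventually h
    filter_upwards [h2] with t ht
    simpa [hτ0] using ht
  have hcomp : ContDiffAt ℝ 2 (w ∘ τ) 0 := hw'.comp 0 hτs.contDiffAt
  have h3 := deriv_deriv_nonneg_of_isLocalMin hloc hcomp.continuousAt
  have h4 : deriv (w ∘ τ) = fun t => fderiv ℝ (w ∘ τ) t 1 := by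
    ext t; exact (fderiv_apply_one_eq_deriv).symm
  rw [h4, ← fderiv_apply_one_eq_deriv, fderiv_clm_apply (fderiv_differentiableAt hcomp)
    (differentiableAt_const _)] at h3
  simpa using h3

end SecondDerivative

end GaussianHypersurface

namespace GaussianHypersurface

/-! ### Derivative of tr(G⁻¹A) where G = 1 and dG = 0 -/

section TraceDerivative

variable {X : Type*} [NormedAddCommGroup X] [NormedSpace ℝ X]
  {ι : Type*} [Fintype ι] [DecidableEq ι]

lemma continuousAt_matrix_inv_apply {X : Type*} [TopologicalSpace X] {G : X → Matrix ι ι ℝ} {x : X} (h1 : G x = 1)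
    (hG : ∀ i j, ContinuousAt (fun y => G y i j) x) (i j : ι) :
    ContinuousAt (fun y => (G y)⁻¹ i j) x := by
  have hGc : ContinuousAt G x := continuousAt_pi.2 fun i => continuousAt_pi.2 fun j => hG i j
  have hd : ContinuousAt (fun y => (G y).det) x :=
    (Continuous.matrix_det continuous_id).continuousAt.comp hGc
  have ha : ContinuousAt (fun y => (G y).adjugate i j) x :=
    ((Continuous.matrix_adjugate continuous_id).matrix_elem i j).continuousAt.comp hGc
  have : (fun y => (G y)⁻¹ i j) = fun y => ((G y).det)⁻¹ * (G y).adjugate i j := by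
    ext y
    simp [Matrix.inv_def]
  rw [this]
  exact (hd.inv₀ (by simp [h1])).mul ha

/-- Here g is o(|y - x|), so a factor that is merely bounded near x does no harm. The factor will be
an entry of G⁻¹, known only to be continuous at that stage. -/
lemma hasFDerivAt_zero_of_continuousAt_mul {c g : X → ℝ} {x : X} (hc : ContinuousAt c x)
    (hg0 : g x = 0) (hg : HasFDerivAt g (0 : X →L[ℝ] ℝ) x) :
    HasFDerivAt (fun y => c y * g y) (0 : X →L[ℝ] ℝ) x := by
  rw [hasFDerivAt_iff_isLittleO] at hg ⊢
  simp only [hg0, zero_apply, sub_zero, mul_zero] at hg ⊢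
  have h1 := (hc.isBigO_one ℝ).mul_isLittleO hg.norm_right
  simp only [one_mul] at h1
  exact h1.of_norm_right

lemma hasFDerivAt_matrix_inv_apply {G : X → Matrix ι ι ℝ} {x : X} (h1 : G x = 1)
    (hG : ∀ i j, HasFDerivAt (fun y => G y i j) (0 : X →L[ℝ] ℝ) x) (i j : ι) :
    HasFDerivAt (fun y => (G y)⁻¹ i j) (0 : X →L[ℝ] ℝ) x := by
  have hcont := continuousAt_matrix_inv_apply h1 fun i j => (hG i j).continuousAt
  have hGc : ContinuousAt G x :=
    continuousAt_pi.2 fun i => continuousAt_pi.2 fun j => (hG i j).continuousAt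
  have hd : ∀ᶠ y in 𝓝 x, (G y).det ≠ 0 :=
    ((Continuous.matrix_det continuous_id).continuousAt.comp hGc).eventually_ne (by simp [h1])
  -- The identity G⁻¹ = 1 - G⁻¹(G - 1) avoids differentiating matrix inversion: G - 1 vanishes to
  -- first order.
  have heq : (fun y => (G y)⁻¹ i j) =ᶠ[𝓝 x]
      fun y => (1 : Matrix ι ι ℝ) i j - ∑ k, (G y)⁻¹ i k * (G y k j - (1 : Matrix ι ι ℝ) k j) := by
    filter_upwards [hd] with y hy
    have : (G y)⁻¹ = 1 - (G y)⁻¹ * (G y - 1) := by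
      rw [mul_sub, Matrix.nonsing_inv_mul _ (isUnit_iff_ne_zero.2 hy)]
      simp
    conv_lhs => rw [this]
    simp [Matrix.mul_apply]
  refine HasFDerivAt.congr_of_eventuallyEq ?_ heq
  have hs : HasFDerivAt (fun y => ∑ k, (G y)⁻¹ i k * (G y k j - (1 : Matrix ι ι ℝ) k j))
      (∑ k : ι, (0 : X →L[ℝ] ℝ)) x :=
    HasFDerivAt.fun_sum fun k _ => hasFDerivAt_zero_of_continuousAt_mul (hcont i k) (by simp [h1])
      ((hG k j).sub_const _)
  simpa using hs.const_sub ((1 : Matrix ι ι ℝ) i j)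

lemma hasFDerivAt_trace_inv_mul {G A : X → Matrix ι ι ℝ} {x : X} (h1 : G x = 1)
    (hG : ∀ i j, HasFDerivAt (fun y => G y i j) (0 : X →L[ℝ] ℝ) x)
    {A' : ι → ι → X →L[ℝ] ℝ} (hA : ∀ i j, HasFDerivAt (fun y => A y i j) (A' i j) x) :
    HasFDerivAt (fun y => Matrix.trace ((G y)⁻¹ * A y)) (∑ i, A' i i) x := by
  have h : HasFDerivAt (fun y => ∑ i, ∑ j, (G y)⁻¹ i j * A y j i)
      (∑ i, ∑ j, ((G x)⁻¹ i j • A' j i + A x j i • (0 : X →L[ℝ] ℝ))) x :=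
    HasFDerivAt.fun_sum fun i _ => HasFDerivAt.fun_sum fun j _ =>
      (hasFDerivAt_matrix_inv_apply h1 hG i j).mul (hA j i)
  have e : ∑ i, ∑ j, ((G x)⁻¹ i j • A' j i + A x j i • (0 : X →L[ℝ] ℝ)) = ∑ i, A' i i := by
    simp [h1, Matrix.one_apply]
  rw [e] at h
  simpa [Matrix.trace, Matrix.mul_apply] using h

end TraceDerivative

/-! ### The Gauss map equation in normal coordinates -/

section NormalCoordinates

variable {X Y : Type*} [NormedAddCommGroup X] [NormedSpace ℝ X]
  [NormedAddCommGroup Y] [InnerProductSpace ℝ Y] {ι : Type*} [Fintype ι]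

lemma fderiv_fderiv_apply {f : X → Y} {x : X} (hf : ContDiffAt ℝ 2 f x) (u w : X) :
    fderiv ℝ (fun y => fderiv ℝ f y w) x u = fderiv ℝ (fderiv ℝ f) x u w := by
  rw [fderiv_clm_apply (fderiv_differentiableAt hf) (differentiableAt_const _)]
  simp

lemma differentiableAt_fderiv_apply {f : X → Y} {x : X} (hf : ContDiffAt ℝ 2 f x) (w : X) :
    DifferentiableAt ℝ (fun y => fderiv ℝ f y w) x :=
  (fderiv_differentiableAt hf).clm_apply (differentiableAt_const _)

/-- A parametrized hypersurface `f` with unit normal `ν` whose coordinates at `x` are normal, the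
vectors `e i` being mapped to an orthonormal frame that is completed by `ν x`. -/
structure IsNormalParam (f ν : X → Y) (e : ι → X) (x : X) : Prop where
  f_smooth : ContDiffAt ℝ 2 f x
  ν_smooth : ContDiffAt ℝ 2 ν x
  unit : ∀ᶠ y in 𝓝 x, ‖ν y‖ = 1
  orth : ∀ᶠ y in 𝓝 x, ∀ v, inner ℝ (ν y) (fderiv ℝ f y v) = 0
  orthonormal : Orthonormal ℝ fun i => fderiv ℝ f x (e i)
  normal : ∀ u v w, inner ℝ (fderiv ℝ (fderiv ℝ f) x v w) (fderiv ℝ f x u) = 0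
  span : ∀ v : Y, v = ∑ i, inner ℝ (fderiv ℝ f x (e i)) v • fderiv ℝ f x (e i) +
    inner ℝ (ν x) v • ν x

namespace IsNormalParam

variable {f ν : X → Y} {e : ι → X} {x : X}

lemma inner_fderiv_normal (h : IsNormalParam f ν e x) :
    ∀ᶠ y in 𝓝 x, ∀ v, inner ℝ (ν y) (fderiv ℝ ν y v) = 0 := by
  filter_upwards [h.unit.eventually_nhds, h.ν_smooth.eventually (by simp)] with y h1 h2 v
  have e1 : (fun z => inner ℝ (ν z) (ν z)) =ᶠ[𝓝 y] fun _ => (1 : ℝ) := by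
    filter_upwards [h1] with z hz
    rw [real_inner_self_eq_norm_sq, hz]; norm_num
  have hd := h2.differentiableAt (by norm_num)
  have := congrArg (fun L : X →L[ℝ] ℝ => L v) e1.fderiv_eq
  simp only [fderiv_inner_apply ℝ hd hd, fderiv_fun_const, Pi.zero_apply, zero_apply] at this
  rw [real_inner_comm (ν y)] at this
  linarith [real_inner_comm (ν y) (fderiv ℝ ν y v)]

/-- Derivative of ⟨ν, Df w⟩ = 0. It holds near x, so the second fundamental form can be replaced by
an expression with only one derivative of f. -/
lemma inner_snd_normal (h : IsNormalParam f ν e x) :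
    ∀ᶠ y in 𝓝 x, ∀ v w, inner ℝ (fderiv ℝ (fderiv ℝ f) y v w) (ν y) =
      -inner ℝ (fderiv ℝ f y w) (fderiv ℝ ν y v) := by
  filter_upwards [h.orth.eventually_nhds, h.ν_smooth.eventually (by simp),
    h.f_smooth.eventually (by simp)] with y h1 h2 h3 v w
  have e1 : (fun z => inner ℝ (ν z) (fderiv ℝ f z w)) =ᶠ[𝓝 y] fun _ => (0 : ℝ) := by
    filter_upwards [h1] with z hz using hz w
  have := congrArg (fun L : X →L[ℝ] ℝ => L v) e1.fderiv_eq
  simp only [fderiv_inner_apply ℝ (h2.differentiableAt (by norm_num))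
    (differentiableAt_fderiv_apply h3 w), fderiv_fun_const, Pi.zero_apply, zero_apply,
    fderiv_fderiv_apply h3] at this
  rw [real_inner_comm, real_inner_comm (fderiv ℝ ν y v) (fderiv ℝ f y w)]
  linarith

lemma inner_fderiv_comm (h : IsNormalParam f ν e x) :
    ∀ᶠ y in 𝓝 x, ∀ v w, inner ℝ (fderiv ℝ f y w) (fderiv ℝ ν y v) =
      inner ℝ (fderiv ℝ f y v) (fderiv ℝ ν y w) := by
  filter_upwards [h.inner_snd_normal, h.f_smooth.eventually (by simp)] with y h1 h2 v w
  have := (h2.isSymmSndFDerivAt (by simp)) v w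
  have a := h1 v w
  have b := h1 w v
  rw [this] at a
  linarith

lemma snd_eq_smul (h : IsNormalParam f ν e x) (v w : X) :
    fderiv ℝ (fderiv ℝ f) x v w = inner ℝ (ν x) (fderiv ℝ (fderiv ℝ f) x v w) • ν x := by
  conv_lhs => rw [h.span (fderiv ℝ (fderiv ℝ f) x v w)]
  rw [Finset.sum_eq_zero, zero_add]
  intro i _
  rw [real_inner_comm, h.normal, zero_smul]

lemma inner_snd_fderiv_normal (h : IsNormalParam f ν e x) (u v w : X) :
    inner ℝ (fderiv ℝ (fderiv ℝ f) x v w) (fderiv ℝ ν x u) = 0 := by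
  rw [h.snd_eq_smul, real_inner_smul_left, h.inner_fderiv_normal.self_of_nhds, mul_zero]

lemma inner_normal_snd (h : IsNormalParam f ν e x) (v w : X) :
    inner ℝ (ν x) (fderiv ℝ (fderiv ℝ ν) x w v) =
      -inner ℝ (fderiv ℝ ν x w) (fderiv ℝ ν x v) := by
  have e1 : (fun z => inner ℝ (ν z) (fderiv ℝ ν z v)) =ᶠ[𝓝 x] fun _ => (0 : ℝ) := by
    filter_upwards [h.inner_fderiv_normal] with z hz using hz v
  have := congrArg (fun L : X →L[ℝ] ℝ => L w) e1.fderiv_eq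
  simp only [fderiv_inner_apply ℝ (h.ν_smooth.differentiableAt (by norm_num))
    (differentiableAt_fderiv_apply h.ν_smooth v), fderiv_fun_const, Pi.zero_apply, zero_apply,
    fderiv_fderiv_apply h.ν_smooth] at this
  linarith

/-- The Codazzi equation: the symmetry of ⟨Df w, Dν v⟩ is differentiated, and the D²f terms vanish
because D²f is normal at x while Dν is tangent. -/
lemma inner_fderiv_snd_comm (h : IsNormalParam f ν e x) (u v w : X) :
    inner ℝ (fderiv ℝ f x w) (fderiv ℝ (fderiv ℝ ν) x u v) =
      inner ℝ (fderiv ℝ f x v) (fderiv ℝ (fderiv ℝ ν) x u w) := by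
  have e1 : (fun z => inner ℝ (fderiv ℝ f z w) (fderiv ℝ ν z v)) =ᶠ[𝓝 x]
      fun z => inner ℝ (fderiv ℝ f z v) (fderiv ℝ ν z w) := by
    filter_upwards [h.inner_fderiv_comm] with z hz using hz v w
  have := congrArg (fun L : X →L[ℝ] ℝ => L u) e1.fderiv_eq
  simp only [fderiv_inner_apply ℝ (differentiableAt_fderiv_apply h.f_smooth _)
    (differentiableAt_fderiv_apply h.ν_smooth _), fderiv_fderiv_apply h.ν_smooth,
    fderiv_fderiv_apply h.f_smooth, h.inner_snd_fderiv_normal] at this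
  linarith

lemma hasFDerivAt_formTrace [DecidableEq ι] (h : IsNormalParam f ν e x) :
    HasFDerivAt (fun y => formTrace (fderiv ℝ f y) (fderiv ℝ (fderiv ℝ f) y) (ν y) e)
      (∑ i, -fderiv ℝ (fun y => inner ℝ (fderiv ℝ f y (e i)) (fderiv ℝ ν y (e i))) x) x := by
  set G : X → Matrix ι ι ℝ := fun y =>
    Matrix.of fun i j => inner ℝ (fderiv ℝ f y (e i)) (fderiv ℝ f y (e j)) with hG
  -- The second fundamental form is written through Dν, so that differentiating it needs no third
  -- derivative of f.
  set A : X → Matrix ι ι ℝ := fun y =>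
    Matrix.of fun i j => -inner ℝ (fderiv ℝ f y (e j)) (fderiv ℝ ν y (e i)) with hA
  have h1 : G x = 1 := by
    ext i j
    exact (orthonormal_iff_ite.1 h.orthonormal i j).trans Matrix.one_apply.symm
  have hG' : ∀ i j, HasFDerivAt (fun y => G y i j) (0 : X →L[ℝ] ℝ) x := by
    intro i j
    have hd : DifferentiableAt ℝ (fun y => G y i j) x :=
      (differentiableAt_fderiv_apply h.f_smooth _).inner ℝ
        (differentiableAt_fderiv_apply h.f_smooth _)
    convert hd.hasFDerivAt
    ext u
    simp only [hG, Matrix.of_apply]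
    rw [fderiv_inner_apply ℝ (differentiableAt_fderiv_apply h.f_smooth _)
      (differentiableAt_fderiv_apply h.f_smooth _), fderiv_fderiv_apply h.f_smooth,
      fderiv_fderiv_apply h.f_smooth, h.normal, real_inner_comm, h.normal]
    simp
  have hA' : ∀ i j, HasFDerivAt (fun y => A y i j)
      (-fderiv ℝ (fun y => inner ℝ (fderiv ℝ f y (e j)) (fderiv ℝ ν y (e i))) x) x := by
    intro i j
    exact ((differentiableAt_fderiv_apply h.f_smooth _).inner ℝ
        (differentiableAt_fderiv_apply h.ν_smooth _)).hasFDerivAt.neg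
  refine (hasFDerivAt_trace_inv_mul h1 hG' hA').congr_of_eventuallyEq ?_
  filter_upwards [h.inner_snd_normal] with y hy
  simp only [formTrace, hy, hG, hA]

/-- The derivative of H + ⟨f, ν⟩/2 in the direction u is zero. By Codazzi, the derivative of H is
minus the component of Δν along Df u, and ⟨Df u, ν⟩ drops out. -/
lemma inner_fderiv_laplacian [DecidableEq ι] (h : IsNormalParam f ν e x) {lam : ℝ}
    (hH : ∀ᶠ y in 𝓝 x, formTrace (fderiv ℝ f y) (fderiv ℝ (fderiv ℝ f) y) (ν y) e +
      1 / 2 * inner ℝ (f y) (ν y) = lam) (u : X) :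
    ∑ i, inner ℝ (fderiv ℝ f x u) (fderiv ℝ (fderiv ℝ ν) x (e i) (e i)) =
      1 / 2 * inner ℝ (f x) (fderiv ℝ ν x u) := by
  have hfd := h.f_smooth.differentiableAt (by norm_num)
  have hνd := h.ν_smooth.differentiableAt (by norm_num)
  have h1 := h.hasFDerivAt_formTrace.add ((hfd.inner ℝ hνd).hasFDerivAt.const_mul (1 / 2))
  have h2 : HasFDerivAt (fun y => formTrace (fderiv ℝ f y) (fderiv ℝ (fderiv ℝ f) y) (ν y) e +
      1 / 2 * inner ℝ (f y) (ν y)) (0 : X →L[ℝ] ℝ) x :=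
    (hasFDerivAt_const lam x).congr_of_eventuallyEq hH
  have h3 := congrArg (fun L : X →L[ℝ] ℝ => L u) (h1.unique h2)
  simp only [add_apply, sum_apply, neg_apply, smul_apply, zero_apply, smul_eq_mul,
    fderiv_inner_apply ℝ hfd hνd,
    fderiv_inner_apply ℝ (differentiableAt_fderiv_apply h.f_smooth _)
      (differentiableAt_fderiv_apply h.ν_smooth _), fderiv_fderiv_apply h.ν_smooth,
    fderiv_fderiv_apply h.f_smooth, h.inner_snd_fderiv_normal, Finset.sum_neg_distrib] at h3
  have h4 := h.orth.self_of_nhds u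
  rw [real_inner_comm] at h4
  rw [h4] at h3
  have h5 : ∑ i, inner ℝ (fderiv ℝ f x u) (fderiv ℝ (fderiv ℝ ν) x (e i) (e i)) =
      ∑ i, (inner ℝ (fderiv ℝ f x (e i)) (fderiv ℝ (fderiv ℝ ν) x u (e i)) + 0) := by
    refine Finset.sum_congr rfl fun i _ => ?_
    rw [(h.ν_smooth.isSymmSndFDerivAt (by simp)) u (e i), h.inner_fderiv_snd_comm, add_zero]
  rw [h5]
  linarith

/-- The drift Laplacian of the Gauss map of a hypersurface of constant weighted mean curvature is
`-|A|² ν`. -/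
lemma drift_laplacian_normal [DecidableEq ι] (h : IsNormalParam f ν e x) {lam : ℝ}
    (hH : ∀ᶠ y in 𝓝 x, formTrace (fderiv ℝ f y) (fderiv ℝ (fderiv ℝ f) y) (ν y) e +
      1 / 2 * inner ℝ (f y) (ν y) = lam) (V : Y) :
    ∑ i, inner ℝ V (fderiv ℝ (fderiv ℝ ν) x (e i) (e i)) -
      1 / 2 * ∑ i, inner ℝ (f x) (fderiv ℝ f x (e i)) * inner ℝ V (fderiv ℝ ν x (e i)) =
      -(∑ i, ‖fderiv ℝ ν x (e i)‖ ^ 2) * inner ℝ V (ν x) := by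
  set F := fun i => fderiv ℝ f x (e i) with hF
  set Δ := ∑ i, fderiv ℝ (fderiv ℝ ν) x (e i) (e i) with hΔ
  have e1 : ∀ k, inner ℝ (F k) Δ = 1 / 2 * inner ℝ (f x) (fderiv ℝ ν x (e k)) := by
    intro k
    rw [hΔ, inner_sum]
    exact h.inner_fderiv_laplacian hH (e k)
  have e2 : inner ℝ (ν x) Δ = -∑ i, ‖fderiv ℝ ν x (e i)‖ ^ 2 := by
    simp only [hΔ, inner_sum, h.inner_normal_snd, real_inner_self_eq_norm_sq,
      Finset.sum_neg_distrib]
  have e3 : ∀ k, fderiv ℝ ν x (e k) = ∑ j, inner ℝ (F j) (fderiv ℝ ν x (e k)) • F j := by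
    intro k
    conv_lhs => rw [h.span (fderiv ℝ ν x (e k))]
    rw [h.inner_fderiv_normal.self_of_nhds, zero_smul, add_zero]
  -- Δν is expanded in the frame (Df e_k, ν): `e1` supplies the tangential components and `e2` the
  -- normal one, -|A|².
  have e4 : inner ℝ V Δ = ∑ k, (1 / 2 * inner ℝ (f x) (fderiv ℝ ν x (e k))) * inner ℝ V (F k) -
      (∑ i, ‖fderiv ℝ ν x (e i)‖ ^ 2) * inner ℝ V (ν x) := by
    conv_lhs => rw [h.span Δ]
    simp only [inner_add_right, inner_sum, real_inner_smul_right]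
    rw [e2]
    have : ∀ k, inner ℝ (fderiv ℝ f x (e k)) Δ = 1 / 2 * inner ℝ (f x) (fderiv ℝ ν x (e k)) := e1
    simp only [this, hF]
    ring
  -- Self-adjointness of the Weingarten map moves Dν from f to V, which produces exactly the drift
  -- term.
  have e5 : ∑ k, (1 / 2 * inner ℝ (f x) (fderiv ℝ ν x (e k))) * inner ℝ V (F k) =
      1 / 2 * ∑ i, inner ℝ (f x) (F i) * inner ℝ V (fderiv ℝ ν x (e i)) := by
    have a1 : ∀ k, inner ℝ (f x) (fderiv ℝ ν x (e k)) =
        ∑ j, inner ℝ (F j) (fderiv ℝ ν x (e k)) * inner ℝ (f x) (F j) := by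
      intro k
      conv_lhs => rw [e3 k]
      simp only [inner_sum, real_inner_smul_right]
    have a2 : ∀ k, inner ℝ V (fderiv ℝ ν x (e k)) =
        ∑ j, inner ℝ (F j) (fderiv ℝ ν x (e k)) * inner ℝ V (F j) := by
      intro k
      conv_lhs => rw [e3 k]
      simp only [inner_sum, real_inner_smul_right]
    simp only [a1, a2, Finset.mul_sum, Finset.sum_mul]
    rw [Finset.sum_comm]
    refine Finset.sum_congr rfl fun i _ => Finset.sum_congr rfl fun j _ => ?_
    rw [show inner ℝ (F i) (fderiv ℝ ν x (e j)) = inner ℝ (F j) (fderiv ℝ ν x (e i)) from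
      h.inner_fderiv_comm.self_of_nhds _ _]
    ring
  have e6 : ∑ i, inner ℝ V (fderiv ℝ (fderiv ℝ ν) x (e i) (e i)) = inner ℝ V Δ := by
    rw [hΔ, inner_sum]
  rw [e6, e4, e5]
  ring

/-- This is Δf = Hν, with H eliminated by the weighted mean curvature equation. -/
lemma laplacian_param [DecidableEq ι] (h : IsNormalParam f ν e x) {lam : ℝ}
    (hH : formTrace (fderiv ℝ f x) (fderiv ℝ (fderiv ℝ f) x) (ν x) e +
      1 / 2 * inner ℝ (f x) (ν x) = lam) :
    ∑ i, fderiv ℝ (fderiv ℝ f) x (e i) (e i) = (lam - 1 / 2 * inner ℝ (f x) (ν x)) • ν x := by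
  rw [formTrace_orthonormal _ _ _ h.orthonormal] at hH
  rw [Finset.sum_congr rfl fun i _ => h.snd_eq_smul (e i) (e i), ← Finset.sum_smul, ← hH]
  congr 1
  simp only [real_inner_comm]
  ring

lemma sum_sq_inner (h : IsNormalParam f ν e x) (v : Y) :
    ∑ i, inner ℝ v (fderiv ℝ f x (e i)) ^ 2 + inner ℝ v (ν x) ^ 2 = ‖v‖ ^ 2 := by
  have := congrArg (fun z => inner ℝ v z) (h.span v)
  simp only [inner_add_right, inner_sum, real_inner_smul_right,
    real_inner_self_eq_norm_sq] at this
  rw [this]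
  simp only [sq, real_inner_comm]

end IsNormalParam

end NormalCoordinates

end GaussianHypersurface

namespace GaussianHypersurface

lemma two_le_infty : (2 : WithTop ℕ∞) ≤ ((⊤ : ℕ∞) : WithTop ℕ∞) :=
  WithTop.coe_le_coe.2 (le_top : (2 : ℕ∞) ≤ ⊤)

/-! ### Mean curvature in an arbitrary parametrization -/

section Chart

variable {n d : ℕ} {M : Type*} [TopologicalSpace M] [ChartedSpace (E n) M]

lemma contDiffAt_comp_extChartAt_symm {F : M → E d} {x : M}
    (hF : ContMDiffAt (𝓡 n) (𝓡 d) ∞ F x) :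
    ContDiffAt ℝ ∞ (F ∘ (extChartAt (𝓡 n) x).symm) (extChartAt (𝓡 n) x x) := by
  have h : ContDiffWithinAt ℝ ∞ (F ∘ (extChartAt (𝓡 n) x).symm) (range (𝓡 n))
      (extChartAt (𝓡 n) x x) := (contMDiffAt_iff.1 hF).2
  rwa [modelWithCornersSelf_coe, range_id, contDiffWithinAt_univ] at h

lemma mfderiv_eq_fderiv_comp_extChartAt_symm {F : M → E d} {x : M}
    (hF : ContMDiffAt (𝓡 n) (𝓡 d) ∞ F x) :
    mfderiv (𝓡 n) (𝓡 d) F x =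
      fderiv ℝ (F ∘ (extChartAt (𝓡 n) x).symm) (extChartAt (𝓡 n) x x) := by
  rw [(hF.mdifferentiableAt (by simp)).mfderiv, modelWithCornersSelf_coe, range_id,
    fderivWithin_univ]
  rfl

lemma meanCurvature_eq_formTrace_chart {F N : M → E (n + 1)} {x : M}
    (hF : ContMDiffAt (𝓡 n) (𝓡 (n + 1)) ∞ F x) :
    meanCurvature F N x =
      formTrace (fderiv ℝ (F ∘ (extChartAt (𝓡 n) x).symm) (extChartAt (𝓡 n) x x))
        (fderiv ℝ (fderiv ℝ (F ∘ (extChartAt (𝓡 n) x).symm)) (extChartAt (𝓡 n) x x))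
        (N x) (EuclideanSpace.basisFun (Fin n) ℝ).toBasis := by
  rw [meanCurvature, formTrace]
  unfold inducedMetric
  rw [mfderiv_eq_fderiv_comp_extChartAt_symm hF]
  simp only [OrthonormalBasis.coe_toBasis, EuclideanSpace.basisFun_apply]
  rfl

/-- The mean curvature can be computed in any local parametrization. -/
lemma meanCurvature_eq_formTrace [IsManifold (𝓡 n) ∞ M] {X ι : Type*} [NormedAddCommGroup X]
    [NormedSpace ℝ X] [Fintype ι] [DecidableEq ι] (b : Module.Basis ι ℝ X)
    (hdim : Module.finrank ℝ X = n)
    {F N : M → E (n + 1)} {ψ : X → M} {y : X}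
    (hF : ContMDiffAt (𝓡 n) (𝓡 (n + 1)) ∞ F (ψ y))
    (hN : ∀ v : TangentSpace (𝓡 n) (ψ y),
      @inner ℝ (E (n + 1)) _ (N (ψ y)) (mfderiv (𝓡 n) (𝓡 (n + 1)) F (ψ y) v) = 0)
    (hψ : ContMDiffAt 𝓘(ℝ, X) (𝓡 n) ∞ ψ y)
    (hinj : Function.Injective (fderiv ℝ (F ∘ ψ) y)) :
    meanCurvature F N (ψ y) =
      formTrace (fderiv ℝ (F ∘ ψ) y) (fderiv ℝ (fderiv ℝ (F ∘ ψ)) y) (N (ψ y)) b := by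
  set φ := extChartAt (𝓡 n) (ψ y)
  set f := F ∘ φ.symm with hf
  set τ : X → E n := φ ∘ ψ with hτ
  have hfd : ContDiffAt ℝ ∞ f (τ y) := contDiffAt_comp_extChartAt_symm hF
  have hτd : ContDiffAt ℝ ∞ τ y := contMDiffAt_iff_contDiffAt.1 (contMDiffAt_extChartAt.comp y hψ)
  have heq : F ∘ ψ =ᶠ[𝓝 y] f ∘ τ := by
    filter_upwards [hψ.continuousAt.preimage_mem_nhds (extChartAt_source_mem_nhds (I := 𝓡 n) (ψ y))]
      with z hz
    simp only [hf, hτ, Function.comp_apply]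
    rw [φ.left_inv hz]
  have hfd2 := hfd.of_le two_le_infty
  have hτd2 := hτd.of_le two_le_infty
  have hD : fderiv ℝ (F ∘ ψ) y = (fderiv ℝ f (τ y)).comp (fderiv ℝ τ y) := by
    rw [heq.fderiv_eq]
    exact fderiv_comp y (hfd2.differentiableAt (by norm_num)) (hτd2.differentiableAt (by norm_num))
  have hDD : ∀ v w, fderiv ℝ (fderiv ℝ (F ∘ ψ)) y v w =
      fderiv ℝ (fderiv ℝ f) (τ y) (fderiv ℝ τ y v) (fderiv ℝ τ y w) +
        fderiv ℝ f (τ y) (fderiv ℝ (fderiv ℝ τ) y v w) := by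
    intro v w
    rw [heq.fderiv.fderiv_eq, fderiv_fderiv_comp hfd2 hτd2]
  have hτinj : Function.Injective (fderiv ℝ τ y) := by
    rw [hD] at hinj
    exact Function.Injective.of_comp hinj
  have : FiniteDimensional ℝ X := b.finiteDimensional_of_finite
  set P : X ≃ₗ[ℝ] E n := LinearEquiv.ofInjectiveOfFinrankEq (fderiv ℝ τ y : X →ₗ[ℝ] E n) hτinj
    (by simp [hdim])
  have hPv : ∀ v, P v = fderiv ℝ τ y v := fun v => rfl
  rw [meanCurvature_eq_formTrace_chart hF]
  have hfinj : Function.Injective (fderiv ℝ f (τ y)) := by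
    intro v w hvw
    have := @hinj (P.symm v) (P.symm w) (by
      rw [hD]
      simp only [ContinuousLinearMap.comp_apply, ← hPv, LinearEquiv.apply_symm_apply, hvw])
    simpa using this
  refine (formTrace_basis_eq hfinj _ _ (b.map P) _).trans ?_
  -- The term Df(D²τ) of the chain rule is tangent; what remains is a linear change of basis by Dτ.
  have hNf : ∀ u, inner ℝ (fderiv ℝ f (τ y) u) (N (ψ y)) = 0 := by
    intro u
    have := hN u
    rw [mfderiv_eq_fderiv_comp_extChartAt_symm hF] at this
    exact (real_inner_comm _ _).trans this
  simp only [formTrace, Module.Basis.map_apply, hPv, hD, hDD, inner_add_left, hNf, add_zero]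
  rfl

end Chart

/-! ### Existence of normal coordinates -/

section Frame

lemma eq_sum_of_orthonormal {n : ℕ} {g : Fin n → E (n + 1)} (hg : Orthonormal ℝ g) {ν : E (n + 1)}
    (hν : ‖ν‖ = 1) (hνg : ∀ i, inner ℝ ν (g i) = 0) (v : E (n + 1)) :
    v = ∑ i, inner ℝ (g i) v • g i + inner ℝ ν v • ν := by
  set g' : Option (Fin n) → E (n + 1) := fun o => o.elim ν g with hg'
  have ho : Orthonormal ℝ g' := by
    rw [orthonormal_iff_ite]
    rintro (_ | i) (_ | j)
    · simp [hg', hν]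
    · simp [hg', hνg]
    · simp [hg', real_inner_comm, hνg]
    · simpa [hg'] using orthonormal_iff_ite.1 hg i j
  have hspan : ⊤ ≤ Submodule.span ℝ (range g') := by
    rw [ho.linearIndependent.span_eq_top_of_card_eq_finrank (by simp)]
  have := (OrthonormalBasis.mk ho hspan).sum_repr' v
  simp only [OrthonormalBasis.coe_mk, Fintype.sum_option, hg'] at this
  exact this.symm.trans (add_comm _ _)

/-- P pulls an orthonormal basis of the range of D back through D; it normalizes the metric at the
centre of the chart. -/
lemma exists_linearIsometry_comp {n d : ℕ} (D : E n →L[ℝ] E d) (hD : Function.Injective D) :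
    ∃ P : E n →L[ℝ] E n, Function.Injective P ∧ ∀ v, ‖D (P v)‖ = ‖v‖ := by
  set R := LinearMap.range (D : E n →ₗ[ℝ] E d)
  set e := LinearEquiv.ofInjective (D : E n →ₗ[ℝ] E d) hD
  have hfr : Module.finrank ℝ R = n := by rw [← e.finrank_eq]; simp
  set o := (stdOrthonormalBasis ℝ R).reindex (finCongr hfr)
  set P : E n ≃ₗ[ℝ] E n := o.repr.symm.toLinearEquiv.trans e.symm with hP
  refine ⟨LinearMap.toContinuousLinearMap (P : E n →ₗ[ℝ] E n), P.injective, fun v => ?_⟩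
  have h1 : (D (P v) : E d) = ((e (P v) : R) : E d) := rfl
  have h2 : e (P v) = o.repr.symm v := by simp [hP]
  show ‖D (P v)‖ = ‖v‖
  rw [h1, h2, ← Submodule.coe_norm, LinearIsometryEquiv.norm_map]

end Frame

section NormalParam

variable {n : ℕ} {M : Type*} [TopologicalSpace M] [ChartedSpace (E n) M]

/-- The quadratic correction leaves the first derivative at 0 unchanged and prescribes the second
one, which is the freedom needed to remove the Christoffel symbols at a point. -/
lemma quadratic_derivs {X X' : Type*} [NormedAddCommGroup X] [NormedSpace ℝ X]
    [NormedAddCommGroup X'] [NormedSpace ℝ X'] (B : X →L[ℝ] X →L[ℝ] X) (hB : ∀ v w, B v w = B w v)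
    (P : X →L[ℝ] X') (c : X') :
    ContDiff ℝ ∞ (fun y => c + P (y - (1 / 2 : ℝ) • B y y)) ∧
    fderiv ℝ (fun y => c + P (y - (1 / 2 : ℝ) • B y y)) 0 = P ∧
    ∀ v w, fderiv ℝ (fderiv ℝ (fun y => c + P (y - (1 / 2 : ℝ) • B y y))) 0 v w = -P (B v w) := by
  have h1 : ∀ y, HasFDerivAt (fun y => c + P (y - (1 / 2 : ℝ) • B y y))
      (P - (ContinuousLinearMap.compL ℝ X X X' P).comp B y) y := by
    intro y
    have hq : HasFDerivAt (fun y => B y y) _ y := B.hasFDerivAt.clm_apply (hasFDerivAt_id y)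
    have := (P.hasFDerivAt.comp y ((hasFDerivAt_id y).sub (hq.const_smul (1 / 2 : ℝ)))).const_add c
    refine this.congr_fderiv ?_
    ext v
    simp only [one_div, ContinuousLinearMap.comp_id, ContinuousLinearMap.comp_apply, sub_apply,
      ContinuousLinearMap.id_apply, smul_apply, add_apply, ContinuousLinearMap.flip_apply,
      hB v y, map_sub, map_smul, map_add, ContinuousLinearMap.compL_apply]
    rw [← two_smul ℝ (P (B y v)), smul_smul]
    norm_num
  have h2 : fderiv ℝ (fun y => c + P (y - (1 / 2 : ℝ) • B y y)) =
      fun y => P - (ContinuousLinearMap.compL ℝ X X X' P).comp B y := funext fun y => (h1 y).fderiv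
  refine ⟨by fun_prop, by rw [h2]; simp, fun v w => ?_⟩
  rw [h2, fderiv_const_sub, ContinuousLinearMap.fderiv]
  simp

/-- A chart followed by a linear map that makes the frame orthonormal and a quadratic correction
that makes D²F normal at the centre. -/
lemma exists_normalParam {F N : M → E (n + 1)} {lam : ℝ} (hM : IsLambdaHypersurface F N lam)
    (x : M) : ∃ ψ : E n → M, ψ 0 = x ∧ ContMDiffAt (𝓡 n) (𝓡 n) ∞ ψ 0 ∧
      Function.Injective (fderiv ℝ (F ∘ ψ) 0) ∧
      IsNormalParam (F ∘ ψ) (N ∘ ψ) (EuclideanSpace.basisFun (Fin n) ℝ) 0 ∧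
      ∀ᶠ y in 𝓝 0, formTrace (fderiv ℝ (F ∘ ψ) y) (fderiv ℝ (fderiv ℝ (F ∘ ψ)) y) ((N ∘ ψ) y)
        (EuclideanSpace.basisFun (Fin n) ℝ) + 1 / 2 * inner ℝ ((F ∘ ψ) y) ((N ∘ ψ) y) = lam := by
  have := hM.hypersurface.smoothManifold
  have hF := hM.hypersurface.smooth
  have hN := hM.gaussMap.smooth
  set φ := extChartAt (𝓡 n) x with hφ
  set f := F ∘ φ.symm
  have hfd : ContDiffAt ℝ ∞ f (φ x) := contDiffAt_comp_extChartAt_symm (hF x)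
  have hDinj : Function.Injective (fderiv ℝ f (φ x)) := by
    have := hM.hypersurface.immersion x
    rwa [mfderiv_eq_fderiv_comp_extChartAt_symm (hF x)] at this
  set D := fderiv ℝ f (φ x)
  obtain ⟨P, hPinj, hP⟩ := exists_linearIsometry_comp D hDinj
  set Is : E n →ₗᵢ[ℝ] E (n + 1) := ⟨(D.comp P : E n →ₗ[ℝ] E (n + 1)), hP⟩
  set I := Is.toContinuousLinearMap
  -- I is an isometry onto the tangent space, so I I* is the tangential projection and D²f(P, P) - I
  -- B is the normal part of D²f(P, P).
  set B : E n →L[ℝ] E n →L[ℝ] E n :=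
    (ContinuousLinearMap.compL ℝ (E n) (E (n + 1)) (E n) (ContinuousLinearMap.adjoint I)).comp
      ((fderiv ℝ (fderiv ℝ f) (φ x)).bilinearComp P P)
  have hBv : ∀ v w, B v w =
      ContinuousLinearMap.adjoint I (fderiv ℝ (fderiv ℝ f) (φ x) (P v) (P w)) := fun v w => rfl
  have hBs : ∀ v w, B v w = B w v := by
    intro v w
    rw [hBv, hBv, (hfd.of_le two_le_infty).isSymmSndFDerivAt (by simp)]
  obtain ⟨hτ1, hτ2, hτ3⟩ := quadratic_derivs B hBs P (φ x)
  set τ : E n → E n := fun y => φ x + P (y - (1 / 2 : ℝ) • B y y) with hτ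
  have hτ0 : τ 0 = φ x := by simp [hτ]
  set ψ : E n → M := φ.symm ∘ τ with hψ
  have hψ0 : ψ 0 = x := by simp [hψ, hτ0, hφ]
  have hU : ∀ᶠ y in 𝓝 (0 : E n), τ y ∈ φ.target := by
    apply hτ1.continuous.continuousAt.preimage_mem_nhds
    rw [hτ0]
    exact extChartAt_target_mem_nhds x
  have hψs : ∀ᶠ y in 𝓝 (0 : E n), ContMDiffAt (𝓡 n) (𝓡 n) ∞ ψ y := by
    filter_upwards [hU] with y hy
    have h := (contMDiffOn_extChartAt_symm (I := 𝓡 n) (n := ∞) x).contMDiffAt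
      ((isOpen_extChartAt_target x).mem_nhds hy)
    exact h.comp y hτ1.contDiffAt.contMDiffAt
  have hFψ : ∀ᶠ y in 𝓝 (0 : E n), ContDiffAt ℝ ∞ (F ∘ ψ) y := by
    filter_upwards [hψs] with y hy
    exact contMDiffAt_iff_contDiffAt.1 ((hF (ψ y)).comp y hy)
  have hNψ : ContDiffAt ℝ ∞ (N ∘ ψ) 0 :=
    contMDiffAt_iff_contDiffAt.1 ((hN (ψ 0)).comp 0 hψs.self_of_nhds)
  have hfτ : F ∘ ψ = f ∘ τ := rfl
  have hfd' : ContDiffAt ℝ 2 f (τ 0) := by rw [hτ0]; exact hfd.of_le two_le_infty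
  have hd1 : fderiv ℝ (F ∘ ψ) 0 = I := by
    rw [hfτ, fderiv_comp 0 (hfd'.differentiableAt (by norm_num))
      (hτ1.contDiffAt.differentiableAt (by simp)), hτ2, hτ0]
    rfl
  have hd2 : ∀ v w, fderiv ℝ (fderiv ℝ (F ∘ ψ)) 0 v w =
      fderiv ℝ (fderiv ℝ f) (φ x) (P v) (P w) - I (B v w) := by
    intro v w
    rw [hfτ, fderiv_fderiv_comp hfd' (hτ1.contDiffAt.of_le two_le_infty), hτ2, hτ0, hτ3, map_neg,
      ← sub_eq_add_neg]
    rfl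
  have horth : ∀ᶠ y in 𝓝 (0 : E n), ∀ v, inner ℝ ((N ∘ ψ) y) (fderiv ℝ (F ∘ ψ) y v) = 0 := by
    filter_upwards [hψs] with y hy v
    have h := mfderiv_comp y ((hF (ψ y)).mdifferentiableAt (by simp)) (hy.mdifferentiableAt (by simp))
    rw [← mfderiv_eq_fderiv, h]
    exact hM.gaussMap.orthogonal (ψ y) _
  have horthonormal : Orthonormal ℝ fun i =>
      fderiv ℝ (F ∘ ψ) 0 (EuclideanSpace.basisFun (Fin n) ℝ i) := by
    rw [hd1]
    exact (EuclideanSpace.basisFun (Fin n) ℝ).orthonormal.comp_linearIsometry Is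
  have hIinj : Function.Injective I := Is.injective
  refine ⟨ψ, hψ0, hψs.self_of_nhds, by rw [hd1]; exact hIinj, ?_, ?_⟩
  · refine ⟨hFψ.self_of_nhds.of_le two_le_infty, hNψ.of_le two_le_infty,
      .of_forall fun y => hM.gaussMap.norm_eq_one _, horth, horthonormal, ?_, ?_⟩
    · intro u v w
      rw [hd2, hd1, inner_sub_left, sub_eq_zero, hBv]
      rw [← ContinuousLinearMap.adjoint_inner_left]
      exact (Is.inner_map_map _ _).symm
    · exact eq_sum_of_orthonormal horthonormal (hM.gaussMap.norm_eq_one _)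
        fun i => horth.self_of_nhds _
  · have hinj : ∀ᶠ y in 𝓝 (0 : E n), Function.Injective (fderiv ℝ (F ∘ ψ) y) := by
      have hc : ContinuousAt (fderiv ℝ (F ∘ ψ)) 0 :=
        (fderiv_differentiableAt (hFψ.self_of_nhds.of_le two_le_infty)).continuousAt
      exact hc.preimage_mem_nhds (ContinuousLinearMap.isOpen_injective.mem_nhds (by
        show Function.Injective _
        rw [hd1]; exact hIinj))
    filter_upwards [hinj, hψs] with y hy1 hy2
    have := meanCurvature_eq_formTrace (N := N) (EuclideanSpace.basisFun (Fin n) ℝ).toBasis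
      (by simp) (hF (ψ y)) (hM.gaussMap.orthogonal (ψ y)) hy2 hy1
    have h3 := hM.weightedMeanCurvature_eq (ψ y)
    rw [this] at h3
    simpa using h3

end NormalParam

end GaussianHypersurface

namespace GaussianHypersurface

/-! ### Second derivative test for the drift Laplacian -/

section MinimumPrinciple

variable {n : ℕ} {M : Type*} [TopologicalSpace M] [ChartedSpace (E n) M]

/-- The second derivative test at a local minimum of `⟨V, N⟩ + Φ ∘ F` in terms of the drift
Laplacian. -/
lemma drift_laplacian_nonneg_of_isLocalMin {F N : M → E (n + 1)} {lam : ℝ}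
    (hM : IsLambdaHypersurface F N lam) {x : M} {V : E (n + 1)} {Φ : E (n + 1) → ℝ}
    (hΦ : ContDiffAt ℝ 2 Φ (F x)) (hmin : IsLocalMin (fun z => inner ℝ V (N z) + Φ (F z)) x) :
    ∃ (g : Fin n → E (n + 1)) (a : ℝ),
      (∀ v, ∑ i, inner ℝ v (g i) ^ 2 + inner ℝ v (N x) ^ 2 = ‖v‖ ^ 2) ∧ (∀ i, ‖g i‖ = 1) ∧
      0 ≤ a ∧ (a = 0 → mfderiv (𝓡 n) (𝓡 (n + 1)) N x = 0) ∧
      0 ≤ ∑ i, fderiv ℝ (fderiv ℝ Φ) (F x) (g i) (g i) + lam * fderiv ℝ Φ (F x) (N x) -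
        1 / 2 * fderiv ℝ Φ (F x) (F x) - a * inner ℝ V (N x) := by
  obtain ⟨ψ, hψ0, hψs, hψinj, hP, hH⟩ := exists_normalParam hM x
  set f := F ∘ ψ with hf
  set ν := N ∘ ψ with hν
  set e := EuclideanSpace.basisFun (Fin n) ℝ
  have hf0 : f 0 = F x := by simp [hf, hψ0]
  have hν0 : ν 0 = N x := by simp [hν, hψ0]
  have hΦ' : ContDiffAt ℝ 2 Φ (f 0) := by rwa [hf0]
  have hwmin : IsLocalMin (fun y => inner ℝ V (ν y) + Φ (f y)) 0 := by
    have h1 : Tendsto ψ (𝓝 0) (𝓝 x) := by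
      have := hψs.continuousAt.tendsto
      rwa [hψ0] at this
    filter_upwards [h1.eventually hmin] with y hy
    simpa [hf, hν, hψ0] using hy
  have hs1 : ContDiffAt ℝ 2 (fun y => inner ℝ V (ν y)) 0 := contDiffAt_const.inner ℝ hP.ν_smooth
  have hs2 : ContDiffAt ℝ 2 (Φ ∘ f) 0 := hΦ'.comp 0 hP.f_smooth
  have hd1 : ∀ᶠ y in 𝓝 (0 : E n), fderiv ℝ (fun y => inner ℝ V (ν y) + Φ (f y)) y =
      fderiv ℝ (fun y => inner ℝ V (ν y)) y + fderiv ℝ (Φ ∘ f) y := by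
    filter_upwards [hs1.eventually (by simp), hs2.eventually (by simp)] with y h1 h2
    exact fderiv_fun_add (h1.differentiableAt (by norm_num)) (h2.differentiableAt (by norm_num))
  have hdν : ∀ᶠ y in 𝓝 (0 : E n), fderiv ℝ (fun y => inner ℝ V (ν y)) y =
      (innerSL ℝ V).comp (fderiv ℝ ν y) := by
    filter_upwards [hP.ν_smooth.eventually (by simp)] with y h1
    exact ((innerSL ℝ V).hasFDerivAt.comp y
      (h1.differentiableAt (by norm_num)).hasFDerivAt).fderiv
  have hfirst : ∀ v, inner ℝ V (fderiv ℝ ν 0 v) = -fderiv ℝ Φ (F x) (fderiv ℝ f 0 v) := by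
    intro v
    have h1 := hwmin.fderiv_eq_zero
    rw [hd1.self_of_nhds, hdν.self_of_nhds, fderiv_comp 0 (hΦ'.differentiableAt (by norm_num))
      (hP.f_smooth.differentiableAt (by norm_num)), hf0] at h1
    have h2 := congrArg (fun L : E n →L[ℝ] ℝ => L v) h1
    simp only [add_apply, ContinuousLinearMap.comp_apply, innerSL_apply_apply, zero_apply] at h2
    linarith
  have hsecond : ∀ v, 0 ≤ inner ℝ V (fderiv ℝ (fderiv ℝ ν) 0 v v) +
      (fderiv ℝ (fderiv ℝ Φ) (F x) (fderiv ℝ f 0 v) (fderiv ℝ f 0 v) +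
        fderiv ℝ Φ (F x) (fderiv ℝ (fderiv ℝ f) 0 v v)) := by
    intro v
    have h1 := fderiv_fderiv_nonneg_of_isLocalMin hwmin (hs1.add hs2) v
    have hd1' : fderiv ℝ (fun y => inner ℝ V (ν y) + Φ (f y)) =ᶠ[𝓝 0]
      fun y => (innerSL ℝ V).comp (fderiv ℝ ν y) + fderiv ℝ (Φ ∘ f) y := by
      filter_upwards [hd1, hdν] with y h1 h2
      rw [h1, h2]
    have hc : HasFDerivAt (fun y => (innerSL ℝ V).comp (fderiv ℝ ν y))
        ((ContinuousLinearMap.compL ℝ (E n) (E (n + 1)) ℝ (innerSL ℝ V)).comp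
          (fderiv ℝ (fderiv ℝ ν) 0)) 0 :=
      (ContinuousLinearMap.compL ℝ (E n) (E (n + 1)) ℝ (innerSL ℝ V)).hasFDerivAt.comp 0
        (fderiv_differentiableAt hP.ν_smooth).hasFDerivAt
    rw [hd1'.fderiv_eq, (hc.fun_add (fderiv_differentiableAt hs2).hasFDerivAt).fderiv] at h1
    simp only [add_apply, ContinuousLinearMap.comp_apply, ContinuousLinearMap.compL_apply,
      innerSL_apply_apply, fderiv_fderiv_comp hΦ' hP.f_smooth, hf0] at h1
    exact h1
  refine ⟨fun i => fderiv ℝ f 0 (e i), ∑ i, ‖fderiv ℝ ν 0 (e i)‖ ^ 2, fun v => ?_,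
    hP.orthonormal.1, by positivity, fun ha => ?_, ?_⟩
  · rw [← hν0]; exact hP.sum_sq_inner v
  · have hz : fderiv ℝ ν 0 = 0 := by
      rw [Finset.sum_eq_zero_iff_of_nonneg (by intros; positivity)] at ha
      have : (fderiv ℝ ν 0 : E n →ₗ[ℝ] E (n + 1)) = 0 := by
        refine e.toBasis.ext fun i => ?_
        have := ha i (Finset.mem_univ i)
        simpa [sq_eq_zero_iff] using this
      ext1 v
      exact congrArg (fun L : E n →ₗ[ℝ] E (n + 1) => L v) this
    have hNd := hM.gaussMap.smooth (ψ 0)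
    have hFd := hM.hypersurface.smooth (ψ 0)
    have hψd := hψs.mdifferentiableAt (by simp)
    have c1 := mfderiv_comp (0 : E n) (hNd.mdifferentiableAt (by simp)) hψd
    have c2 := mfderiv_comp (0 : E n) (hFd.mdifferentiableAt (by simp)) hψd
    rw [mfderiv_eq_fderiv] at c1 c2
    set L : E n →L[ℝ] E n := mfderiv (𝓡 n) (𝓡 n) ψ 0
    have hLinj : Function.Injective L := by
      intro v w hvw
      apply hψinj
      rw [c2]
      exact congrArg (fun z => mfderiv (𝓡 n) (𝓡 (n + 1)) F (ψ 0) z) hvw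
    -- Vanishing of D(N ∘ ψ) gives dN = 0 only because Dψ, injective between spaces of equal
    -- dimension, is onto.
    have hLsurj : Function.Surjective L :=
      (LinearMap.injective_iff_surjective (f := (L : E n →ₗ[ℝ] E n))).1 hLinj
    rw [← hψ0]
    ext1 v
    obtain ⟨w, hw⟩ := hLsurj v
    have := congrArg (fun L : E n →L[ℝ] E (n + 1) => L w) (c1.symm.trans hz)
    rw [← hw]
    exact this
  -- The second-order inequalities are summed over the frame. The first-order condition `hfirst`
  -- turns the drift of ⟨V, ν⟩ into that of Φ ∘ f, and the two ⟨F, N⟩ dΦ(N)/2 terms, from Δf and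
  -- from the tangential part of F, cancel.
  · have h1 := hP.drift_laplacian_normal hH V
    have h2 := hP.laplacian_param hH.self_of_nhds
    have h3 : 0 ≤ ∑ i, (inner ℝ V (fderiv ℝ (fderiv ℝ ν) 0 (e i) (e i)) +
      (fderiv ℝ (fderiv ℝ Φ) (F x) (fderiv ℝ f 0 (e i)) (fderiv ℝ f 0 (e i)) +
        fderiv ℝ Φ (F x) (fderiv ℝ (fderiv ℝ f) 0 (e i) (e i)))) :=
      Finset.sum_nonneg fun i _ => hsecond (e i)
    rw [Finset.sum_add_distrib, Finset.sum_add_distrib, ← map_sum, h2, map_smul, smul_eq_mul] at h3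
    have h4 := congrArg (fderiv ℝ Φ (F x)) (hP.span (F x))
    rw [map_add, map_sum, map_smul, smul_eq_mul] at h4
    simp only [map_smul, smul_eq_mul] at h4
    simp only [hfirst, hf0, hν0] at h1 h3 h4
    have h5 : ∑ i, inner ℝ (F x) (fderiv ℝ f 0 (e i)) *
        -fderiv ℝ Φ (F x) (fderiv ℝ f 0 (e i)) =
        -∑ i, inner ℝ (fderiv ℝ f 0 (e i)) (F x) * fderiv ℝ Φ (F x) (fderiv ℝ f 0 (e i)) := by
      rw [← Finset.sum_neg_distrib]
      exact Finset.sum_congr rfl fun i _ => by rw [real_inner_comm]; ring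
    rw [h5] at h1
    rw [real_inner_comm] at h4
    linarith

end MinimumPrinciple

/-! ### The infimum of ⟨V, N⟩ is attained -/

section Attained

variable {n : ℕ} {M : Type*} [TopologicalSpace M] [ChartedSpace (E n) M]

/-- The penalty ε‖F‖² makes a minimum exist. The second derivative test then gives 0 ≤ 2n + 2λ⟨F, N⟩
- ‖F‖² there, a bound on ‖F‖ free of ε, so a minimum over one compact set serves for all ε. -/
lemma exists_forall_inner_normal_le {F N : M → E (n + 1)} {lam : ℝ}
    (hM : IsLambdaHypersurface F N lam) (hproper : IsProperMap F) {V : E (n + 1)}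
    (hV : ∀ x, 0 ≤ inner ℝ V (N x)) : ∃ x₀, ∀ x, inner ℝ V (N x₀) ≤ inner ℝ V (N x) := by
  have := hM.hypersurface.connected
  have hFc : Continuous F := hM.hypersurface.smooth.continuous
  have huc : Continuous fun x => inner ℝ V (N x) :=
    continuous_const.inner hM.gaussMap.smooth.continuous
  -- For r > R one has r > 1, hence 2n + 2|λ|r - r² < 0.
  set R : ℝ := 2 * n + 2 * |lam| + 1
  have hex : ∀ ε : ℝ, 0 < ε → ∃ z, ‖F z‖ ≤ R ∧
      ∀ x, inner ℝ V (N z) + ε * ‖F z‖ ^ 2 ≤ inner ℝ V (N x) + ε * ‖F x‖ ^ 2 := by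
    intro ε hε
    obtain ⟨y₀⟩ : Nonempty M := inferInstance
    have htend : Tendsto (fun x => ‖F x‖) (cocompact M) atTop :=
      (tendsto_norm_cocompact_atTop (E := E (n + 1))).comp
        (isProperMap_iff_tendsto_cocompact.1 hproper).2
    have htend2 : Tendsto (fun x => ε * ‖F x‖ ^ 2) (cocompact M) atTop :=
      ((tendsto_pow_atTop two_ne_zero).comp htend).const_mul_atTop hε
    obtain ⟨z, hz⟩ := (huc.add ((hFc.norm.pow 2).const_mul ε)).exists_forall_le' y₀ (by
      filter_upwards [htend2.eventually_ge_atTop (inner ℝ V (N y₀) + ε * ‖F y₀‖ ^ 2)] with x hx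
      have := hV x
      simp only [Pi.add_apply, Pi.pow_apply]
      linarith)
    refine ⟨z, ?_, hz⟩
    have hd : ∀ y, HasFDerivAt (fun y : E (n + 1) => ε * ‖y‖ ^ 2) (ε • (2 • innerSL ℝ y)) y :=
      fun y => (hasStrictFDerivAt_norm_sq y).hasFDerivAt.const_mul ε
    have hd1 : fderiv ℝ (fun y : E (n + 1) => ε * ‖y‖ ^ 2) = fun y => ε • (2 • innerSL ℝ y) :=
      funext fun y => (hd y).fderiv
    have hd2 : ∀ y v w, fderiv ℝ (fderiv ℝ (fun y : E (n + 1) => ε * ‖y‖ ^ 2)) y v w =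
        ε * (2 * inner ℝ v w) := by
      intro y v w
      rw [hd1]
      have : HasFDerivAt (fun y : E (n + 1) => ε • (2 • innerSL ℝ y))
          (ε • (2 • (innerSL ℝ : E (n + 1) →L[ℝ] E (n + 1) →L[ℝ] ℝ))) y :=
        ((innerSL ℝ : E (n + 1) →L[ℝ] E (n + 1) →L[ℝ] ℝ).hasFDerivAt.const_smul 2).const_smul ε
      rw [this.fderiv]
      simp [-mul_eq_mul_left_iff]
      rfl
    have hsm : ContDiff ℝ 2 (fun y : E (n + 1) => ε * ‖y‖ ^ 2) :=
      contDiff_const.mul (contDiff_norm_sq ℝ)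
    obtain ⟨g, a, -, hg1, ha, -, hineq⟩ :=
      drift_laplacian_nonneg_of_isLocalMin (V := V) hM (x := z) hsm.contDiffAt
        (Filter.Eventually.of_forall hz)
    simp only [hd2, real_inner_self_eq_norm_sq, hg1] at hineq
    rw [hd1] at hineq
    simp only [one_pow, mul_one, Finset.sum_const, Finset.card_univ, Fintype.card_fin,
      nsmul_eq_mul, smul_apply, smul_eq_mul, innerSL_apply_apply,
      real_inner_self_eq_norm_sq, Nat.cast_ofNat] at hineq
    have h1 : 0 ≤ a * inner ℝ V (N z) := mul_nonneg ha (hV z)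
    have h2 : |inner ℝ (F z) (N z)| ≤ ‖F z‖ := by
      have := abs_real_inner_le_norm (F z) (N z)
      rwa [hM.gaussMap.norm_eq_one, mul_one] at this
    have h3 : lam * inner ℝ (F z) (N z) ≤ |lam| * ‖F z‖ :=
      (le_abs_self _).trans (by rw [abs_mul]; gcongr)
    have h4 : 0 ≤ ε * (2 * n + 2 * (|lam| * ‖F z‖) - ‖F z‖ ^ 2) := by nlinarith
    have h5 := nonneg_of_mul_nonneg_right h4 hε
    by_contra! hlt
    have h6 : (0 : ℝ) ≤ n := n.cast_nonneg
    have h7 := abs_nonneg lam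
    nlinarith
  have hK : IsCompact {x | ‖F x‖ ≤ R} := by
    have := hproper.isCompact_preimage (isCompact_closedBall (0 : E (n + 1)) R)
    convert this using 1
    ext x; simp
  obtain ⟨z₁, hz₁, -⟩ := hex 1 one_pos
  obtain ⟨x₀, hx₀, hmin⟩ := hK.exists_isMinOn ⟨z₁, hz₁⟩ huc.continuousOn
  refine ⟨x₀, fun x => le_of_forall_pos_le_add fun δ hδ => ?_⟩
  -- This ε depends on x and makes the penalty at x at most δ.
  obtain ⟨z, hz, hz'⟩ := hex (δ / (‖F x‖ ^ 2 + 1)) (by positivity)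
  have h1 : inner ℝ V (N x₀) ≤ inner ℝ V (N z) := hmin hz
  have h2 := hz' x
  have h3 : δ / (‖F x‖ ^ 2 + 1) * ‖F x‖ ^ 2 ≤ δ := by
    rw [div_mul_eq_mul_div, div_le_iff₀ (by positivity)]
    nlinarith
  have h4 : 0 ≤ δ / (‖F x‖ ^ 2 + 1) * ‖F z‖ ^ 2 := by positivity
  linarith

end Attained

end GaussianHypersurface

namespace GaussianHypersurface

/-! ### The barrier of the Hopf argument -/

section Barrier

variable {d : ℕ}

/-- The sum ‖y - a‖² + ‖y - b‖² is, up to a constant, 2‖y - c‖² with c the midpoint of a and b: this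
is Hopf's Gaussian barrier for the ball with diameter ab. -/
lemma barrier_derivs (η α : ℝ) (a b : E d) :
    ContDiff ℝ 2 (fun y : E d => -(η * Real.exp (-α * (‖y - a‖ ^ 2 + ‖y - b‖ ^ 2)))) ∧
    (∀ y v, fderiv ℝ (fun y : E d => -(η * Real.exp (-α * (‖y - a‖ ^ 2 + ‖y - b‖ ^ 2)))) y v =
      η * α * Real.exp (-α * (‖y - a‖ ^ 2 + ‖y - b‖ ^ 2)) * (2 * inner ℝ ((y - a) + (y - b)) v)) ∧
    ∀ y v, fderiv ℝ (fderiv ℝ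
        (fun y : E d => -(η * Real.exp (-α * (‖y - a‖ ^ 2 + ‖y - b‖ ^ 2))))) y v v =
      η * α * Real.exp (-α * (‖y - a‖ ^ 2 + ‖y - b‖ ^ 2)) *
        (4 * ‖v‖ ^ 2 - 4 * α * inner ℝ ((y - a) + (y - b)) v ^ 2) := by
  have hs : ContDiff ℝ 2 (fun y : E d => -(η * Real.exp (-α * (‖y - a‖ ^ 2 + ‖y - b‖ ^ 2)))) := by
    have h1 : ContDiff ℝ 2 (fun y : E d => ‖y - a‖ ^ 2) := (contDiff_id.sub contDiff_const).norm_sq ℝ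
    have h2 : ContDiff ℝ 2 (fun y : E d => ‖y - b‖ ^ 2) := (contDiff_id.sub contDiff_const).norm_sq ℝ
    exact (contDiff_const.mul ((contDiff_const.mul (h1.add h2)).exp)).neg
  have hq : ∀ (c y : E d), HasFDerivAt (fun y : E d => ‖y - c‖ ^ 2) (2 • innerSL ℝ (y - c)) y := by
    intro c y
    refine ((hasStrictFDerivAt_norm_sq (y - c)).hasFDerivAt.comp y
      ((hasFDerivAt_id y).sub_const c)).congr_fderiv ?_
    rw [ContinuousLinearMap.comp_id]
  have hexp : ∀ y : E d, HasFDerivAt (fun y : E d => Real.exp (-α * (‖y - a‖ ^ 2 + ‖y - b‖ ^ 2)))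
      (Real.exp (-α * (‖y - a‖ ^ 2 + ‖y - b‖ ^ 2)) •
        (-α) • (2 • innerSL ℝ (y - a) + 2 • innerSL ℝ (y - b))) y :=
    fun y => (((hq a y).add (hq b y)).const_mul (-α)).exp
  have h1 : ∀ y v, fderiv ℝ (fun y : E d => -(η * Real.exp (-α * (‖y - a‖ ^ 2 + ‖y - b‖ ^ 2)))) y v =
      η * α * Real.exp (-α * (‖y - a‖ ^ 2 + ‖y - b‖ ^ 2)) * (2 * inner ℝ ((y - a) + (y - b)) v) := by
    intro y v
    rw [((hexp y).const_mul η).fun_neg.fderiv]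
    simp [inner_add_left, inner_sub_left]
    ring
  refine ⟨hs, h1, fun y v => ?_⟩
  rw [← fderiv_fderiv_apply hs.contDiffAt]
  simp only [h1]
  have hin : HasFDerivAt (fun y : E d => 2 * inner ℝ ((y - a) + (y - b)) v)
      ((2 : ℝ) • ((innerSL ℝ v) + innerSL ℝ v)) y := by
    have h2 : HasFDerivAt (fun y : E d => innerSL ℝ v (y - a) + innerSL ℝ v (y - b))
        (innerSL ℝ v + innerSL ℝ v) y :=
      ((innerSL ℝ v).hasFDerivAt.comp y ((hasFDerivAt_id y).sub_const a)).add
        ((innerSL ℝ v).hasFDerivAt.comp y ((hasFDerivAt_id y).sub_const b))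
    refine (h2.const_mul 2).congr_of_eventuallyEq (.of_forall fun z => ?_)
    simp [inner_add_left, real_inner_comm]
  rw [(((hexp y).const_mul (η * α)).fun_mul hin).fderiv]
  simp [inner_add_left, inner_sub_left]
  ring

end Barrier

/-! ### The strong minimum principle and its consequences -/

section StrongMinimum

variable {n : ℕ} {M : Type*} [TopologicalSpace M] [ChartedSpace (E n) M]

/-- Near a point, the chords of a hypersurface are transverse to the normal. -/
lemma eventually_chord_transverse {F N : M → E (n + 1)} (hF : IsImmersedHypersurface F)
    (hN : IsGaussMap F N) (x₀ : M) :
    ∃ U ∈ 𝓝 x₀, ∀ x ∈ U, ∀ y ∈ U, x ≠ y → |inner ℝ (F x - F y) (N x)| < ‖F x - F y‖ := by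
  have := hF.smoothManifold
  set φ := extChartAt (𝓡 n) x₀
  set f := F ∘ φ.symm with hf
  have hfd : ContDiffAt ℝ ∞ f (φ x₀) := contDiffAt_comp_extChartAt_symm (hF.smooth x₀)
  set D := fderiv ℝ f (φ x₀)
  have hmf := mfderiv_eq_fderiv_comp_extChartAt_symm (hF.smooth x₀)
  have hDinj : Function.Injective D := by
    have := hF.immersion x₀
    rwa [hmf] at this
  have hDN : ∀ v, inner ℝ (D v) (N x₀) = 0 := by
    intro v
    have := hN.orthogonal x₀ v
    rw [hmf] at this
    exact (real_inner_comm _ _).trans this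
  obtain ⟨K, hK, hanti⟩ := LinearMap.exists_antilipschitzWith (D : E n →ₗ[ℝ] E (n + 1))
    (LinearMap.ker_eq_bot.2 hDinj)
  have hlow : ∀ v, ‖v‖ ≤ K * ‖D v‖ := fun v => by
    simpa using hanti.le_mul_dist v 0
  have hK0 : (0 : ℝ) < K := hK
  have hstrict := (hfd.hasStrictFDerivAt (by simp)).isLittleO
  -- With K the antilipschitz constant of D and v the coordinate difference, a chord is Dv + r.
  -- After multiplication by K its normal part is at most |v|/4 (rotation of N) plus |v|/4 (error
  -- r), while its length is at least |v| - |v|/4.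
  have hb := hstrict.def (c := 1 / (4 * K)) (by positivity)
  rw [nhds_prod_eq, eventually_prod_self_iff'] at hb
  obtain ⟨t, ht, hbt⟩ := hb
  have hNc : ∀ᶠ x in 𝓝 x₀, ‖N x - N x₀‖ * ‖D‖ < 1 / (4 * K) := by
    have : Tendsto (fun x => ‖N x - N x₀‖ * ‖D‖) (𝓝 x₀) (𝓝 (‖N x₀ - N x₀‖ * ‖D‖)) :=
      ((hN.smooth.continuous.sub continuous_const).norm.mul continuous_const).tendsto x₀
    rw [sub_self, norm_zero, zero_mul] at this
    exact this.eventually_lt_const (by positivity)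
  have hφt : φ ⁻¹' t ∈ 𝓝 x₀ := (continuousAt_extChartAt x₀).preimage_mem_nhds ht
  refine ⟨φ.source ∩ (φ ⁻¹' t ∩ {x | ‖N x - N x₀‖ * ‖D‖ < 1 / (4 * K)}),
    inter_mem (extChartAt_source_mem_nhds x₀) (inter_mem hφt hNc), ?_⟩
  rintro x ⟨hxs, hxt, hxN⟩ y ⟨hys, hyt, -⟩ hxy
  set v := φ x - φ y
  have hv0 : 0 < ‖v‖ := norm_pos_iff.2 (sub_ne_zero.2 fun h => hxy (φ.injOn hxs hys h))
  have h1 := hbt _ hxt _ hyt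
  have hfx : f (φ x) = F x := by simp [hf, φ.left_inv hxs]
  have hfy : f (φ y) = F y := by simp [hf, φ.left_inv hys]
  simp only [hfx, hfy] at h1
  set r := F x - F y - D (φ x - φ y) with hr
  have hFxy : F x - F y = D v + r := by rw [hr]; abel
  have hr1 : K * ‖r‖ ≤ ‖v‖ / 4 := by
    calc K * ‖r‖ ≤ K * (1 / (4 * K) * ‖v‖) := by gcongr
      _ = ‖v‖ / 4 := by field_simp
  have h2 : |inner ℝ (D v) (N x)| ≤ ‖N x - N x₀‖ * ‖D‖ * ‖v‖ := by
    have : inner ℝ (D v) (N x) = inner ℝ (D v) (N x - N x₀) := by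
      rw [inner_sub_right, hDN, sub_zero]
    rw [this]
    calc _ ≤ ‖D v‖ * ‖N x - N x₀‖ := abs_real_inner_le_norm _ _
      _ ≤ (‖D‖ * ‖v‖) * ‖N x - N x₀‖ := by gcongr; exact D.le_opNorm v
      _ = _ := by ring
  have h3 : K * (‖N x - N x₀‖ * ‖D‖ * ‖v‖) ≤ ‖v‖ / 4 := by
    calc K * (‖N x - N x₀‖ * ‖D‖ * ‖v‖) ≤ K * (1 / (4 * K) * ‖v‖) := by gcongr; exact hxN.le
      _ = ‖v‖ / 4 := by field_simp
  have h4 : |inner ℝ r (N x)| ≤ ‖r‖ := by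
    simpa [hN.norm_eq_one] using abs_real_inner_le_norm r (N x)
  have h5 : |inner ℝ (F x - F y) (N x)| ≤ |inner ℝ (D v) (N x)| + |inner ℝ r (N x)| := by
    rw [hFxy, inner_add_left]
    exact abs_add_le _ _
  have h6 : ‖D v‖ - ‖r‖ ≤ ‖F x - F y‖ := by
    rw [hFxy]
    simpa using norm_sub_norm_le (D v) (-r)
  have h7 := hlow v
  have h8 : K * |inner ℝ (F x - F y) (N x)| < K * ‖F x - F y‖ := by
    have a1 := mul_le_mul_of_nonneg_left (h5.trans (add_le_add h2 h4)) hK0.le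
    have a2 := mul_le_mul_of_nonneg_left h6 hK0.le
    nlinarith
  exact lt_of_mul_lt_mul_left h8 hK0.le

/-- The condition `hlt` says that the drift Laplacian of the barrier is negative. The factor of 4α
is the squared tangential length of (F - a) + (F - b), so a large α achieves it wherever this length
is positive. -/
lemma not_isLocalMin_add_barrier {F N : M → E (n + 1)} {lam : ℝ}
    (hM : IsLambdaHypersurface F N lam) {V : E (n + 1)} {x : M} (hV : 0 ≤ inner ℝ V (N x))
    {a b : E (n + 1)} {η α : ℝ} (hη : 0 < η) (hα : 0 < α)
    (hlt : 4 * n + 2 * lam * inner ℝ ((F x - a) + (F x - b)) (N x) -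
      inner ℝ ((F x - a) + (F x - b)) (F x) <
      4 * α * (‖(F x - a) + (F x - b)‖ ^ 2 - inner ℝ ((F x - a) + (F x - b)) (N x) ^ 2)) :
    ¬ IsLocalMin (fun z => inner ℝ V (N z) +
      -(η * Real.exp (-α * (‖F z - a‖ ^ 2 + ‖F z - b‖ ^ 2)))) x := by
  intro hmin
  obtain ⟨hs, hd1, hd2⟩ := barrier_derivs η α a b
  obtain ⟨g, k, hg, hg1, hk, -, hineq⟩ :=
    drift_laplacian_nonneg_of_isLocalMin hM hs.contDiffAt hmin
  simp only [hd1, hd2, hg1] at hineq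
  have h1 := hg ((F x - a) + (F x - b))
  set c := (F x - a) + (F x - b)
  set ex := Real.exp (-α * (‖F x - a‖ ^ 2 + ‖F x - b‖ ^ 2))
  have hex0 : 0 < ex := Real.exp_pos _
  rw [← Finset.mul_sum, Finset.sum_sub_distrib, ← Finset.mul_sum, ← Finset.mul_sum, eq_sub_of_add_eq h1] at hineq
  simp only [one_pow, mul_one, Finset.sum_const, Finset.card_univ, Fintype.card_fin,
    nsmul_eq_mul] at hineq
  have h2 : 0 ≤ k * inner ℝ V (N x) := mul_nonneg hk hV
  have h3 : 0 ≤ (η * α * ex) * (n * 4 - 4 * α * (‖c‖ ^ 2 - inner ℝ c (N x) ^ 2) +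
      2 * lam * inner ℝ c (N x) - inner ℝ c (F x)) := by linarith
  have h4 := nonneg_of_mul_nonneg_right h3 (by positivity)
  linarith

/-- The strong minimum principle for `⟨V, N⟩`, nonnegative with a minimum at `x₀`. -/
lemma eventually_eq_of_forall_le {F N : M → E (n + 1)} {lam : ℝ}
    (hM : IsLambdaHypersurface F N lam) {V : E (n + 1)} (hV : ∀ x, 0 ≤ inner ℝ V (N x)) {x₀ : M}
    (hmin : ∀ x, inner ℝ V (N x₀) ≤ inner ℝ V (N x)) :
    ∀ᶠ x in 𝓝 x₀, inner ℝ V (N x) = inner ℝ V (N x₀) := by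
  have := hM.hypersurface.t2
  have : LocallyCompactSpace M := ChartedSpace.locallyCompactSpace (E n) M
  have hFc : Continuous F := hM.hypersurface.smooth.continuous
  have hNc : Continuous N := hM.gaussMap.smooth.continuous
  have huc : Continuous fun x => inner ℝ V (N x) := continuous_const.inner hNc
  set m := inner ℝ V (N x₀)
  -- Hopf's argument with extrinsic distances: the set {u = m} is touched from outside, at some x₂,
  -- by a ball around the image of a nearby point x₁ with u ≠ m.
  by_contra hne
  obtain ⟨U, hU, htrans⟩ := eventually_chord_transverse hM.hypersurface hM.gaussMap x₀
  have hFinj : ∀ x ∈ U, ∀ y ∈ U, x ≠ y → 0 < ‖F x - F y‖ := fun x hx y hy hxy =>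
    (abs_nonneg _).trans_lt (htrans x hx y hy hxy)
  obtain ⟨K, hKn, hKU, hK⟩ := local_compact_nhds hU
  have hx₀K : x₀ ∈ interior K := mem_interior_iff_mem_nhds.2 hKn
  obtain ⟨δ, hδ, hδK⟩ : ∃ δ > 0, ∀ x ∈ K \ interior K, δ ≤ ‖F x - F x₀‖ := by
    have hKd : IsCompact (K \ interior K) := hK.diff isOpen_interior
    rcases (K \ interior K).eq_empty_or_nonempty with he | hne
    · exact ⟨1, one_pos, by simp [he]⟩
    · obtain ⟨z, hz, hzmin⟩ := hKd.exists_isMinOn hne (hFc.sub continuous_const).norm.continuousOn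
      refine ⟨‖F z - F x₀‖, hFinj z (hKU hz.1) x₀ (mem_of_mem_nhds hU) ?_, fun x hx => hzmin hx⟩
      rintro rfl
      exact hz.2 hx₀K
  obtain ⟨x₁, hx₁S, hx₁K, hx₁δ⟩ : ∃ x₁, inner ℝ V (N x₁) ≠ m ∧ x₁ ∈ K ∧ ‖F x₁ - F x₀‖ < δ / 2 := by
    have h1 : ∀ᶠ x in 𝓝 x₀, ‖F x - F x₀‖ < δ / 2 := by
      have : Tendsto (fun x => ‖F x - F x₀‖) (𝓝 x₀) (𝓝 ‖F x₀ - F x₀‖) :=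
        (hFc.sub continuous_const).norm.tendsto x₀
      rw [sub_self, norm_zero] at this
      exact this.eventually_lt_const (by positivity)
    obtain ⟨x₁, h2, h3, h4⟩ := (Filter.not_eventually.1 hne).and_eventually (h1.and hKn) |>.exists
    exact ⟨x₁, h2, h4, h3⟩
  have hS : IsClosed {x | inner ℝ V (N x) = m} := isClosed_eq huc continuous_const
  -- x₂ is nearest to x₁ among the points of K with u = m. As F x₁ is within δ/2 of F x₀, F x₂ is
  -- within δ of it, which keeps x₂ off the boundary of K.
  obtain ⟨x₂, hx₂, hx₂min⟩ := (hK.inter_right hS).exists_isMinOn ⟨x₀, mem_of_mem_nhds hKn, rfl⟩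
    (hFc.sub (continuous_const (y := F x₁))).norm.continuousOn
  have hx₂S : inner ℝ V (N x₂) = m := hx₂.2
  have hx₂i : x₂ ∈ interior K := by
    by_contra hni
    have h1 := hδK x₂ ⟨hx₂.1, hni⟩
    have h2 : ‖F x₂ - F x₁‖ ≤ ‖F x₀ - F x₁‖ := hx₂min ⟨mem_of_mem_nhds hKn, rfl⟩
    have h3 : ‖F x₂ - F x₀‖ ≤ ‖F x₂ - F x₁‖ + ‖F x₁ - F x₀‖ := norm_sub_le_norm_sub_add_norm_sub _ _ _
    rw [norm_sub_rev (F x₀)] at h2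
    linarith
  have hx₂₁ : x₂ ≠ x₁ := by rintro rfl; exact hx₁S hx₂S
  have htr := htrans x₂ (hKU hx₂.1) x₁ (hKU hx₁K) hx₂₁
  set a := F x₁ with ha
  set b := F x₂ with hb
  set κ : M → ℝ := fun x => ‖(F x - a) + (F x - b)‖ ^ 2 - inner ℝ ((F x - a) + (F x - b)) (N x) ^ 2
    with hκ
  set β : M → ℝ := fun x => 4 * n + 2 * lam * inner ℝ ((F x - a) + (F x - b)) (N x) -
      inner ℝ ((F x - a) + (F x - b)) (F x)
  -- Transversality of the chord from x₁ to x₂ says that the exponent of the barrier has nonzero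
  -- tangential gradient at x₂.
  have hκ₂ : 0 < κ x₂ := by
    simp only [hκ, ← hb, sub_self, add_zero]
    have := sq_lt_sq' (by linarith [abs_nonneg (inner ℝ (b - a) (N x₂)), norm_nonneg (b - a)]) htr
    rw [sq_abs] at this
    linarith
  have hcc : Continuous fun x => (F x - a) + (F x - b) :=
    (hFc.sub continuous_const).add (hFc.sub continuous_const)
  have hκc : Continuous κ := (hcc.norm.pow 2).sub ((hcc.inner hNc).pow 2)
  have hβc : Continuous β := (continuous_const.add (continuous_const.mul (hcc.inner hNc))).sub
    (hcc.inner hFc)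
  obtain ⟨α, hα, hα₂⟩ : ∃ α > 0, β x₂ < 4 * α * κ x₂ := by
    refine ⟨(|β x₂| + 1) / (4 * κ x₂), by positivity, ?_⟩
    have : 4 * ((|β x₂| + 1) / (4 * κ x₂)) * κ x₂ = |β x₂| + 1 := by field_simp
    rw [this]
    linarith [le_abs_self (β x₂)]
  have hev : ∀ᶠ x in 𝓝 x₂, x ∈ interior K ∧ β x < 4 * α * κ x :=
    (isOpen_interior.eventually_mem hx₂i).and
      (hβc.continuousAt.eventually_lt ((hκc.const_mul (4 * α)).continuousAt) hα₂)
  obtain ⟨B, hBn, hBU, hB⟩ := local_compact_nhds hev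
  have hx₂B : x₂ ∈ interior B := mem_interior_iff_mem_nhds.2 hBn
  set q : M → ℝ := fun x => ‖F x - a‖ ^ 2 + ‖F x - b‖ ^ 2 with hq
  have hqc : Continuous q :=
    ((hFc.sub continuous_const).norm.pow 2).add ((hFc.sub continuous_const).norm.pow 2)
  have hT : IsCompact ((B \ interior B) ∩ {x | q x ≤ q x₂}) :=
    (hB.diff isOpen_interior).inter_right (isClosed_le hqc continuous_const)
  -- The ball with diameter ab lies in the ball around a of radius |b - a| and meets its boundary
  -- sphere only at b. So within K the set {u = m} meets {q ≤ q x₂} only at x₂, which is interior to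
  -- B.
  have hTm : ∀ x ∈ (B \ interior B) ∩ {x | q x ≤ q x₂}, m < inner ℝ V (N x) := by
    rintro x ⟨⟨hxB, hxi⟩, hxq⟩
    refine lt_of_le_of_ne (hmin x) fun heq => ?_
    have hxK : x ∈ K := interior_subset (hBU hxB).1
    have hxx : x ≠ x₂ := by rintro rfl; exact hxi hx₂B
    have h1 : ‖F x₂ - F x₁‖ ≤ ‖F x - F x₁‖ := hx₂min ⟨hxK, heq.symm⟩
    have h2 := hFinj x (hKU hxK) x₂ (hKU hx₂.1) hxx
    have h3 : q x ≤ q x₂ := hxq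
    simp only [hq, hb, ha, sub_self, norm_zero] at h3
    nlinarith [norm_nonneg (F x₂ - F x₁)]
  obtain ⟨η, hη, hηT⟩ : ∃ η > 0, ∀ x ∈ (B \ interior B) ∩ {x | q x ≤ q x₂},
      m + η ≤ inner ℝ V (N x) := by
    rcases ((B \ interior B) ∩ {x | q x ≤ q x₂}).eq_empty_or_nonempty with he | hne
    · exact ⟨1, one_pos, by simp [he]⟩
    · obtain ⟨z, hz, hzmin⟩ := hT.exists_isMinOn hne huc.continuousOn
      refine ⟨inner ℝ V (N z) - m, sub_pos.2 (hTm z hz), fun x hx => ?_⟩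
      have : inner ℝ V (N z) ≤ inner ℝ V (N x) := hzmin hx
      linarith
  set w : M → ℝ := fun z => inner ℝ V (N z) + -(η * Real.exp (-α * q z)) with hw
  have hwc : Continuous w :=
    huc.add (continuous_const.mul (Real.continuous_exp.comp (continuous_const.mul hqc))).neg
  have hnot : ∀ x ∈ interior B, ¬ IsLocalMin w x := fun x hx =>
    not_isLocalMin_add_barrier hM (hV x) hη hα (hBU (interior_subset hx)).2
  -- Where q ≤ q x₂ the gap η absorbs the barrier, which is at most η; where q > q x₂ the barrier
  -- subtracts less than at x₂.
  have hbd : ∀ x ∈ B \ interior B, w x₂ ≤ w x := by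
    intro x hx
    simp only [hw, hx₂S]
    by_cases hxq : q x ≤ q x₂
    · have h1 := hηT x ⟨hx, hxq⟩
      have h2 : Real.exp (-α * q x) ≤ 1 := by
        rw [Real.exp_le_one_iff]
        have : 0 ≤ q x := by positivity
        nlinarith
      have h3 : 0 < Real.exp (-α * q x₂) := Real.exp_pos _
      nlinarith
    · have h1 : Real.exp (-α * q x) ≤ Real.exp (-α * q x₂) :=
        Real.exp_le_exp.2 (by nlinarith [not_le.1 hxq])
      have h2 := hmin x
      nlinarith
  -- If the minimum of w over B is reached on the boundary, `hbd` makes the interior point x₂ a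
  -- minimum too; either way an interior local minimum contradicts `hnot`.
  obtain ⟨z, hz, hzmin⟩ := hB.exists_isMinOn ⟨x₂, interior_subset hx₂B⟩ hwc.continuousOn
  by_cases hzi : z ∈ interior B
  · exact hnot z hzi (hzmin.isLocalMin (mem_interior_iff_mem_nhds.1 hzi))
  · refine hnot x₂ hx₂B ?_
    filter_upwards [hBn] with x hx
    exact (hbd z ⟨hz, hzi⟩).trans (hzmin hx)

/-- On a proper hypersurface of constant weighted mean curvature a nonnegative `⟨V, N⟩` is
constant. -/
lemma inner_normal_const {F N : M → E (n + 1)} {lam : ℝ}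
    (hM : IsLambdaHypersurface F N lam) (hproper : IsProperMap F) {V : E (n + 1)}
    (hV : ∀ x, 0 ≤ inner ℝ V (N x)) (x y : M) : inner ℝ V (N x) = inner ℝ V (N y) := by
  have := hM.hypersurface.connected
  have huc : Continuous fun x => inner ℝ V (N x) :=
    continuous_const.inner hM.gaussMap.smooth.continuous
  obtain ⟨x₀, hx₀⟩ := exists_forall_inner_normal_le hM hproper hV
  -- Each point of this set is itself a global minimum, so the local statement applies there and
  -- gives openness.
  have hclopen : IsClopen {x | inner ℝ V (N x) = inner ℝ V (N x₀)} := by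
    refine ⟨isClosed_eq huc continuous_const, isOpen_iff_mem_nhds.2 fun z hz => ?_⟩
    have hz' : inner ℝ V (N z) = inner ℝ V (N x₀) := hz
    have := eventually_eq_of_forall_le hM hV (x₀ := z) fun x => by rw [hz']; exact hx₀ x
    rwa [hz'] at this
  have huniv := hclopen.eq_univ ⟨x₀, rfl⟩
  have h : ∀ z, inner ℝ V (N z) = inner ℝ V (N x₀) := fun z => by
    have : z ∈ {x | inner ℝ V (N x) = inner ℝ V (N x₀)} := by rw [huniv]; trivial
    exact this
  rw [h x, h y]

lemma eq_of_mfderiv_eq_zero [IsManifold (𝓡 n) ∞ M] [PreconnectedSpace M] {d : ℕ} {f : M → E d}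
    (hf : ContMDiff (𝓡 n) (𝓡 d) ∞ f) (h0 : ∀ x, mfderiv (𝓡 n) (𝓡 d) f x = 0) (x y : M) :
    f x = f y := by
  have hloc : IsLocallyConstant f := by
    rw [IsLocallyConstant.iff_eventually_eq]
    intro x
    set φ := extChartAt (𝓡 n) x
    obtain ⟨r, hr, hball⟩ := Metric.mem_nhds_iff.1 (extChartAt_target_mem_nhds (I := 𝓡 n) x)
    have hsm : ∀ z ∈ Metric.ball (φ x) r, ContMDiffAt (𝓡 n) (𝓡 n) ∞ φ.symm z := fun z hz =>
      (contMDiffOn_extChartAt_symm (I := 𝓡 n) (n := ∞) x).contMDiffAt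
        ((isOpen_extChartAt_target x).mem_nhds (hball hz))
    have hd : ∀ z ∈ Metric.ball (φ x) r, DifferentiableAt ℝ (f ∘ φ.symm) z := fun z hz =>
      (contMDiffAt_iff_contDiffAt.1 ((hf _).comp z (hsm z hz))).differentiableAt (by simp)
    have hzero : ∀ z ∈ Metric.ball (φ x) r, fderiv ℝ (f ∘ φ.symm) z = 0 := by
      intro z hz
      rw [← mfderiv_eq_fderiv, mfderiv_comp z ((hf _).mdifferentiableAt (by simp))
        ((hsm z hz).mdifferentiableAt (by simp)), h0]
      rfl
    filter_upwards [extChartAt_source_mem_nhds (I := 𝓡 n) x,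
      (continuousAt_extChartAt (I := 𝓡 n) x).preimage_mem_nhds (Metric.ball_mem_nhds _ hr)]
      with y hy1 hy2
    have := Metric.isOpen_ball.is_const_of_fderiv_eq_zero
      (convex_ball (φ x) r).isPreconnected
      (fun z hz => (hd z hz).differentiableWithinAt) hzero hy2 (Metric.mem_ball_self hr)
    simp only [Function.comp_apply] at this
    rwa [φ.left_inv hy1, φ.left_inv (mem_extChartAt_source x)] at this
  exact hloc.apply_eq_of_isPreconnected isPreconnected_univ trivial trivial

/-- If `⟨V, N⟩ ≥ 0` does not vanish identically, the Gauss map is constant. -/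
lemma normal_const_of_inner_pos {F N : M → E (n + 1)} {lam : ℝ}
    (hM : IsLambdaHypersurface F N lam) (hproper : IsProperMap F) {V : E (n + 1)}
    (hV : ∀ x, 0 ≤ inner ℝ V (N x)) {x₀ : M} (hx₀ : inner ℝ V (N x₀) ≠ 0) (x y : M) :
    N x = N y := by
  have := hM.hypersurface.connected
  have := hM.hypersurface.smoothManifold
  refine eq_of_mfderiv_eq_zero hM.gaussMap.smooth (fun z => ?_) x y
  have hc := inner_normal_const hM hproper hV
  -- Since u is constant, every point is a minimum; with Φ = 0 the test reads 0 ≤ -a u, and u > 0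
  -- forces a = 0.
  obtain ⟨g, a, -, -, ha, ha0, hineq⟩ := drift_laplacian_nonneg_of_isLocalMin (V := V)
    (Φ := fun _ => 0) hM (x := z) contDiffAt_const (.of_forall fun y => by simp [hc y z])
  refine ha0 (le_antisymm ?_ ha)
  have hpos : 0 < inner ℝ V (N z) := by
    rw [hc z x₀]; exact lt_of_le_of_ne (hV x₀) hx₀.symm
  simp at hineq
  by_contra! hlt
  nlinarith [mul_pos hlt hpos]

end StrongMinimum

end GaussianHypersurface

namespace GaussianHypersurface

/-! ### Local inverses, smoothness of lifts and local translations -/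

section Inverse

variable {n : ℕ} {M : Type*} [TopologicalSpace M] [ChartedSpace (E n) M]

/-- The inverse function theorem on a manifold, for maps into a vector space. -/
lemma exists_local_inverse [IsManifold (𝓡 n) ∞ M] {X : Type*} [NormedAddCommGroup X]
    [NormedSpace ℝ X] [CompleteSpace X] {g : M → X} (hg : ContMDiff (𝓡 n) 𝓘(ℝ, X) ∞ g) {x₀ : M}
    (A : E n ≃L[ℝ] X) (hA : mfderiv (𝓡 n) 𝓘(ℝ, X) g x₀ = (A : E n →L[ℝ] X)) :
    ∃ χ : OpenPartialHomeomorph M X, x₀ ∈ χ.source ∧ (∀ x ∈ χ.source, χ x = g x) ∧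
      ContMDiffOn 𝓘(ℝ, X) (𝓡 n) ∞ χ.symm χ.target := by
  set c := chartAt (E n) x₀
  set h := g ∘ c.symm
  have hcs : ∀ z ∈ c.target, ContMDiffAt (𝓡 n) (𝓡 n) ∞ c.symm z := fun z hz =>
    (contMDiffOn_chart_symm (I := 𝓡 n) (n := ∞) (x := x₀)).contMDiffAt (c.open_target.mem_nhds hz)
  have hhd : ∀ z ∈ c.target, ContDiffAt ℝ ∞ h z := fun z hz =>
    contMDiffAt_iff_contDiffAt.1 ((hg _).comp z (hcs z hz))
  have hz₀ : c x₀ ∈ c.target := mem_chart_target _ x₀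
  have hh₀ : HasFDerivAt h (A : E n →L[ℝ] X) (c x₀) := by
    have h1 : mfderiv (𝓡 n) 𝓘(ℝ, X) g x₀ = fderiv ℝ h (c x₀) := by
      rw [((hg x₀).mdifferentiableAt (by simp)).mfderiv, modelWithCornersSelf_coe, range_id,
        fderivWithin_univ]
      rfl
    rw [← hA, h1]
    exact ((hhd _ hz₀).differentiableAt (by simp)).hasFDerivAt
  set e := (hhd _ hz₀).toOpenPartialHomeomorph h hh₀ (by simp)
  -- Restricting to the open set where Dh is invertible makes the inverse smooth on its whole
  -- domain, not just at the image of x₀.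
  set O : Set (E n) := c.target ∩ fderiv ℝ h ⁻¹' range ((↑) : (E n ≃L[ℝ] X) → E n →L[ℝ] X)
  have hOo : IsOpen O := by
    refine ContinuousOn.isOpen_inter_preimage (fun z hz => ?_) c.open_target
      ContinuousLinearEquiv.isOpen
    exact (fderiv_differentiableAt
      ((hhd z hz).of_le two_le_infty)).continuousAt.continuousWithinAt
  refine ⟨c.trans (e.restrOpen O hOo), ?_, fun x hx => ?_, ?_⟩
  · rw [OpenPartialHomeomorph.trans_source, OpenPartialHomeomorph.restrOpen_source]
    exact ⟨mem_chart_source _ x₀, (hhd _ hz₀).mem_toOpenPartialHomeomorph_source hh₀ (by simp),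
      hz₀, ⟨A, hh₀.fderiv.symm⟩⟩
  · rw [OpenPartialHomeomorph.trans_source] at hx
    show g (c.symm (c x)) = g x
    rw [c.left_inv hx.1]
  · intro y hy
    rw [OpenPartialHomeomorph.trans_target] at hy
    have h1 : e.symm y ∈ e.source ∩ O := (e.restrOpen O hOo).map_target hy.1
    have hye : y ∈ e.target := hy.1.1
    obtain ⟨-, hzt, ⟨B, hB⟩⟩ := h1
    have h2 : HasFDerivAt e (B : E n →L[ℝ] X) (e.symm y) := by
      rw [hB]
      exact ((hhd _ hzt).differentiableAt (by simp)).hasFDerivAt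
    have h3 : ContDiffAt ℝ ∞ e.symm y := e.contDiffAt_symm hye h2 (hhd _ hzt)
    exact ((hcs _ hzt).comp y h3.contMDiffAt).contMDiffWithinAt

variable {F N : M → E (n + 1)}

/-- A continuous lift through an immersion of a smooth map is smooth. -/
lemma contMDiffAt_of_comp_immersion (hF : IsImmersedHypersurface F) {EP HP P : Type*}
    [NormedAddCommGroup EP] [NormedSpace ℝ EP] [TopologicalSpace HP] {I : ModelWithCorners ℝ EP HP}
    [TopologicalSpace P] [ChartedSpace HP P] {θ : P → M} {p : P} (hθ : ContinuousAt θ p)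
    (hFθ : ContMDiffAt I (𝓡 (n + 1)) ∞ (F ∘ θ) p) : ContMDiffAt I (𝓡 n) ∞ θ p := by
  have := hF.smoothManifold
  set D : E n →L[ℝ] E (n + 1) := mfderiv (𝓡 n) (𝓡 (n + 1)) F (θ p)
  -- With L a left inverse of dF, the map L ∘ F is a local diffeomorphism, and θ is its local
  -- inverse applied to L ∘ F ∘ θ.
  obtain ⟨L₀, hL₀⟩ := (D : E n →ₗ[ℝ] E (n + 1)).exists_leftInverse_of_injective
    (LinearMap.ker_eq_bot.2 (hF.immersion (θ p)))
  set L : E (n + 1) →L[ℝ] E n := LinearMap.toContinuousLinearMap L₀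
  have hLs : ContMDiff (𝓡 (n + 1)) (𝓡 n) ∞ L := L.contDiff.contMDiff
  have hLF : ContMDiff (𝓡 n) (𝓡 n) ∞ (L ∘ F) := hLs.comp hF.smooth
  have hder : mfderiv (𝓡 n) (𝓡 n) (L ∘ F) (θ p) =
      (ContinuousLinearEquiv.refl ℝ (E n) : E n →L[ℝ] E n) := by
    rw [mfderiv_comp (θ p) ((hLs _).mdifferentiableAt (by simp))
      ((hF.smooth _).mdifferentiableAt (by simp)), mfderiv_eq_fderiv, L.fderiv]
    ext1 v
    exact congrArg (fun T : E n →ₗ[ℝ] E n => T v) hL₀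
  obtain ⟨χ, hχ, hχg, hχs⟩ := exists_local_inverse hLF _ hder
  have heq : θ =ᶠ[𝓝 p] χ.symm ∘ (L ∘ (F ∘ θ)) := by
    filter_upwards [hθ.eventually_mem (χ.open_source.mem_nhds hχ)] with q hq
    have h1 := hχg _ hq
    simp only [Function.comp_apply] at h1 ⊢
    rw [← h1, χ.left_inv hq]
  refine ContMDiffAt.congr_of_eventuallyEq ?_ heq
  have h3 : L (F (θ p)) ∈ χ.target := by
    have h1 := hχg _ hχ
    simp only [Function.comp_apply] at h1
    rw [← h1]
    exact χ.map_source hχ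
  exact (hχs.contMDiffAt (χ.open_target.mem_nhds h3)).comp p ((hLs _).comp p hFθ)

/-- The tangent space is the orthogonal complement of the normal. -/
lemma exists_mfderiv_eq_of_inner_eq_zero (hF : IsImmersedHypersurface F) (hN : IsGaussMap F N)
    (x : M) {v : E (n + 1)} (hv : inner ℝ v (N x) = 0) :
    ∃ w : TangentSpace (𝓡 n) x, mfderiv (𝓡 n) (𝓡 (n + 1)) F x w = v := by
  set D' : E n →L[ℝ] E (n + 1) := mfderiv (𝓡 n) (𝓡 (n + 1)) F x
  set D := (D' : E n →ₗ[ℝ] E (n + 1))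
  have hne : N x ≠ 0 := by
    rw [← norm_ne_zero_iff, hN.norm_eq_one]; norm_num
  have hle : LinearMap.range D ≤ (Submodule.span ℝ {N x})ᗮ := by
    rintro _ ⟨w, rfl⟩
    rw [Submodule.mem_orthogonal_singleton_iff_inner_right]
    exact hN.orthogonal x w
  have : Fact (Module.finrank ℝ (E (n + 1)) = n + 1) := ⟨by simp⟩
  have heq := Submodule.eq_of_le_of_finrank_eq hle (by
    rw [Submodule.finrank_orthogonal_span_singleton (n := n) hne, LinearMap.finrank_range_of_inj
      (f := D) (hF.immersion x)]
    simp)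
  have hmem : v ∈ LinearMap.range D := by
    rw [heq, Submodule.mem_orthogonal_singleton_iff_inner_left]
    exact hv
  exact hmem

/-- The directions that are tangent to the hypersurface at all of its points. -/
def tangentDirections {M : Type*} (N : M → E (n + 1)) : Submodule ℝ (E (n + 1)) :=
  ⨅ x, (Submodule.span ℝ {N x})ᗮ

lemma mem_tangentDirections {M : Type*} {N : M → E (n + 1)} {v : E (n + 1)} :
    v ∈ tangentDirections N ↔ ∀ x, inner ℝ v (N x) = 0 := by
  simp only [tangentDirections, Submodule.mem_iInf, Submodule.mem_orthogonal_singleton_iff_inner_left]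

/-- In the chart χ = L ∘ F the parametrization k = F ∘ χ⁻¹ has L ∘ k = id. If v is tangent
everywhere then Dk(Lv) = v, so k(χ x + tLv) - tv is constant in t. T is defined for all small v, so
its continuity is that of an open product set. -/
lemma exists_local_translation (hF : IsImmersedHypersurface F) (hN : IsGaussMap F N) (x₀ : M) :
    ∃ U ∈ 𝓝 x₀, ∃ δ > 0, ∃ T : M × E (n + 1) → M,
      ContinuousOn T (U ×ˢ Metric.ball 0 δ) ∧ (∀ x ∈ U, T (x, 0) = x) ∧
      ∀ x ∈ U, ∀ v ∈ tangentDirections N, ‖v‖ < δ → F (T (x, v)) = F x + v := by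
  have := hF.smoothManifold
  set D : E n →L[ℝ] E (n + 1) := mfderiv (𝓡 n) (𝓡 (n + 1)) F x₀
  obtain ⟨L₀, hL₀⟩ := (D : E n →ₗ[ℝ] E (n + 1)).exists_leftInverse_of_injective
    (LinearMap.ker_eq_bot.2 (hF.immersion x₀))
  set L : E (n + 1) →L[ℝ] E n := LinearMap.toContinuousLinearMap L₀
  have hLs : ContMDiff (𝓡 (n + 1)) (𝓡 n) ∞ L := L.contDiff.contMDiff
  have hLF : ContMDiff (𝓡 n) (𝓡 n) ∞ (L ∘ F) := hLs.comp hF.smooth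
  have hder : mfderiv (𝓡 n) (𝓡 n) (L ∘ F) x₀ =
      (ContinuousLinearEquiv.refl ℝ (E n) : E n →L[ℝ] E n) := by
    rw [mfderiv_comp x₀ ((hLs _).mdifferentiableAt (by simp))
      ((hF.smooth _).mdifferentiableAt (by simp)), mfderiv_eq_fderiv, L.fderiv]
    ext1 v
    exact congrArg (fun T : E n →ₗ[ℝ] E n => T v) hL₀
  obtain ⟨χ, hχ, hχg, hχs⟩ := exists_local_inverse hLF _ hder
  set k : E n → E (n + 1) := F ∘ χ.symm with hk
  have hχsm : ∀ z ∈ χ.target, ContMDiffAt (𝓡 n) (𝓡 n) ∞ χ.symm z := fun z hz =>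
    hχs.contMDiffAt (χ.open_target.mem_nhds hz)
  have hkd : ∀ z ∈ χ.target, DifferentiableAt ℝ k z := fun z hz =>
    (contMDiffAt_iff_contDiffAt.1 ((hF.smooth _).comp z (hχsm z hz))).differentiableAt (by simp)
  have hkL : ∀ z ∈ χ.target, ∀ w, L (fderiv ℝ k z w) = w := by
    intro z hz w
    have h1 : (L : E (n + 1) → E n) ∘ k =ᶠ[𝓝 z] id := by
      filter_upwards [χ.open_target.mem_nhds hz] with y hy
      have := hχg _ (χ.map_target hy)
      rw [χ.right_inv hy] at this
      exact this.symm
    have h2 := h1.fderiv_eq (𝕜 := ℝ)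
    rw [fderiv_comp z L.differentiable.differentiableAt (hkd z hz), L.fderiv, fderiv_id] at h2
    exact congrArg (fun T : E n →L[ℝ] E n => T w) h2
  have hkv : ∀ z ∈ χ.target, ∀ v ∈ tangentDirections N, fderiv ℝ k z (L v) = v := by
    intro z hz v hv
    have hc : fderiv ℝ k z = (mfderiv (𝓡 n) (𝓡 (n + 1)) F (χ.symm z)).comp
        (mfderiv (𝓡 n) (𝓡 n) χ.symm z) := by
      rw [← mfderiv_eq_fderiv]
      exact mfderiv_comp z ((hF.smooth _).mdifferentiableAt (by simp))
        ((hχsm z hz).mdifferentiableAt (by simp))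
    obtain ⟨w, hw⟩ := exists_mfderiv_eq_of_inner_eq_zero hF hN (χ.symm z)
      (mem_tangentDirections.1 hv (χ.symm z))
    set S : E n →L[ℝ] E n := mfderiv (𝓡 n) (𝓡 n) χ.symm z
    have hSinj : Function.Injective S := by
      intro a b hab
      rw [← hkL z hz a, ← hkL z hz b, hc]
      exact congrArg (fun y => L (mfderiv (𝓡 n) (𝓡 (n + 1)) F (χ.symm z) y)) hab
    obtain ⟨u, hu⟩ := (LinearMap.injective_iff_surjective (f := (S : E n →ₗ[ℝ] E n))).1 hSinj w
    have h1 : fderiv ℝ k z u = v := by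
      rw [hc, ← hw, ← hu]
      rfl
    rw [← h1, hkL z hz u]
  obtain ⟨r, hr, hball⟩ := Metric.isOpen_iff.1 χ.open_target _ (χ.map_source hχ)
  have hLpos : 0 < ‖L‖ + 1 := by positivity
  -- Half of r is spent on χ x - χ x₀ and half on Lv; the summand 1 covers the case L = 0.
  refine ⟨χ.source ∩ χ ⁻¹' Metric.ball (χ x₀) (r / 2), ?_, r / 2 / (‖L‖ + 1), by positivity,
    fun q => χ.symm (χ q.1 + L q.2), ?_, ?_, ?_⟩
  · exact inter_mem (χ.open_source.mem_nhds hχ)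
      ((χ.continuousAt hχ).preimage_mem_nhds (Metric.ball_mem_nhds _ (by positivity)))
  · have hmaps : MapsTo (fun q : M × E (n + 1) => χ q.1 + L q.2)
        ((χ.source ∩ χ ⁻¹' Metric.ball (χ x₀) (r / 2)) ×ˢ Metric.ball 0 (r / 2 / (‖L‖ + 1)))
        χ.target := by
      rintro ⟨x, v⟩ ⟨⟨hx, hxr⟩, hv⟩
      apply hball
      rw [mem_preimage, mem_ball_iff_norm] at hxr
      rw [mem_ball_zero_iff] at hv
      rw [mem_ball_iff_norm]
      have h1 : ‖L v‖ < r / 2 := by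
        have h2 : ‖v‖ * (‖L‖ + 1) < r / 2 := (lt_div_iff₀ hLpos).1 hv
        have := L.le_opNorm v
        nlinarith [norm_nonneg v]
      calc ‖χ x + L v - χ x₀‖ = ‖(χ x - χ x₀) + L v‖ := by congr 1; abel
        _ ≤ ‖χ x - χ x₀‖ + ‖L v‖ := norm_add_le _ _
        _ < r := by linarith
    refine χ.continuousOn_symm.comp (ContinuousOn.add ?_ ?_) hmaps
    · exact χ.continuousOn.comp continuousOn_fst fun q hq => hq.1.1
    · exact (L.continuous.comp continuous_snd).continuousOn
  · rintro x ⟨hx, -⟩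
    simp [χ.left_inv hx]
  · rintro x ⟨hx, hxr⟩ v hv hvδ
    rw [mem_preimage, mem_ball_iff_norm] at hxr
    have h1 : ‖L v‖ < r / 2 := by
      have h2 : ‖v‖ * (‖L‖ + 1) < r / 2 := (lt_div_iff₀ hLpos).1 hvδ
      have := L.le_opNorm v
      nlinarith [norm_nonneg v]
    have hmem : ∀ t ∈ Icc (0 : ℝ) 1, χ x + t • L v ∈ χ.target := by
      rintro t ⟨ht0, ht1⟩
      apply hball
      rw [mem_ball_iff_norm]
      have h2 : ‖t • L v‖ ≤ ‖L v‖ := by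
        rw [norm_smul, Real.norm_of_nonneg ht0]
        exact mul_le_of_le_one_left (norm_nonneg _) ht1
      calc ‖χ x + t • L v - χ x₀‖ = ‖(χ x - χ x₀) + t • L v‖ := by congr 1; abel
        _ ≤ ‖χ x - χ x₀‖ + ‖t • L v‖ := norm_add_le _ _
        _ < r := by linarith
    have hder : ∀ t ∈ Icc (0 : ℝ) 1,
        HasDerivAt (fun t : ℝ => k (χ x + t • L v) - t • v) 0 t := by
      intro t ht
      have h2 : HasDerivAt (fun t : ℝ => χ x + t • L v) (L v) t := by
        simpa using ((hasDerivAt_id t).smul_const (L v)).const_add (χ x)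
      have h3 := (hkd _ (hmem t ht)).hasFDerivAt.comp_hasDerivAt t h2
      rw [hkv _ (hmem t ht) v hv] at h3
      have h4 : HasDerivAt (fun t : ℝ => t • v) v t := by
        simpa using (hasDerivAt_id t).smul_const v
      simpa using h3.fun_sub h4
    have := constant_of_has_deriv_right_zero
      (fun t ht => (hder t ht).continuousAt.continuousWithinAt)
      (fun t ht => (hder t (Ico_subset_Icc_self ht)).hasDerivWithinAt) 1 (by simp)
    simp only [one_smul, zero_smul, add_zero, sub_zero, hk, Function.comp_apply,
      χ.left_inv hx] at this
    exact sub_eq_iff_eq_add.1 this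

end Inverse

end GaussianHypersurface

namespace GaussianHypersurface

/-! ### Lifting segments through the immersion -/

section Lift

variable {n : ℕ} {M : Type*} [TopologicalSpace M]

/-- `γ` is a lift through `F` of the segment `t ↦ F x + t v`, `0 ≤ t ≤ T`, that starts at `x`. -/
structure IsSegmentLift (F : M → E (n + 1)) (x : M) (v : E (n + 1)) (T : ℝ) (γ : ℝ → M) :
    Prop where
  continuousOn : ContinuousOn γ (Icc 0 T)
  start : γ 0 = x
  map : ∀ t ∈ Icc 0 T, F (γ t) = F x + t • v

variable {F : M → E (n + 1)} {x : M} {v : E (n + 1)} {T : ℝ} {γ γ' : ℝ → M}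

namespace IsSegmentLift

/-- The lifts agree on a closed set because M is Hausdorff, and on an open one because F is locally
injective; the interval is connected. -/
lemma eqOn [T2Space M] (hF : IsLocallyInjective F) (h : IsSegmentLift F x v T γ)
    (h' : IsSegmentLift F x v T γ') (hT : 0 ≤ T) : EqOn γ γ' (Icc 0 T) :=
  (T2Space.isSeparatedMap F).eqOn_of_comp_eqOn hF isPreconnected_Icc h.continuousOn
    h'.continuousOn (fun t ht => by simp [h.map t ht, h'.map t ht]) ⟨le_rfl, hT⟩
    (h.start.trans h'.start.symm)

/-- The case t < s is included: the lift may be followed backwards. -/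
lemma subsegment (h : IsSegmentLift F x v 1 γ) {s t : ℝ} (hs : s ∈ Icc (0 : ℝ) 1)
    (ht : t ∈ Icc (0 : ℝ) 1) :
    IsSegmentLift F (γ s) ((t - s) • v) 1 (fun r => γ (s + r * (t - s))) := by
  have hmaps : MapsTo (fun r : ℝ => s + r * (t - s)) (Icc 0 1) (Icc 0 1) := by
    rintro r ⟨hr0, hr1⟩
    obtain ⟨hs0, hs1⟩ := hs
    obtain ⟨ht0, ht1⟩ := ht
    constructor <;> nlinarith
  refine ⟨h.continuousOn.comp (by fun_prop) hmaps, by simp, fun r hr => ?_⟩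
  rw [h.map _ (hmaps hr), h.map _ hs]
  module

lemma rescale {N : ℝ} (hN : 0 < N) (h : IsSegmentLift F x (N⁻¹ • v) N γ) :
    IsSegmentLift F x v 1 (fun r => γ (N * r)) := by
  have hmaps : MapsTo (fun r : ℝ => N * r) (Icc 0 1) (Icc 0 N) := by
    rintro r ⟨hr0, hr1⟩
    constructor <;> nlinarith
  refine ⟨h.continuousOn.comp (by fun_prop) hmaps, by simp [h.start], fun r hr => ?_⟩
  rw [h.map _ (hmaps hr), smul_smul]
  congr 2
  field_simp

lemma append (hT : 0 ≤ T) (h : IsSegmentLift F x v T γ) (h' : IsSegmentLift F (γ T) v 1 γ') :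
    IsSegmentLift F x v (T + 1) (fun t => if t ≤ T then γ t else γ' (t - T)) := by
  have hTs : (T : ℝ) ∈ Icc (0 : ℝ) T := ⟨hT, le_rfl⟩
  refine ⟨?_, by simp [hT, h.start], fun t ht => ?_⟩
  · rw [← Icc_union_Icc_eq_Icc hT (by linarith : T ≤ T + 1)]
    refine ContinuousOn.union_of_isClosed ?_ ?_ isClosed_Icc isClosed_Icc
    · exact h.continuousOn.congr fun t ht => if_pos ht.2
    · have hc : ContinuousOn (fun t => γ' (t - T)) (Icc T (T + 1)) :=
        h'.continuousOn.comp (by fun_prop) fun t ht => ⟨by linarith [ht.1], by linarith [ht.2]⟩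
      refine hc.congr fun t ht => ?_
      by_cases htT : t ≤ T
      · have : t = T := le_antisymm htT ht.1
        simp [this, h'.start]
      · exact if_neg htT
  · by_cases htT : t ≤ T
    · simp only [if_pos htT]
      exact h.map t ⟨ht.1, htT⟩
    · simp only [if_neg htT]
      rw [h'.map _ ⟨by linarith, by linarith [ht.2]⟩, h.map T hTs]
      module

end IsSegmentLift

/-- The map `T` of `exists_local_translation` along a ray. -/
lemma isSegmentLift_of_local {N : M → E (n + 1)} {U : Set M} {δ : ℝ} {T : M × E (n + 1) → M}
    (hT : ContinuousOn T (U ×ˢ Metric.ball 0 δ)) (hT0 : ∀ x ∈ U, T (x, 0) = x)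
    (hTF : ∀ x ∈ U, ∀ v ∈ tangentDirections N, ‖v‖ < δ → F (T (x, v)) = F x + v)
    {x : M} (hx : x ∈ U) {v : E (n + 1)} (hv : v ∈ tangentDirections N) (hvδ : ‖v‖ < δ) :
    IsSegmentLift F x v 1 (fun t => T (x, t • v)) := by
  have hnorm : ∀ t ∈ Icc (0 : ℝ) 1, ‖t • v‖ < δ := by
    rintro t ⟨ht0, ht1⟩
    rw [norm_smul, Real.norm_of_nonneg ht0]
    exact (mul_le_of_le_one_left (norm_nonneg _) ht1).trans_lt hvδ
  refine ⟨hT.comp (by fun_prop) fun t ht => ⟨hx, by simpa using hnorm t ht⟩,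
    by simp [hT0 x hx], fun t ht => ?_⟩
  exact hTF x hx _ (Submodule.smul_mem _ _ hv) (hnorm t ht)

end Lift

/-! ### The translation action of the everywhere tangent directions -/

section Translation

variable {n : ℕ} {M : Type*} [TopologicalSpace M] [ChartedSpace (E n) M] {F N : M → E (n + 1)}

lemma IsImmersedHypersurface.isLocallyInjective (hF : IsImmersedHypersurface F)
    (hN : IsGaussMap F N) : IsLocallyInjective F := by
  rw [isLocallyInjective_iff_nhds]
  intro x
  obtain ⟨U, hU, h⟩ := eventually_chord_transverse hF hN x
  refine ⟨U, hU, fun y hy z hz hyz => ?_⟩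
  by_contra hne
  have := h y hy z hz hne
  simp [hyz] at this

/-- A lift never leaves the preimage of the ball of radius ‖v‖ around F x, compact by properness.
Hence one step size δ works along the whole segment, and finitely many short lifts are concatenated.
-/
lemma exists_isSegmentLift (hF : IsImmersedHypersurface F) (hN : IsGaussMap F N)
    (hproper : IsProperMap F) (x : M) {v : E (n + 1)} (hv : v ∈ tangentDirections N) :
    ∃ γ, IsSegmentLift F x v 1 γ := by
  have hK : IsCompact (F ⁻¹' Metric.closedBall (F x) ‖v‖) :=
    hproper.isCompact_preimage (isCompact_closedBall _ _)
  obtain ⟨δ, hδ, hδK⟩ : ∃ δ > 0, ∀ y ∈ F ⁻¹' Metric.closedBall (F x) ‖v‖,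
      ∀ w ∈ tangentDirections N, ‖w‖ < δ → ∃ γ, IsSegmentLift F y w 1 γ := by
    refine hK.induction_on (p := fun s => ∃ δ > 0, ∀ y ∈ s,
      ∀ w ∈ tangentDirections N, ‖w‖ < δ → ∃ γ, IsSegmentLift F y w 1 γ) ?_ ?_ ?_ ?_
    · exact ⟨1, one_pos, by simp⟩
    · rintro s t hst ⟨δ, hδ, h⟩
      exact ⟨δ, hδ, fun y hy => h y (hst hy)⟩
    · rintro s t ⟨δ, hδ, h⟩ ⟨δ', hδ', h'⟩
      refine ⟨min δ δ', lt_min hδ hδ', fun y hy w hw hwδ => ?_⟩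
      rcases hy with hy | hy
      · exact h y hy w hw (hwδ.trans_le (min_le_left _ _))
      · exact h' y hy w hw (hwδ.trans_le (min_le_right _ _))
    · intro y _
      obtain ⟨U, hU, δ, hδ, T, hT, hT0, hTF⟩ := exists_local_translation hF hN y
      exact ⟨U, mem_nhdsWithin_of_mem_nhds hU, δ, hδ, fun z hz w hw hwδ =>
        ⟨_, isSegmentLift_of_local hT hT0 hTF hz hw hwδ⟩⟩
  obtain ⟨m, hm⟩ := exists_nat_gt (‖v‖ / δ)
  have hm0 : (0 : ℝ) < m := (by positivity : 0 ≤ ‖v‖ / δ).trans_lt hm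
  set w := (m : ℝ)⁻¹ • v with hw
  have hwW : w ∈ tangentDirections N := Submodule.smul_mem _ _ hv
  have hwn : ‖w‖ = ‖v‖ / m := by
    rw [hw, norm_smul, norm_inv, Real.norm_of_nonneg hm0.le]; field_simp
  have hwδ : ‖w‖ < δ := by
    rw [hwn, div_lt_iff₀ hm0]
    rw [div_lt_iff₀ hδ] at hm
    linarith
  have hind : ∀ j : ℕ, j ≤ m → ∃ γ, IsSegmentLift F x w j γ := by
    intro j
    induction j with
    | zero =>
      intro _
      refine ⟨fun _ => x, continuousOn_const, rfl, fun t ht => ?_⟩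
      have : t = 0 := le_antisymm (by simpa using ht.2) ht.1
      simp [this]
    | succ j ih =>
      intro hj
      obtain ⟨γ, hγ⟩ := ih (by omega)
      have hj0 : (0 : ℝ) ≤ j := j.cast_nonneg
      have hmem : γ j ∈ F ⁻¹' Metric.closedBall (F x) ‖v‖ := by
        rw [mem_preimage, mem_closedBall_iff_norm, hγ.map j ⟨hj0, le_rfl⟩, add_sub_cancel_left,
          norm_smul, Real.norm_of_nonneg hj0, hwn, mul_div_assoc', div_le_iff₀ hm0, mul_comm]
        have : (j : ℝ) ≤ m := by exact_mod_cast (by omega : j ≤ m)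
        gcongr
      obtain ⟨γ', hγ'⟩ := hδK _ hmem w hwW hwδ
      have happ := hγ.append hj0 hγ'
      rw [← Nat.cast_succ] at happ
      exact ⟨_, happ⟩
  obtain ⟨γ, hγ⟩ := hind m le_rfl
  exact ⟨_, hγ.rescale hm0⟩

/-- Translations in the directions that are everywhere tangent lift to the hypersurface. -/
lemma exists_translation (hF : IsImmersedHypersurface F) (hN : IsGaussMap F N)
    (hproper : IsProperMap F) :
    ∃ θ : M → tangentDirections N → M, Continuous (fun q : M × tangentDirections N => θ q.1 q.2) ∧
      (∀ x, θ x 0 = x) ∧ (∀ x v, F (θ x v) = F x + v) ∧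
      ∀ x v w, θ (θ x v) w = θ x (v + w) := by
  have := hF.t2
  have hinj := hF.isLocallyInjective hN
  have hex : ∀ (x : M) (v : tangentDirections N), ∃ γ, IsSegmentLift F x (v : E (n + 1)) 1 γ :=
    fun x v => exists_isSegmentLift hF hN hproper x v.2
  choose Γ hΓ using hex
  have h1m : (1 : ℝ) ∈ Icc (0 : ℝ) 1 := ⟨zero_le_one, le_rfl⟩
  have h0m : (0 : ℝ) ∈ Icc (0 : ℝ) 1 := ⟨le_rfl, zero_le_one⟩
  have huniq : ∀ x (v : tangentDirections N) γ, IsSegmentLift F x (v : E (n + 1)) 1 γ →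
      Γ x v 1 = γ 1 := fun x v γ hγ => (hΓ x v).eqOn hinj hγ zero_le_one h1m
  have hsub : ∀ x (v : tangentDirections N) (s t : ℝ), s ∈ Icc (0 : ℝ) 1 → t ∈ Icc (0 : ℝ) 1 →
      Γ (Γ x v s) ((t - s) • v) 1 = Γ x v t := by
    intro x v s t hs ht
    rw [huniq _ ((t - s) • v) _ ((hΓ x v).subsegment hs ht)]
    congr 1; ring
  have hzero : ∀ x, Γ x 0 1 = x := fun x =>
    huniq x 0 (fun _ => x) ⟨continuousOn_const, rfl, by simp⟩
  have hcont : Continuous (fun q : M × tangentDirections N => Γ q.1 q.2 1) := by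
    rw [continuous_iff_continuousAt]
    rintro ⟨x₀, v₀⟩
    set P : unitInterval → Prop := fun t =>
      ContinuousAt (fun q : M × tangentDirections N => Γ q.1 q.2 t) (x₀, v₀)
    -- Near (x₀, v₀), uniqueness of lifts gives Γ_t = T(Γ_s, (t - s)v) for s, t close together, so
    -- continuity passes from time s to time t. It holds at time 0, hence at time 1.
    have hloc : IsLocallyConstant P := by
      rw [IsLocallyConstant.iff_exists_open]
      intro t₀
      obtain ⟨U, hU, δ, hδ, T, hT, hT0, hTF⟩ := exists_local_translation hF hN (Γ x₀ v₀ t₀)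
      have hγc : Continuous fun t : unitInterval => Γ x₀ v₀ t :=
        continuousOn_iff_continuous_domRestrict.1 (hΓ x₀ v₀).continuousOn
      have hstep : ∀ s t : unitInterval, Γ x₀ v₀ s ∈ interior U →
          ‖((t : ℝ) - s) • v₀‖ < δ → P s → P t := by
        intro s t hs hst hPs
        have heq : (fun q : M × tangentDirections N => Γ q.1 q.2 t) =ᶠ[𝓝 (x₀, v₀)]
            fun q => T (Γ q.1 q.2 s, (((t : ℝ) - s) • q.2 : tangentDirections N)) := by
          have e1 : ∀ᶠ q : M × tangentDirections N in 𝓝 (x₀, v₀), Γ q.1 q.2 s ∈ interior U :=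
            hPs.eventually_mem (isOpen_interior.mem_nhds hs)
          have e2 : ∀ᶠ q : M × tangentDirections N in 𝓝 (x₀, v₀), ‖((t : ℝ) - s) • q.2‖ < δ := by
            have : Continuous fun q : M × tangentDirections N => ‖((t : ℝ) - s) • q.2‖ := by
              fun_prop
            exact this.continuousAt.eventually_lt_const hst
          filter_upwards [e1, e2] with q hq1 hq2
          have h2 := isSegmentLift_of_local hT hT0 hTF (interior_subset hq1)
            (((t : ℝ) - s) • q.2).2 hq2
          rw [← hsub q.1 q.2 s t s.2 t.2, huniq _ _ _ h2, one_smul]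
        refine ContinuousAt.congr ?_ heq.symm
        have hTc : ContinuousAt T (Γ x₀ v₀ s, (((t : ℝ) - s) • v₀ : tangentDirections N)) :=
          hT.continuousAt (prod_mem_nhds (mem_interior_iff_mem_nhds.1 hs)
            (Metric.isOpen_ball.mem_nhds (by simpa using hst)))
        refine ContinuousAt.comp (g := T) (f := fun q : M × tangentDirections N =>
          (Γ q.1 q.2 s, ((((t : ℝ) - s) • q.2 : tangentDirections N) : E (n + 1)))) hTc ?_
        exact hPs.prodMk (by fun_prop)
      have ho1 : ∀ᶠ t : unitInterval in 𝓝 t₀, Γ x₀ v₀ t ∈ interior U :=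
        hγc.continuousAt.eventually_mem (isOpen_interior.mem_nhds (mem_interior_iff_mem_nhds.2 hU))
      have ho2 : ∀ᶠ t : unitInterval in 𝓝 t₀, ‖((t : ℝ) - t₀) • v₀‖ < δ := by
        have : Continuous fun t : unitInterval => ‖((t : ℝ) - t₀) • v₀‖ := by fun_prop
        refine this.continuousAt.eventually_lt_const ?_
        simpa using hδ
      obtain ⟨O, hO, hOo, hOt⟩ := eventually_nhds_iff.1 (ho1.and ho2)
      refine ⟨O, hOo, hOt, fun t ht => ?_⟩
      refine propext ⟨fun h => ?_, fun h => ?_⟩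
      · refine hstep t t₀ (hO t ht).1 ?_ h
        rw [← norm_neg, ← neg_smul, neg_sub]
        exact (hO t ht).2
      · exact hstep t₀ t (hO t₀ hOt).1 (hO t ht).2 h
    have hP0 : P 0 := by
      have : (fun q : M × tangentDirections N => Γ q.1 q.2 ((0 : unitInterval) : ℝ)) = Prod.fst := by
        ext q; exact (hΓ q.1 q.2).start
      show ContinuousAt _ _
      rw [this]
      exact continuousAt_fst
    have hP1 : P 1 := by
      have := hloc.apply_eq_of_isPreconnected isPreconnected_univ (mem_univ (0 : unitInterval))
        (mem_univ 1)
      rwa [this] at hP0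
    exact hP1
  have hmap : ∀ x (v : tangentDirections N), F (Γ x v 1) = F x + v := fun x v => by
    have := (hΓ x v).map 1 h1m
    rwa [one_smul] at this
  refine ⟨fun x v => Γ x v 1, hcont, hzero, hmap, fun x v w => ?_⟩
  -- Moving by rv and then by rw lifts the segment in direction v + w, so additivity is again
  -- uniqueness of lifts.
  have hlift : IsSegmentLift F x ((v + w : tangentDirections N) : E (n + 1)) 1
      (fun r => Γ (Γ x (r • v) 1) (r • w) 1) := by
    refine ⟨?_, by simp [hzero], fun r _ => ?_⟩
    · have h1 : Continuous fun r : ℝ => Γ x (r • v) 1 :=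
        hcont.comp (by fun_prop : Continuous fun r : ℝ => (x, r • v))
      have h2 : Continuous fun r : ℝ => (Γ x (r • v) 1, r • w) := h1.prodMk (by fun_prop)
      exact (hcont.comp h2).continuousOn
    · rw [hmap, hmap]
      simp only [Submodule.coe_smul, Submodule.coe_add]
      module
  have := huniq x (v + w) _ hlift
  simp only [one_smul] at this
  exact this.symm

/-- A proper hypersurface with constant Gauss map is a hyperplane. -/
lemma isHyperplane_of_normal_const (hF : IsImmersedHypersurface F) (hN : IsGaussMap F N)
    (hproper : IsProperMap F) (hconst : ∀ x y, N x = N y) : IsHyperplane F := by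
  have := hF.connected
  have := hF.smoothManifold
  obtain ⟨x₀⟩ : Nonempty M := inferInstance
  obtain ⟨θ, hθ, hθ0, hθF, hθadd⟩ := exists_translation hF hN hproper
  set V := N x₀ with hV
  have hV0 : V ≠ 0 := by rw [← norm_ne_zero_iff, hN.norm_eq_one]; norm_num
  have hW : ∀ v, v ∈ tangentDirections N ↔ inner ℝ V v = 0 := fun v => by
    rw [mem_tangentDirections]
    refine ⟨fun h => (real_inner_comm _ _).trans (h x₀), fun h x => ?_⟩
    rw [hconst x x₀]
    exact (real_inner_comm _ _).trans h
  have hFV : ∀ x, inner ℝ V (F x) = inner ℝ V (F x₀) := by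
    intro x
    -- The functional ⟨V, ·⟩ takes values in `E 1` so that `eq_of_mfderiv_eq_zero` applies.
    set L : E (n + 1) →L[ℝ] E 1 :=
      (innerSL ℝ V).smulRight (EuclideanSpace.single (0 : Fin 1) (1 : ℝ)) with hL
    have hLs : ContMDiff (𝓡 (n + 1)) (𝓡 1) ∞ L := L.contDiff.contMDiff
    have hLu : ∀ u, inner ℝ V u = 0 → L u = 0 := fun u hu => by
      rw [hL, ContinuousLinearMap.smulRight_apply, innerSL_apply_apply, hu, zero_smul]
    have h1 := eq_of_mfderiv_eq_zero (f := L ∘ F) (hLs.comp hF.smooth) (fun y => ?_) x x₀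
    · have := congrArg (fun z : E 1 => z 0) h1
      simpa [hL] using this
    · rw [mfderiv_comp y ((hLs _).mdifferentiableAt (by simp))
        ((hF.smooth _).mdifferentiableAt (by simp)), mfderiv_eq_fderiv, L.fderiv]
      ext1 w
      have h2 : inner ℝ V (mfderiv (𝓡 n) (𝓡 (n + 1)) F y w : E (n + 1)) = 0 := by
        rw [hV, hconst x₀ y]; exact hN.orthogonal y w
      exact hLu _ h2
  have hdiff : ∀ x y, F x - F y ∈ tangentDirections N := fun x y => by
    rw [hW, inner_sub_right, hFV x, hFV y, sub_self]
  -- For z near y, the points z and θ y (F z - F y) have the same image and both lie where F is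
  -- injective. So orbits are open, and by connectedness there is only one.
  have horbit : ∀ y, ∀ᶠ z in 𝓝 y, ∃ v, z = θ y v := by
    intro y
    obtain ⟨U, hU, hinj⟩ := isLocallyInjective_iff_nhds.1 (hF.isLocallyInjective hN) y
    have hc : Continuous fun z => θ y ⟨F z - F y, hdiff z y⟩ :=
      hθ.comp (continuous_const.prodMk
        ((hF.smooth.continuous.sub continuous_const).subtype_mk _))
    have hyU : θ y ⟨F y - F y, hdiff y y⟩ = y := by
      have : (⟨F y - F y, hdiff y y⟩ : tangentDirections N) = 0 := Subtype.ext (sub_self _)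
      rw [this, hθ0]
    have hev : ∀ᶠ z in 𝓝 y, θ y ⟨F z - F y, hdiff z y⟩ ∈ U := by
      have := hc.tendsto y
      rw [hyU] at this
      exact this hU
    filter_upwards [hU, hev] with z hz hz'
    refine ⟨_, hinj hz hz' ?_⟩
    rw [hθF]
    simp
  have hclopen : IsClopen {z | ∃ v, z = θ x₀ v} := by
    constructor
    · rw [← isOpen_compl_iff, isOpen_iff_mem_nhds]
      intro y hy
      filter_upwards [horbit y] with z hz hz'
      obtain ⟨v, rfl⟩ := hz
      obtain ⟨w, hw⟩ := hz'
      refine hy ⟨w - v, ?_⟩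
      rw [sub_eq_add_neg, ← hθadd, ← hw, hθadd, add_neg_cancel, hθ0]
    · rw [isOpen_iff_mem_nhds]
      rintro _ ⟨v, rfl⟩
      filter_upwards [horbit (θ x₀ v)] with z hz
      obtain ⟨w, rfl⟩ := hz
      exact ⟨v + w, hθadd _ _ _⟩
  have huniv := hclopen.eq_univ ⟨x₀, 0, (hθ0 x₀).symm⟩
  have hall : ∀ z, ∃ v, z = θ x₀ v := fun z => by
    have : z ∈ {z | ∃ v, z = θ x₀ v} := by rw [huniv]; trivial
    exact this
  refine ⟨fun a b hab => ?_, V, inner ℝ V (F x₀), hV0, ?_⟩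
  · obtain ⟨v, rfl⟩ := hall a
    obtain ⟨w, rfl⟩ := hall b
    rw [hθF, hθF, add_left_cancel_iff] at hab
    rw [Subtype.ext hab]
  · ext y
    refine ⟨?_, fun hy => ?_⟩
    · rintro ⟨x, rfl⟩
      exact hFV x
    · have hy' : inner ℝ V y = inner ℝ V (F x₀) := hy
      have hmem : y - F x₀ ∈ tangentDirections N := by
        rw [hW, inner_sub_right, hy', sub_self]
      exact ⟨θ x₀ ⟨_, hmem⟩, by rw [hθF]; simp⟩

end Translation

end GaussianHypersurface

namespace GaussianHypersurface

/-! ### The level set of the last coordinates as a manifold -/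

section Slice

variable {n k p : ℕ} {M : Type*} [TopologicalSpace M]

/-- The chart of the level set `{s = 0}` that is induced by a chart of `M` in which `s` is a linear
projection. -/
def sliceChart {s : M → E p} (χ : OpenPartialHomeomorph M (E k × E p))
    (hχ : ∀ x ∈ χ.source, (χ x).2 = s x) (m : {x : M // s x = 0}) :
    OpenPartialHomeomorph {x : M // s x = 0} (E k) where
  toFun x := (χ x).1
  -- The point m is a default value; on the target the condition always holds.
  invFun z := open Classical in if h : s (χ.symm (z, 0)) = 0 then ⟨χ.symm (z, 0), h⟩ else m
  source := {x | (x : M) ∈ χ.source}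
  target := {z | (z, (0 : E p)) ∈ χ.target}
  map_source' x hx := by
    have h : ((χ x).1, (0 : E p)) = χ x := Prod.ext rfl ((hχ x hx).trans x.2).symm
    show ((χ x).1, (0 : E p)) ∈ χ.target
    rw [h]
    exact χ.map_source hx
  map_target' z hz := by
    have hz' : (z, (0 : E p)) ∈ χ.target := hz
    have h : s (χ.symm (z, 0)) = 0 := by
      rw [← hχ _ (χ.map_target hz'), χ.right_inv hz']
    rw [dif_pos h]
    exact χ.map_target hz'
  left_inv' x hx := by
    have h : ((χ x).1, (0 : E p)) = χ x := Prod.ext rfl ((hχ x hx).trans x.2).symm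
    have h2 : χ.symm ((χ x).1, (0 : E p)) = x := by rw [h, χ.left_inv hx]
    have h3 : s (χ.symm ((χ x).1, (0 : E p))) = 0 := by rw [h2, x.2]
    rw [dif_pos h3]
    exact Subtype.ext h2
  right_inv' z hz := by
    have hz' : (z, (0 : E p)) ∈ χ.target := hz
    have h : s (χ.symm (z, 0)) = 0 := by
      rw [← hχ _ (χ.map_target hz'), χ.right_inv hz']
    rw [dif_pos h]
    show (χ (χ.symm (z, 0))).1 = z
    rw [χ.right_inv hz']
  open_source := χ.open_source.preimage continuous_subtype_val
  open_target := χ.open_target.preimage (by fun_prop : Continuous fun z : E k => (z, (0 : E p)))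
  continuousOn_toFun :=
    continuous_fst.comp_continuousOn
      (χ.continuousOn.comp continuous_subtype_val.continuousOn fun _ hx => hx)
  continuousOn_invFun := by
    rw [IsEmbedding.subtypeVal.continuousOn_iff]
    have h1 : ContinuousOn (fun z : E k => χ.symm (z, (0 : E p)))
        {z | (z, (0 : E p)) ∈ χ.target} :=
      χ.continuousOn_symm.comp (by fun_prop) fun _ hz => hz
    refine h1.congr fun z hz => ?_
    have hz' : (z, (0 : E p)) ∈ χ.target := hz
    have h : s (χ.symm (z, 0)) = 0 := by
      rw [← hχ _ (χ.map_target hz'), χ.right_inv hz']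
    simp only [Function.comp_apply, dif_pos h]

variable {s : M → E p} {χ : {x : M // s x = 0} → OpenPartialHomeomorph M (E k × E p)}

lemma sliceChart_symm_coe {χ : OpenPartialHomeomorph M (E k × E p)}
    (hχ : ∀ x ∈ χ.source, (χ x).2 = s x) (m : {x : M // s x = 0}) {z : E k}
    (hz : (z, (0 : E p)) ∈ χ.target) : ((sliceChart χ hχ m).symm z : M) = χ.symm (z, 0) := by
  have h : s (χ.symm (z, 0)) = 0 := by
    rw [← hχ _ (χ.map_target hz), χ.right_inv hz]
  show ((open Classical in if h : s (χ.symm (z, 0)) = 0 then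
    (⟨χ.symm (z, 0), h⟩ : {x : M // s x = 0}) else m : {x : M // s x = 0}) : M) = _
  rw [dif_pos h]

/-- The level set `{s = 0}` as a charted space. -/
abbrev sliceChartedSpace (hχ : ∀ m, ∀ x ∈ (χ m).source, (χ m x).2 = s x)
    (hmem : ∀ m, (m : M) ∈ (χ m).source) : ChartedSpace (E k) {x : M // s x = 0} where
  atlas := range fun m => sliceChart (χ m) (hχ m) m
  chartAt m := sliceChart (χ m) (hχ m) m
  mem_chart_source m := hmem m
  chart_mem_atlas m := mem_range_self m

variable [ChartedSpace (E n) M]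

/-- On its domain, a transition map is the first component of a transition χ' ∘ χ⁻¹ restricted to E
k × {0}. -/
lemma slice_isManifold
    (hχ : ∀ m, ∀ x ∈ (χ m).source, (χ m x).2 = s x)
    (hmem : ∀ m, (m : M) ∈ (χ m).source)
    (hsmooth : ∀ m, ContMDiffOn (𝓡 n) 𝓘(ℝ, E k × E p) ∞ (χ m) (χ m).source)
    (hsymm : ∀ m, ContMDiffOn 𝓘(ℝ, E k × E p) (𝓡 n) ∞ (χ m).symm (χ m).target) :
    @IsManifold ℝ _ (E k) _ _ (E k) _ (𝓡 k) ∞ {x : M // s x = 0} _ (sliceChartedSpace hχ hmem) := by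
  let _ := sliceChartedSpace hχ hmem
  refine isManifold_of_contDiffOn _ _ _ ?_
  rintro _ _ ⟨m, rfl⟩ ⟨m', rfl⟩
  simp only [modelWithCornersSelf_coe, modelWithCornersSelf_coe_symm, Function.comp_id,
    Function.id_comp, preimage_id, range_id, inter_univ]
  rintro z ⟨hz1, hz2⟩
  have hz1' : (z, (0 : E p)) ∈ (χ m).target := hz1
  have hc := sliceChart_symm_coe (hχ m) m hz1'
  have hz2' : (χ m).symm (z, 0) ∈ (χ m').source := by
    rw [← hc]; exact hz2
  have h1 : ContMDiffAt (𝓡 k) 𝓘(ℝ, E k × E p) ∞ (fun z : E k => (z, (0 : E p))) z :=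
    (contDiff_id.prodMk contDiff_const).contMDiff z
  have h2 := ((hsymm m).contMDiffAt ((χ m).open_target.mem_nhds hz1')).comp z h1
  have h3 := ((hsmooth m').contMDiffAt ((χ m').open_source.mem_nhds hz2')).comp z h2
  have h4 : ContDiffAt ℝ ∞ (fun z : E k => (χ m' ((χ m).symm (z, (0 : E p)))).1) z :=
    contDiff_fst.contDiffAt.comp z h3.contDiffAt
  refine (h4.congr_of_eventuallyEq ?_).contDiffWithinAt
  filter_upwards [(sliceChart (χ m) (hχ m) m).open_target.mem_nhds hz1] with y hy
  show (χ m' ((sliceChart (χ m) (hχ m) m).symm y : M)).1 = _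
  rw [sliceChart_symm_coe (hχ m) m hy]

lemma slice_contMDiff_val
    (hχ : ∀ m, ∀ x ∈ (χ m).source, (χ m x).2 = s x)
    (hmem : ∀ m, (m : M) ∈ (χ m).source)
    (hsymm : ∀ m, ContMDiffOn 𝓘(ℝ, E k × E p) (𝓡 n) ∞ (χ m).symm (χ m).target) :
    @ContMDiff ℝ _ (E k) _ _ (E k) _ (𝓡 k) {x : M // s x = 0} _ (sliceChartedSpace hχ hmem)
      (E n) _ _ (E n) _ (𝓡 n) M _ _ ∞ Subtype.val := by
  let _ := sliceChartedSpace hχ hmem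
  intro m
  rw [contMDiffAt_iff_source, modelWithCornersSelf_coe, range_id, contMDiffWithinAt_univ]
  set z₀ : E k := (χ m m).1
  have hmt : z₀ ∈ (sliceChart (χ m) (hχ m) m).target :=
    (sliceChart (χ m) (hχ m) m).map_source (hmem m)
  have hmt' : (z₀, (0 : E p)) ∈ (χ m).target := hmt
  have h1 : ContMDiffAt (𝓡 k) 𝓘(ℝ, E k × E p) ∞ (fun z : E k => (z, (0 : E p))) z₀ :=
    (contDiff_id.prodMk contDiff_const).contMDiff z₀
  have h2 := ((hsymm m).contMDiffAt ((χ m).open_target.mem_nhds hmt')).comp z₀ h1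
  refine h2.congr_of_eventuallyEq ?_
  filter_upwards [(sliceChart (χ m) (hχ m) m).open_target.mem_nhds hmt] with y hy
  exact sliceChart_symm_coe (hχ m) m hy

/-- In slice charts f is the first component of χ ∘ f, and the subspace topology gives continuity:
smoothness into the slice can be tested in M. -/
lemma contMDiffAt_slice
    (hχ : ∀ m, ∀ x ∈ (χ m).source, (χ m x).2 = s x)
    (hmem : ∀ m, (m : M) ∈ (χ m).source)
    (hsmooth : ∀ m, ContMDiffOn (𝓡 n) 𝓘(ℝ, E k × E p) ∞ (χ m) (χ m).source)
    {EP HP P : Type*}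
    [NormedAddCommGroup EP] [NormedSpace ℝ EP] [TopologicalSpace HP] {I : ModelWithCorners ℝ EP HP}
    [TopologicalSpace P] [ChartedSpace HP P] {f : P → {x : M // s x = 0}} {q : P}
    (hf : ContMDiffAt I (𝓡 n) ∞ (fun y => (f y : M)) q) :
    @ContMDiffAt ℝ _ EP _ _ HP _ I P _ _ (E k) _ _ (E k) _ (𝓡 k) {x : M // s x = 0} _
      (sliceChartedSpace hχ hmem) ∞ f q := by
  let _ := sliceChartedSpace hχ hmem
  rw [contMDiffAt_iff_target]
  refine ⟨IsEmbedding.subtypeVal.continuousAt_iff.2 hf.continuousAt, ?_⟩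
  have h1 := ((hsmooth (f q)).contMDiffAt ((χ (f q)).open_source.mem_nhds (hmem (f q)))).comp q hf
  exact (contDiff_fst.contMDiff _).comp q h1

end Slice

end GaussianHypersurface

namespace GaussianHypersurface

/-! ### The decomposition ℝⁿ⁺¹ = ℝᵏ⁺¹ × ℝᵖ -/

section Coordinates

variable {n k p : ℕ} (hk : k + p = n)

/-- The last `p` coordinates among the coordinates of `ℝⁿ⁺¹`. -/
def splitIndex : Fin (k + 1) ⊕ Fin p ≃ Fin (n + 1) :=
  finSumFinEquiv.trans (finCongr (by omega))

lemma splitIndex_inl (i : Fin (k + 1)) :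
    splitIndex hk (Sum.inl i) = ⟨i, by omega⟩ := by
  ext; simp [splitIndex]

lemma splitIndex_inr (j : Fin p) :
    splitIndex hk (Sum.inr j) = ⟨k + 1 + j, by omega⟩ := by
  ext; simp [splitIndex]

/-- The projection of `ℝⁿ⁺¹` to its first `k + 1` coordinates. -/
def headProj : E (n + 1) →L[ℝ] E (k + 1) :=
  LinearMap.toContinuousLinearMap
    { toFun := fun y => WithLp.toLp 2 fun i => y (splitIndex hk (Sum.inl i))
      map_add' := fun _ _ => by ext; simp
      map_smul' := fun _ _ => by ext; simp }

/-- The projection of `ℝⁿ⁺¹` to its last `p` coordinates. -/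
def tailProj : E (n + 1) →L[ℝ] E p :=
  LinearMap.toContinuousLinearMap
    { toFun := fun y => WithLp.toLp 2 fun j => y (splitIndex hk (Sum.inr j))
      map_add' := fun _ _ => by ext; simp
      map_smul' := fun _ _ => by ext; simp }

/-- The inclusion of `ℝᵏ⁺¹` as `ℝᵏ⁺¹ × {0}ᵖ`. -/
def headIncl : E (k + 1) →L[ℝ] E (n + 1) :=
  LinearMap.toContinuousLinearMap
    { toFun := fun z => WithLp.toLp 2 fun l => Sum.elim z (fun _ => 0) ((splitIndex hk).symm l)
      map_add' := fun a b => by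
        ext l
        rcases h : (splitIndex hk).symm l with i | j <;> simp [h]
      map_smul' := fun c a => by
        ext l
        rcases h : (splitIndex hk).symm l with i | j <;> simp [h] }

/-- The inclusion of `ℝᵖ` as `{0}ᵏ⁺¹ × ℝᵖ`. -/
def tailIncl : E p →L[ℝ] E (n + 1) :=
  LinearMap.toContinuousLinearMap
    { toFun := fun t => WithLp.toLp 2 fun l => Sum.elim (fun _ => 0) t ((splitIndex hk).symm l)
      map_add' := fun a b => by
        ext l
        rcases h : (splitIndex hk).symm l with i | j <;> simp [h]
      map_smul' := fun c a => by
        ext l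
        rcases h : (splitIndex hk).symm l with i | j <;> simp [h] }

lemma headProj_apply (y : E (n + 1)) (i : Fin (k + 1)) :
    headProj hk y i = y (splitIndex hk (Sum.inl i)) := rfl

lemma tailProj_apply (y : E (n + 1)) (j : Fin p) :
    tailProj hk y j = y (splitIndex hk (Sum.inr j)) := rfl

lemma headIncl_apply (z : E (k + 1)) (l : Fin (n + 1)) :
    headIncl hk z l = Sum.elim z (fun _ => 0) ((splitIndex hk).symm l) := rfl

lemma tailIncl_apply (t : E p) (l : Fin (n + 1)) :
    tailIncl hk t l = Sum.elim (fun _ => 0) t ((splitIndex hk).symm l) := rfl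

@[simp] lemma headProj_headIncl (z : E (k + 1)) : headProj hk (headIncl hk z) = z := by
  ext i; simp [headProj_apply, headIncl_apply]

@[simp] lemma tailProj_headIncl (z : E (k + 1)) : tailProj hk (headIncl hk z) = 0 := by
  ext i; simp [tailProj_apply, headIncl_apply]

@[simp] lemma headProj_tailIncl (t : E p) : headProj hk (tailIncl hk t) = 0 := by
  ext i; simp [headProj_apply, tailIncl_apply]

@[simp] lemma tailProj_tailIncl (t : E p) : tailProj hk (tailIncl hk t) = t := by
  ext i; simp [tailProj_apply, tailIncl_apply]

lemma headIncl_add_tailIncl (y : E (n + 1)) :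
    headIncl hk (headProj hk y) + tailIncl hk (tailProj hk y) = y := by
  ext l
  obtain ⟨s, rfl⟩ := (splitIndex hk).surjective l
  rcases s with i | j <;>
    simp [headIncl_apply, tailIncl_apply, headProj_apply, tailProj_apply]

lemma inner_eq_head_add_tail (y z : E (n + 1)) :
    inner ℝ y z = inner ℝ (headProj hk y) (headProj hk z) +
      inner ℝ (tailProj hk y) (tailProj hk z) := by
  simp only [PiLp.inner_apply, headProj_apply, tailProj_apply]
  rw [← (splitIndex hk).sum_comp, Fintype.sum_sum_type]

end Coordinates

section Translate

variable {n k p : ℕ} {M : Type*} [TopologicalSpace M] [ChartedSpace (E n) M]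
  {F N : M → E (n + 1)} {hk : k + p = n}

/-- Translation preserves tangent spaces, so the two unit normals agree up to sign. Their inner
product is continuous in t, takes only the values ±1, and is 1 at t = 0. -/
lemma normal_comp_eq_of_translate (hF : IsImmersedHypersurface F) (hN : IsGaussMap F N)
    {τ : M → E p → M} (hτ : Continuous fun q : M × E p => τ q.1 q.2) (hτ0 : ∀ x, τ x 0 = x)
    {J : E p →L[ℝ] E (n + 1)} (hτF : ∀ x t, F (τ x t) = F x + J t) (x : M) (t : E p) :
    N (τ x t) = N x := by
  have hpm : ∀ t, inner ℝ (N (τ x t)) (N x) = 1 ∨ inner ℝ (N (τ x t)) (N x) = -1 := by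
    intro t
    have hc : Continuous fun y => τ y t := hτ.comp (by fun_prop : Continuous fun y : M => (y, t))
    have hFc : F ∘ (fun y => τ y t) = fun y => F y + J t := funext fun y => hτF y t
    have hs : ContMDiffAt (𝓡 n) (𝓡 n) ∞ (fun y => τ y t) x := by
      refine contMDiffAt_of_comp_immersion hF hc.continuousAt ?_
      rw [hFc]
      exact (hF.smooth x).add contMDiffAt_const
    have hd : (mfderiv (𝓡 n) (𝓡 (n + 1)) F (τ x t)).comp
        (mfderiv (𝓡 n) (𝓡 n) (fun y => τ y t) x) = mfderiv (𝓡 n) (𝓡 (n + 1)) F x := by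
      have h1 := mfderiv_comp x ((hF.smooth (τ x t)).mdifferentiableAt (by simp))
        (hs.mdifferentiableAt (by simp))
      rw [hFc] at h1
      rw [← h1]
      have h2 := ((hF.smooth x).mdifferentiableAt (by simp)).hasMFDerivAt.add
        (hasMFDerivAt_const (J t) x)
      exact h2.mfderiv.trans (add_zero (mfderiv (𝓡 n) (𝓡 (n + 1)) F x : E n →L[ℝ] E (n + 1)))
    set a : ℝ := inner ℝ (N (τ x t)) (N x) with ha
    have hperp : inner ℝ (N (τ x t) - a • N x) (N x) = 0 := by
      rw [inner_sub_left, real_inner_smul_left, real_inner_self_eq_norm_sq, hN.norm_eq_one]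
      simp [ha]
    obtain ⟨w, hw⟩ := exists_mfderiv_eq_of_inner_eq_zero hF hN x hperp
    have h3 : inner ℝ (N (τ x t)) (N (τ x t) - a • N x) = 0 := by
      rw [← hw, ← hd]
      exact hN.orthogonal (τ x t) _
    rw [inner_sub_right, real_inner_smul_right, real_inner_self_eq_norm_sq, hN.norm_eq_one,
      ← ha] at h3
    have h4 : (a - 1) * (a + 1) = 0 := by linarith
    rcases mul_eq_zero.1 h4 with h | h
    · left; linarith
    · right; linarith
  have hone : inner ℝ (N (τ x t)) (N x) = 1 := by
    refine (hpm t).resolve_right fun hneg => ?_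
    have hcont : Continuous fun t => inner ℝ (N (τ x t)) (N x) :=
      (hN.smooth.continuous.comp (hτ.comp (by fun_prop : Continuous fun t : E p => (x, t)))).inner
        continuous_const
    have h0 : inner ℝ (N (τ x 0)) (N x) = 1 := by
      rw [hτ0, real_inner_self_eq_norm_sq, hN.norm_eq_one]; norm_num
    obtain ⟨s, hs⟩ := mem_range_of_exists_le_of_exists_ge hcont (c := 0)
      ⟨t, by rw [hneg]; norm_num⟩ ⟨0, by rw [h0]; norm_num⟩
    have hs' : inner ℝ (N (τ x s)) (N x) = 0 := hs
    rcases hpm s with h | h <;> rw [hs'] at h <;> norm_num at h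
  exact (inner_eq_one_iff_of_norm_eq_one (hN.norm_eq_one _) (hN.norm_eq_one _)).1 hone

end Translate

end GaussianHypersurface

namespace GaussianHypersurface

/-! ### Mean curvature of a cylinder -/

section Cylinder

variable {n k p : ℕ} {hk : k + p = n}

lemma inner_headIncl_left (z : E (k + 1)) (y : E (n + 1)) :
    inner ℝ (headIncl hk z) y = inner ℝ z (headProj hk y) := by
  simp [inner_eq_head_add_tail hk]

lemma inner_headIncl_add_tailIncl (a b : E (k + 1)) (s t : E p) :
    inner ℝ (headIncl hk a + tailIncl hk s) (headIncl hk b + tailIncl hk t) =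
      inner ℝ a b + inner ℝ s t := by
  simp [inner_eq_head_add_tail hk]

/-- In the product basis the Gram matrix is diag(G, 1) and the second fundamental form is diag(A,
0). -/
lemma formTrace_cylinder {Dg : E k →L[ℝ] E (k + 1)} (hDg : Function.Injective Dg)
    {Bg : E k →L[ℝ] E k →L[ℝ] E (k + 1)} {D : E k × E p →L[ℝ] E (n + 1)}
    {B : E k × E p →L[ℝ] E k × E p →L[ℝ] E (n + 1)}
    (hD : ∀ v, D v = headIncl hk (Dg v.1) + tailIncl hk v.2)
    (hB : ∀ v w, B v w = headIncl hk (Bg v.1 w.1)) (ν : E (n + 1)) :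
    formTrace D B ν ((EuclideanSpace.basisFun (Fin k) ℝ).toBasis.prod
        (EuclideanSpace.basisFun (Fin p) ℝ).toBasis) =
      formTrace Dg Bg (headProj hk ν) (EuclideanSpace.basisFun (Fin k) ℝ).toBasis := by
  unfold formTrace
  set b := (EuclideanSpace.basisFun (Fin k) ℝ).toBasis
  set G := Matrix.of fun i j : Fin k => inner ℝ (Dg (b i)) (Dg (b j)) with hG
  set A := Matrix.of fun i j : Fin k => inner ℝ (Bg (b i) (b j)) (headProj hk ν) with hA
  have hGu : IsUnit G.det := gram_isUnit_det hDg b.linearIndependent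
  have e1 : (Matrix.of fun i j : Fin k ⊕ Fin p => inner ℝ
      (D (b.prod (EuclideanSpace.basisFun (Fin p) ℝ).toBasis i))
      (D (b.prod (EuclideanSpace.basisFun (Fin p) ℝ).toBasis j))) =
      Matrix.fromBlocks G 0 0 1 := by
    ext i j
    rcases i with i | i <;> rcases j with j | j <;>
      simp only [Matrix.of_apply, hD, inner_headIncl_add_tailIncl, Matrix.fromBlocks_apply₁₁,
        Matrix.fromBlocks_apply₁₂, Matrix.fromBlocks_apply₂₁, Matrix.fromBlocks_apply₂₂]
    · simp [hG]
    · simp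
    · simp
    · simp [Matrix.one_apply, EuclideanSpace.inner_single_left]
  have e2 : (Matrix.of fun i j : Fin k ⊕ Fin p => inner ℝ
      (B (b.prod (EuclideanSpace.basisFun (Fin p) ℝ).toBasis i)
        (b.prod (EuclideanSpace.basisFun (Fin p) ℝ).toBasis j)) ν) =
      Matrix.fromBlocks A 0 0 0 := by
    ext i j
    rcases i with i | i <;> rcases j with j | j <;>
      simp [hB, inner_headIncl_left, hA]
  have e3 : (Matrix.fromBlocks G 0 0 (1 : Matrix (Fin p) (Fin p) ℝ))⁻¹ =
      Matrix.fromBlocks G⁻¹ 0 0 1 := by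
    apply Matrix.inv_eq_right_inv
    rw [Matrix.fromBlocks_multiply]
    simp [Matrix.mul_nonsing_inv _ hGu]
  rw [e1, e2, e3, Matrix.fromBlocks_multiply]
  simp [Matrix.trace, Fintype.sum_sum_type]

lemma hasFDerivAt_cylinder {g : E k → E (k + 1)} {q : E k × E p} (hg : DifferentiableAt ℝ g q.1) :
    HasFDerivAt (fun q : E k × E p => headIncl hk (g q.1) + tailIncl hk q.2)
      ((headIncl hk).comp ((fderiv ℝ g q.1).comp (ContinuousLinearMap.fst ℝ (E k) (E p))) +
        (tailIncl hk).comp (ContinuousLinearMap.snd ℝ (E k) (E p))) q :=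
  ((headIncl hk).hasFDerivAt.comp q (hg.hasFDerivAt.comp q hasFDerivAt_fst)).fun_add
    ((tailIncl hk).hasFDerivAt.comp q hasFDerivAt_snd)

lemma fderiv_fderiv_cylinder {g : E k → E (k + 1)} {q : E k × E p} (hg : ContDiffAt ℝ 2 g q.1)
    (v w : E k × E p) :
    fderiv ℝ (fderiv ℝ fun q : E k × E p => headIncl hk (g q.1) + tailIncl hk q.2) q v w =
      headIncl hk (fderiv ℝ (fderiv ℝ g) q.1 v.1 w.1) := by
  have hev : ∀ᶠ q' : E k × E p in 𝓝 q, DifferentiableAt ℝ g q'.1 := by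
    have h1 : ∀ᶠ z in 𝓝 q.1, DifferentiableAt ℝ g z := by
      filter_upwards [hg.eventually (by simp)] with z hz using hz.differentiableAt (by simp)
    exact continuousAt_fst.eventually h1
  have heq : (fderiv ℝ fun q : E k × E p => headIncl hk (g q.1) + tailIncl hk q.2) =ᶠ[𝓝 q]
      fun q => (headIncl hk).comp ((fderiv ℝ g q.1).comp (ContinuousLinearMap.fst ℝ (E k) (E p))) +
        (tailIncl hk).comp (ContinuousLinearMap.snd ℝ (E k) (E p)) := by
    filter_upwards [hev] with q' hq' using (hasFDerivAt_cylinder hq').fderiv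
  have h2 : HasFDerivAt (fun q : E k × E p => fderiv ℝ g q.1)
      ((fderiv ℝ (fderiv ℝ g) q.1).comp (ContinuousLinearMap.fst ℝ (E k) (E p))) q :=
    (fderiv_differentiableAt hg).hasFDerivAt.comp q hasFDerivAt_fst
  have h3 := ((hasFDerivAt_const (headIncl hk) q).clm_comp
    (h2.clm_comp (hasFDerivAt_const (ContinuousLinearMap.fst ℝ (E k) (E p)) q))).add_const
    ((tailIncl hk).comp (ContinuousLinearMap.snd ℝ (E k) (E p)))
  rw [heq.fderiv_eq, h3.fderiv]
  simp

variable {M M' : Type*} [TopologicalSpace M] [ChartedSpace (E n) M] [TopologicalSpace M']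
  [ChartedSpace (E k) M'] {F N : M → E (n + 1)} {G N' : M' → E (k + 1)}

lemma mfderiv_comp_cylinder (hF : ContMDiff (𝓡 n) (𝓡 (n + 1)) ∞ F)
    {Φ : M' × E p → M} (hΦ : ContMDiff ((𝓡 k).prod (𝓡 p)) (𝓡 n) ∞ Φ)
    (hG : ContMDiff (𝓡 k) (𝓡 (k + 1)) ∞ G)
    (hFΦ : ∀ m t, F (Φ (m, t)) = headIncl hk (G m) + tailIncl hk t) (q : M' × E p)
    (v : TangentSpace ((𝓡 k).prod (𝓡 p)) q) :
    mfderiv (𝓡 n) (𝓡 (n + 1)) F (Φ q) (mfderiv ((𝓡 k).prod (𝓡 p)) (𝓡 n) Φ q v) =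
      headIncl hk (mfderiv (𝓡 k) (𝓡 (k + 1)) G q.1 v.1) + tailIncl hk v.2 := by
  have h1 := mfderiv_comp q ((hF (Φ q)).mdifferentiableAt (by simp))
    ((hΦ q).mdifferentiableAt (by simp))
  have h2 : F ∘ Φ = (headIncl hk ∘ (G ∘ Prod.fst)) + (tailIncl hk ∘ Prod.snd) :=
    funext fun q => hFΦ q.1 q.2
  have h3 := ((headIncl hk).hasMFDerivAt.comp q
    (((hG q.1).mdifferentiableAt (by simp)).hasMFDerivAt.comp q
      (hasMFDerivAt_fst (I := 𝓡 k) (I' := 𝓡 p) q)) :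
      HasMFDerivAt ((𝓡 k).prod (𝓡 p)) (𝓡 (n + 1)) (headIncl hk ∘ (G ∘ Prod.fst)) q _)
  have h4 := ((tailIncl hk).hasMFDerivAt.comp q (hasMFDerivAt_snd (I := 𝓡 k) (I' := 𝓡 p) q) :
      HasMFDerivAt ((𝓡 k).prod (𝓡 p)) (𝓡 (n + 1)) (tailIncl hk ∘ Prod.snd) q _)
  rw [h2, (h3.add h4).mfderiv] at h1
  exact (congrArg (fun T : E k × E p →L[ℝ] E (n + 1) => T v) h1).symm

/-- M is parametrized by (z, t) ↦ Φ(c⁻¹ z, t) with c a chart of M'; independence of the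
parametrization reduces the claim to the block computation. -/
lemma meanCurvature_cylinder [IsManifold (𝓡 n) ∞ M] [IsManifold (𝓡 k) ∞ M']
    (hF : ContMDiff (𝓡 n) (𝓡 (n + 1)) ∞ F) (hN : IsGaussMap F N)
    {Φ : M' × E p → M} (hΦ : ContMDiff ((𝓡 k).prod (𝓡 p)) (𝓡 n) ∞ Φ)
    (hG : ContMDiff (𝓡 k) (𝓡 (k + 1)) ∞ G)
    (hGi : ∀ m, Function.Injective (mfderiv (𝓡 k) (𝓡 (k + 1)) G m))
    (hFΦ : ∀ m t, F (Φ (m, t)) = headIncl hk (G m) + tailIncl hk t) (m : M') (t : E p)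
    (hNΦ : headProj hk (N (Φ (m, t))) = N' m) :
    meanCurvature F N (Φ (m, t)) = meanCurvature G N' m := by
  set c := extChartAt (𝓡 k) m
  set z₀ : E k := c m
  set g : E k → E (k + 1) := G ∘ c.symm
  set ψ : E k × E p → M := fun q => Φ (c.symm q.1, q.2) with hψ
  have hcz : c.symm z₀ = m := extChartAt_to_inv m
  have hψ₀ : ψ (z₀, t) = Φ (m, t) := by simp only [hψ, hcz]
  have hcs : ContMDiffAt (𝓡 k) (𝓡 k) ∞ c.symm z₀ := by
    have h1 := contMDiffWithinAt_extChartAt_symm_range (I := 𝓡 k) (n := ∞) m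
      (mem_extChartAt_target m)
    rwa [modelWithCornersSelf_coe, range_id, contMDiffWithinAt_univ] at h1
  have hψs : ContMDiffAt 𝓘(ℝ, E k × E p) (𝓡 n) ∞ ψ (z₀, t) := by
    have h1 : ContMDiffAt 𝓘(ℝ, E k × E p) ((𝓡 k).prod (𝓡 p)) ∞
        (fun q : E k × E p => (c.symm q.1, q.2)) (z₀, t) :=
      (ContMDiffAt.comp (z₀, t) hcs contDiff_fst.contMDiff.contMDiffAt).prodMk
        contDiff_snd.contMDiff.contMDiffAt
    exact (hΦ _).comp (z₀, t) h1
  have hgs : ContDiffAt ℝ ∞ g z₀ := contMDiffAt_iff_contDiffAt.1 ((hG _).comp z₀ hcs)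
  have hFψ : F ∘ ψ = fun q => headIncl hk (g q.1) + tailIncl hk q.2 :=
    funext fun q => hFΦ _ _
  have hD : fderiv ℝ (F ∘ ψ) (z₀, t) = _ :=
    hFψ ▸ (hasFDerivAt_cylinder (hk := hk) (q := (z₀, t)) (hgs.differentiableAt (by simp))).fderiv
  have hgi : Function.Injective (fderiv ℝ g z₀) := by
    have h1 := mfderiv_eq_fderiv_comp_extChartAt_symm (hG m)
    intro a b hab
    apply hGi m
    rw [h1]
    exact hab
  have hDv : ∀ v, fderiv ℝ (F ∘ ψ) (z₀, t) v =
      headIncl hk (fderiv ℝ g z₀ v.1) + tailIncl hk v.2 := fun v => by rw [hD]; simp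
  have hDi : Function.Injective (fderiv ℝ (F ∘ ψ) (z₀, t)) := by
    rw [injective_iff_map_eq_zero]
    intro v hv
    rw [hDv] at hv
    have e1 := congrArg (headProj hk) hv
    have e2 := congrArg (tailProj hk) hv
    simp only [map_add, headProj_headIncl, headProj_tailIncl, tailProj_headIncl,
      tailProj_tailIncl, map_zero, add_zero, zero_add] at e1 e2
    exact Prod.ext (hgi (e1.trans (map_zero _).symm)) e2
  rw [← hψ₀, meanCurvature_eq_formTrace ((EuclideanSpace.basisFun (Fin k) ℝ).toBasis.prod
    (EuclideanSpace.basisFun (Fin p) ℝ).toBasis) (by simp [hk]) (hF _) (hN.orthogonal _) hψs hDi,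
    meanCurvature_eq_formTrace_chart (hG m), ← hNΦ, ← hψ₀]
  exact formTrace_cylinder hgi hDv (fun v w => by
    rw [hFψ]; exact fderiv_fderiv_cylinder (hgs.of_le two_le_infty) v w) _

end Cylinder

end GaussianHypersurface

namespace GaussianHypersurface

/-! ### From a product diffeomorphism to the splitting -/

section Splitting

variable {n k p : ℕ} {hk : k + p = n}

lemma coord_of_eq_headIncl_add_tailIncl {y : E (n + 1)} {z : E (k + 1)} {t : E p}
    (h : y = headIncl hk z + tailIncl hk t) :
    (∀ i : Fin (k + 1), y ⟨i, by omega⟩ = z i) ∧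
      ∀ j : Fin p, y ⟨k + 1 + j, by omega⟩ = t j := by
  constructor
  · intro i
    rw [← splitIndex_inl hk i, ← headProj_apply, h]
    simp
  · intro j
    rw [← splitIndex_inr hk j, ← tailProj_apply, h]
    simp

variable {M M' : Type*} [TopologicalSpace M] [ChartedSpace (E n) M] [TopologicalSpace M']
  [ChartedSpace (E k) M'] {F N : M → E (n + 1)} {G N' : M' → E (k + 1)} {lam : ℝ}

/-- Everything about M' is read off on the slice t = 0, where F and N are the inclusions of G and
N', so that ⟨F, N⟩ = ⟨G, N'⟩. -/
theorem splitsAs_of_diffeomorph [IsManifold (𝓡 k) ∞ M'] (hM : IsLambdaHypersurface F N lam)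
    (Φ : (M' × E p) ≃ₘ^∞⟮(𝓡 k).prod (𝓡 p), 𝓡 n⟯ M)
    (hFΦ : ∀ m t, F (Φ (m, t)) = headIncl hk (G m) + tailIncl hk t)
    (hNΦ : ∀ m t, N (Φ (m, t)) = headIncl hk (N' m)) :
    IsLambdaHypersurface G N' lam ∧ SplitsAs F N hk G N' := by
  have hF := hM.hypersurface
  have hN := hM.gaussMap
  have := hF.smoothManifold
  have := hF.t2
  have := hF.secondCountable
  have := hF.connected
  have hi : ContMDiff (𝓡 k) (𝓡 n) ∞ fun m : M' => Φ (m, 0) :=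
    Φ.contMDiff.comp (contMDiff_id.prodMk contMDiff_const)
  have hGeq : G = headProj hk ∘ F ∘ fun m => Φ (m, 0) := by ext1 m; simp [hFΦ]
  have hNeq : N' = headProj hk ∘ N ∘ fun m => Φ (m, 0) := by ext1 m; simp [hNΦ]
  have hG : ContMDiff (𝓡 k) (𝓡 (k + 1)) ∞ G := by
    rw [hGeq]
    exact (headProj hk).contDiff.contMDiff.comp (hF.smooth.comp hi)
  have hN's : ContMDiff (𝓡 k) (𝓡 (k + 1)) ∞ N' := by
    rw [hNeq]
    exact (headProj hk).contDiff.contMDiff.comp (hN.smooth.comp hi)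
  have hd := mfderiv_comp_cylinder hF.smooth Φ.contMDiff hG hFΦ
  have hd0 : ∀ (m : M') (a : E k), mfderiv (𝓡 n) (𝓡 (n + 1)) F (Φ (m, 0))
      (mfderiv ((𝓡 k).prod (𝓡 p)) (𝓡 n) Φ (m, 0) ((a, 0) : E k × E p)) =
      headIncl hk (mfderiv (𝓡 k) (𝓡 (k + 1)) G m a) := fun m a =>
    (hd (m, 0) ((a, 0) : E k × E p)).trans (by rw [map_zero, add_zero])
  have hGi : ∀ m, Function.Injective (mfderiv (𝓡 k) (𝓡 (k + 1)) G m) := by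
    intro m a b hab
    have h1 : Function.Injective (mfderiv ((𝓡 k).prod (𝓡 p)) (𝓡 n) Φ (m, 0)) :=
      (Φ.mfderivToContinuousLinearEquiv (by simp) (m, 0)).injective
    have h2 : ((a, 0) : E k × E p) = (b, 0) := by
      apply h1
      apply hF.immersion (Φ (m, 0))
      exact (hd0 m a).trans ((congrArg (headIncl hk) hab).trans (hd0 m b).symm)
    exact congrArg Prod.fst h2
  have hinner : ∀ m y, inner ℝ (N (Φ (m, 0))) (headIncl hk y) = inner ℝ (N' m) y := by
    intro m y
    rw [hNΦ, inner_headIncl_left, headProj_headIncl]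
  refine ⟨⟨⟨inferInstance, ?_, ?_, ?_, hG, hGi⟩, ⟨hN's, fun m => ?_, fun m v => ?_⟩, fun m => ?_⟩,
    Φ, fun q v w => ?_, fun m t => ⟨fun i => ⟨?_, ?_⟩, fun j => ⟨?_, ?_⟩⟩⟩
  · refine T2Space.of_injective_continuous (f := fun m => Φ (m, 0)) (fun a b hab => ?_)
      hi.continuous
    exact congrArg Prod.fst (Φ.injective hab)
  · have h1 : Topology.IsEmbedding fun m : M' => Φ (m, 0) :=
      Φ.toHomeomorph.isEmbedding.comp (isEmbedding_prodMkLeft 0)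
    exact h1.secondCountableTopology
  · have h1 : Function.Surjective fun x : M => (Φ.symm x).1 :=
      fun m => ⟨Φ (m, 0), by simp⟩
    exact h1.connectedSpace (continuous_fst.comp Φ.symm.continuous)
  · rw [← hN.norm_eq_one (Φ (m, 0)), hNΦ, ← sq_eq_sq₀ (norm_nonneg _) (norm_nonneg _),
      ← real_inner_self_eq_norm_sq, ← real_inner_self_eq_norm_sq, inner_headIncl_left,
      headProj_headIncl]
  · have h1 := hN.orthogonal (Φ (m, 0))
      (mfderiv ((𝓡 k).prod (𝓡 p)) (𝓡 n) Φ (m, 0) ((v, 0) : E k × E p))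
    exact (hinner m _).symm.trans
      ((congrArg (inner ℝ (N (Φ (m, 0)))) (hd0 m v)).symm.trans h1)
  · rw [← meanCurvature_cylinder hF.smooth hN Φ.contMDiff hG hGi hFΦ m 0 (by simp [hNΦ]),
      ← hM.weightedMeanCurvature_eq (Φ (m, 0))]
    congr 2
    rw [real_inner_comm, ← hinner, hFΦ, map_zero, add_zero, real_inner_comm]
  · unfold inducedMetric
    rw [hd, hd]
    exact inner_headIncl_add_tailIncl _ _ _ _
  · exact (coord_of_eq_headIncl_add_tailIncl (hFΦ m t)).1 i
  · exact (coord_of_eq_headIncl_add_tailIncl (hk := hk) (t := 0)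
      ((hNΦ m t).trans (by simp))).1 i
  · exact (coord_of_eq_headIncl_add_tailIncl (hFΦ m t)).2 j
  · exact (coord_of_eq_headIncl_add_tailIncl (hk := hk) (z := N' m) (t := 0)
      ((hNΦ m t).trans (by simp))).2 j

/-- L is the orthogonal projection onto the complement of ν, identified with ℝᵏ. -/
lemma exists_clm_ker_le_span {ν : E (k + 1)} (hν : ν ≠ 0) :
    ∃ L : E (k + 1) →L[ℝ] E k, ∀ u, L u = 0 → ∃ c : ℝ, c • ν = u := by
  have : Fact (Module.finrank ℝ (E (k + 1)) = k + 1) := ⟨by simp⟩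
  set K := (Submodule.span ℝ {ν})ᗮ with hK
  have hdim : Module.finrank ℝ K = Module.finrank ℝ (E k) := by
    rw [Submodule.finrank_orthogonal_span_singleton (n := k) hν]; simp
  refine ⟨((LinearEquiv.ofFinrankEq K (E k) hdim).toContinuousLinearEquiv : K →L[ℝ] E k).comp
    K.orthogonalProjectionOnto, fun u hu => ?_⟩
  have h1 : K.orthogonalProjectionOnto u = 0 := by simpa using hu
  rw [Submodule.orthogonalProjectionOnto_eq_zero_iff, hK, Submodule.orthogonal_orthogonal] at h1
  exact Submodule.mem_span_singleton.1 h1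

/-- Near every point, the last `p` coordinates of `F` are part of a chart when the last `p`
coordinates of the normal vanish. -/
lemma exists_chart_snd_eq_tailProj (hF : IsImmersedHypersurface F) (hN : IsGaussMap F N)
    (htail : ∀ x, tailProj hk (N x) = 0) (x : M) :
    ∃ χ : OpenPartialHomeomorph M (E k × E p), x ∈ χ.source ∧
      (∀ y ∈ χ.source, (χ y).2 = tailProj hk (F y)) ∧
      ContMDiffOn (𝓡 n) 𝓘(ℝ, E k × E p) ∞ χ χ.source ∧
      ContMDiffOn 𝓘(ℝ, E k × E p) (𝓡 n) ∞ χ.symm χ.target := by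
  have := hF.smoothManifold
  have hself : inner ℝ (headProj hk (N x)) (headProj hk (N x)) = 1 := by
    have h1 := inner_eq_head_add_tail hk (N x) (N x)
    rw [htail, real_inner_self_eq_norm_sq, hN.norm_eq_one] at h1
    simpa using h1.symm
  have hne : headProj hk (N x) ≠ 0 := by
    intro h
    rw [h, inner_zero_left] at hself
    norm_num at hself
  obtain ⟨L, hL⟩ := exists_clm_ker_le_span hne
  set T : E (n + 1) →L[ℝ] E k × E p := (L.comp (headProj hk)).prod (tailProj hk)
  set D : E n →L[ℝ] E (n + 1) := mfderiv (𝓡 n) (𝓡 (n + 1)) F x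
  have hTs : ContMDiff (𝓡 (n + 1)) 𝓘(ℝ, E k × E p) ∞ T := T.contDiff.contMDiff
  -- The kernel of T is spanned by the normal, whose tail vanishes, and no nonzero tangent vector is
  -- normal.
  have hinj : Function.Injective (T.comp D) := by
    rw [injective_iff_map_eq_zero]
    intro w hw
    have e1 : L (headProj hk (D w)) = 0 := congrArg Prod.fst hw
    have e2 : tailProj hk (D w) = 0 := congrArg Prod.snd hw
    obtain ⟨c, hc⟩ := hL _ e1
    have e3 : inner ℝ (N x) (D w) = 0 := hN.orthogonal x w
    rw [inner_eq_head_add_tail hk, e2, ← hc, inner_zero_right, real_inner_smul_right, hself] at e3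
    have hc0 : c = 0 := by simpa using e3
    have e4 : D w = 0 := by
      rw [← headIncl_add_tailIncl hk (D w), e2, ← hc, hc0]
      simp
    exact hF.immersion x (e4.trans (map_zero D).symm)
  have hdim : Module.finrank ℝ (E n) = Module.finrank ℝ (E k × E p) := by simp [hk]
  have hder : mfderiv (𝓡 n) 𝓘(ℝ, E k × E p) (T ∘ F) x =
      ((LinearEquiv.ofInjectiveOfFinrankEq (T.comp D : E n →ₗ[ℝ] E k × E p) hinj
        hdim).toContinuousLinearEquiv : E n →L[ℝ] E k × E p) := by
    rw [mfderiv_comp x ((hTs _).mdifferentiableAt (by simp))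
      ((hF.smooth _).mdifferentiableAt (by simp)), mfderiv_eq_fderiv, T.fderiv]
    rfl
  obtain ⟨χ, hx, hχ, hsymm⟩ := exists_local_inverse (hTs.comp hF.smooth) _ hder
  exact ⟨χ, hx, fun y hy => by rw [hχ y hy]; rfl,
    (hTs.comp hF.smooth).contMDiffOn.congr hχ, hsymm⟩

end Splitting

end GaussianHypersurface

namespace GaussianHypersurface

/-! ### The splitting theorem -/

section Main

variable {n k p : ℕ} {M : Type u} [TopologicalSpace M] [ChartedSpace (E n) M]
  {F N : M → E (n + 1)} {lam : ℝ}

/-- M' is the slice where the last p coordinates of F vanish, and Φ translates it. The inverse moves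
x back by its own last coordinates and records them. Both maps are smooth because their compositions
with the immersion F are explicit. -/
theorem exists_splitsAs (hM : IsLambdaHypersurface F N lam) (hproper : IsProperMap F)
    (hk : k + p = n) (htail : ∀ x, tailProj hk (N x) = 0) :
    ∃ (M' : Type u) (_ : TopologicalSpace M') (_ : ChartedSpace (E k) M') (G N' : M' → E (k + 1)),
      IsLambdaHypersurface G N' lam ∧ SplitsAs F N hk G N' := by
  have hF := hM.hypersurface
  have hN := hM.gaussMap
  obtain ⟨θ, hθ, hθ0, hθF, hθadd⟩ := exists_translation hF hN hproper
  have hmemW : ∀ t, tailIncl hk t ∈ tangentDirections N := fun t => by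
    refine mem_tangentDirections.2 fun x => ?_
    rw [inner_eq_head_add_tail hk, htail]
    simp
  set τ : M → E p → M := fun x t => θ x ⟨tailIncl hk t, hmemW t⟩ with hτdef
  have hτ : Continuous fun q : M × E p => τ q.1 q.2 :=
    hθ.comp (continuous_fst.prodMk (((tailIncl hk).continuous.comp continuous_snd).subtype_mk _))
  have hτ0 : ∀ x, τ x 0 = x := fun x => by
    have h1 : (⟨tailIncl hk 0, hmemW 0⟩ : tangentDirections N) = 0 := Subtype.ext (map_zero _)
    rw [hτdef]
    simp only [h1, hθ0]
  have hτF : ∀ x t, F (τ x t) = F x + tailIncl hk t := fun x t => hθF x _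
  have hτadd : ∀ x t s, τ (τ x t) s = τ x (t + s) := fun x t s => by
    simp only [hτdef, hθadd]
    congr 1
    exact Subtype.ext (map_add _ _ _).symm
  have hτN := normal_comp_eq_of_translate hF hN hτ hτ0 hτF
  choose χ hmem hχ hsmooth hsymm using exists_chart_snd_eq_tailProj hF hN htail
  set M' := {x : M // tailProj hk (F x) = 0}
  let _ : ChartedSpace (E k) M' := sliceChartedSpace (χ := fun m : M' => χ m)
    (fun m => hχ m) (fun m => hmem m)
  have : IsManifold (𝓡 k) ∞ M' := slice_isManifold (χ := fun m : M' => χ m)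
    (fun m => hχ m) (fun m => hmem m) (fun m => hsmooth m) (fun m => hsymm m)
  have hval : ContMDiff (𝓡 k) (𝓡 n) ∞ (Subtype.val : M' → M) :=
    slice_contMDiff_val (χ := fun m : M' => χ m)
      (fun m => hχ m) (fun m => hmem m) (fun m => hsymm m)
  have hs : ContMDiff (𝓡 n) (𝓡 p) ∞ fun x => tailProj hk (F x) :=
    (tailProj hk).contDiff.contMDiff.comp hF.smooth
  have hρmem : ∀ x, tailProj hk (F (τ x (-tailProj hk (F x)))) = 0 := fun x => by
    simp [hτF]
  set ρ : M → M' := fun x => ⟨τ x (-tailProj hk (F x)), hρmem x⟩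
  have hρs : ContMDiff (𝓡 n) (𝓡 k) ∞ ρ := fun x => by
    refine contMDiffAt_slice (χ := fun m : M' => χ m) (fun m => hχ m) (fun m => hmem m)
      (fun m => hsmooth m) (contMDiffAt_of_comp_immersion hF ?_ ?_)
    · exact (hτ.comp (continuous_id.prodMk hs.continuous.neg)).continuousAt
    · have h1 : F ∘ (fun y => (ρ y : M)) =
          fun y => F y + tailIncl hk (-tailProj hk (F y)) := funext fun y => hτF y _
      rw [h1]
      exact (hF.smooth x).add
        (((tailIncl hk).contDiff.contMDiff _).comp x (hs x).neg)
  have hΦs : ContMDiff ((𝓡 k).prod (𝓡 p)) (𝓡 n) ∞ fun q : M' × E p => τ q.1 q.2 := fun q => by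
    refine contMDiffAt_of_comp_immersion hF ?_ ?_
    · exact (hτ.comp ((continuous_subtype_val.comp continuous_fst).prodMk
        continuous_snd)).continuousAt
    · have h1 : F ∘ (fun q : M' × E p => τ q.1 q.2) =
          fun q => F q.1 + tailIncl hk q.2 := funext fun q => hτF _ _
      rw [h1]
      exact ((hF.smooth.comp (hval.comp contMDiff_fst)) q).add
        (((tailIncl hk).contDiff.contMDiff.comp contMDiff_snd) q)
  have htF : ∀ (m : M') t, tailProj hk (F (τ m t)) = t := fun m t => by
    simp [hτF, m.2]
  let Φ : (M' × E p) ≃ₘ^∞⟮(𝓡 k).prod (𝓡 p), 𝓡 n⟯ M :=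
    { toFun := fun q => τ q.1 q.2
      invFun := fun x => (ρ x, tailProj hk (F x))
      left_inv := fun q => by
        refine Prod.ext (Subtype.ext ?_) (htF q.1 q.2)
        show τ (τ q.1 q.2) (-tailProj hk (F (τ q.1 q.2))) = q.1
        rw [htF, hτadd, add_neg_cancel, hτ0]
      right_inv := fun x => by
        show τ (τ x (-tailProj hk (F x))) (tailProj hk (F x)) = x
        rw [hτadd, neg_add_cancel, hτ0]
      contMDiff_toFun := hΦs
      contMDiff_invFun := hρs.prodMk hs }
  refine ⟨M', inferInstance, inferInstance, fun m => headProj hk (F m),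
    fun m => headProj hk (N m), splitsAs_of_diffeomorph hM Φ (fun m t => ?_) fun m t => ?_⟩
  · show F (τ m t) = _
    have h1 := headIncl_add_tailIncl hk (F m)
    rw [m.2, map_zero, add_zero] at h1
    rw [hτF, h1]
  · show N (τ m t) = _
    have h1 := headIncl_add_tailIncl hk (N m)
    rw [htail, map_zero, add_zero] at h1
    rw [hτN, h1]

end Main

end GaussianHypersurface

end

open GaussianHypersurface in
theorem corollary1p2 {n p : ℕ} (hp : 1 ≤ p) (hpn : p ≤ n + 1)
    {M : Type u} [TopologicalSpace M] [ChartedSpace (E n) M]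
    (F N : M → E (n + 1)) (lam : ℝ)
    (hM : IsLambdaHypersurface F N lam)
    (hcomplete : IsCompleteHypersurface F)
    (hproper : IsProperMap F)
    -- the Gauss map lies in `x_{n+2-p} ≥ 0, …, x_{n+1} ≥ 0` (indices from `0` in the code)
    (hGauss : ∀ (x : M) (i : Fin (n + 1)), n + 1 - p ≤ (i : ℕ) → 0 ≤ N x i) :
    IsHyperplane F ∨
      ∃ (k : ℕ) (hk : k + p = n) (M' : Type u) (_ : TopologicalSpace M')
        (_ : ChartedSpace (E k) M') (G N' : M' → E (k + 1)),
        IsLambdaHypersurface G N' lam ∧ SplitsAs F N hk G N' := by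
  have hF := hM.hypersurface
  have hN := hM.gaussMap
  -- A single nonzero value of a single controlled coordinate already makes the Gauss map constant.
  by_cases h : ∃ (x₀ : M) (i : Fin (n + 1)), n + 1 - p ≤ (i : ℕ) ∧ N x₀ i ≠ 0
  · obtain ⟨x₀, i, hi, hne⟩ := h
    have hcoord : ∀ x, inner ℝ (EuclideanSpace.single i (1 : ℝ)) (N x) = N x i := fun x => by
      simp [EuclideanSpace.inner_single_left]
    refine Or.inl (isHyperplane_of_normal_const hF hN hproper
      (normal_const_of_inner_pos hM hproper (V := EuclideanSpace.single i 1)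
        (fun x => ?_) (x₀ := x₀) ?_))
    · rw [hcoord]
      exact hGauss x i hi
    · rwa [hcoord]
  · push Not at h
    -- For p = n + 1 all coordinates of N would vanish, against ‖N‖ = 1.
    have hpn' : p ≠ n + 1 := by
      rintro rfl
      obtain ⟨x⟩ := hF.connected.toNonempty
      have h0 : N x = 0 := PiLp.ext fun i => h x i (by omega)
      have h1 := hN.norm_eq_one x
      rw [h0, norm_zero] at h1
      exact zero_ne_one h1
    have hk : (n - p) + p = n := by omega
    refine Or.inr ⟨n - p, hk, exists_splitsAs hM hproper hk fun x => PiLp.ext fun j => ?_⟩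
    rw [tailProj_apply, splitIndex_inr]
    exact h x _ (by simp only []; omega)
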